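/- Let $N\ge 0$ be an even integer, let $\alpha\ge 0$ and $t\ge 0$, and write $\mathbb N=\{1,2,\dots\}$. For $x,y\in\mathbb Z$ let $$\Psi(x,y)=\alpha^2\oint_{|u|=r}\frac{du}{2\pi i}\oint_{|w|=R}\frac{dw}{2\pi i}\,\frac{u-w}{1-u-w}\,\frac{w^{1-x}e^{t(w-1)}}{(w-\alpha)(w-1)}\,\frac{u^{1-y}e^{t(u-1)}}{(u-\alpha)(u-1)},$$ where $r,R>\max\{1,\alpha,|1-\alpha|\}$ and $|r-R|>1$ (so both positively oriented circles enclose $0,1,\alpha,1-\alpha$, and $1-u-w\ne0$ on them). Let $\phi(x,y)=\mathbf 1_{x\le y}$ for $x,y\in\mathbb Z$ and $\phi(\dagger_k,y)=1$, where $\dagger_1,\dots,\dagger_N$ are additional (virtual) points. Put $$\mathcal X=\{1,\dots,N\}\times\mathbb N,\qquad \mathcal V=\{\dagger_1,\dots,\dagger_N\},\qquad \widetilde{\mathcal X}=\mathcal V\cup\mathcal X .$$ A finite set $A\subset\mathcal X$ is called a triangular array, $A\in\Lambda_N$, if for every $1\le k\le N$ it has exactly $k$ points $(k,z_1^k),\dots,(k,z_k^k)$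 with first coordinate $k$. In that case put, with $z^{k-1}_k:=\dagger_k$, $$\mathcal W_{N,0}(A|\emptyset)=\prod_{k=1}^N\det\big[\phi(z_i^{k-1},z_j^k)\big]_{1\le i,j\le k}\;\mathrm{Pf}\big[\Psi(z_i^N,z_j^N)\big]_{1\le i,j\le N};$$ this does not depend on the order in which the points of each row are listed. Define $L:\widetilde{\mathcal X}\times\widetilde{\mathcal X}\to\mathbb C^{2\times2}$ by $$L(\dagger_i,\dagger_j)=\begin{bmatrix}-1&0\\0&0\end{bmatrix}\mathbf 1_{i+1=j}+\begin{bmatrix}1&0\\0&0\end{bmatrix}\mathbf 1_{j+1=i},$$ $$L(\dagger_i,(j,x))=\begin{bmatrix}0&0\\ \phi(\dagger_i,x)&0\end{bmatrix}\mathbf 1_{i=j},\qquad L((i,x),\dagger_j)=-L(\dagger_j,(i,x))^T,$$ $$L((i,x),(j,y))=\begin{bmatrix}0&0\\ \phi(x,y)&0\end{bmatrix}\mathbf 1_{i+1=j}+\begin{bmatrix}0&-\phi(y,x)\\0&0\end{bmatrix}\mathbf 1_{j+1=i}+\begin{bmatrix}0&0\\0&\Psi(x,y)\end{bmatrix}\mathbf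 1_{i=j=N}$$ for $1\le i,j\le N$ and $x,y\in\mathbb N$. Then: (1) $L$ is skew-symmetric, i.e. $L_{ab}(p,q)=-L_{ba}(q,p)$, and for every finite $A\subset\mathcal X$ $$\mathrm{Pf}\big[L|_{\mathcal V\cup A}\big]=\begin{cases}\mathcal W_{N,0}(A|\emptyset)&\text{if }A\in\Lambda_N,\\0&\text{otherwise.}\end{cases}$$ (2) Suppose in addition $\alpha>0$ and $t>0$. Let $J(p,q)=\begin{bmatrix}0&1\\-1&0\end{bmatrix}\delta_{p,q}$ on $\mathcal X$, and let $J_{\mathcal X}$ be its extension by $0$ to $\widetilde{\mathcal X}$. The Fredholm Pfaffian $$\mathrm{Pf}[J_{\mathcal X}+L]=\sum_{n\ge0}\frac1{n!}\sum_{x_1,\dots,x_n\in\mathcal X}\mathrm{Pf}\big[L|_{(\dagger_1,\dots,\dagger_N,x_1,\dots,x_n)}\big]$$ converges absolutely and is nonzero; the infinite matrix $J_{\mathcal X}+L$ has exactly one two-sided inverse (a matrix $M$ for which all entries of $(J_{\mathcal X}+L)M$ and $M(J_{\mathcal X}+L)$ are absolutely convergent sums and both products are the identity); and the measure $$\mu_N(A)=\frac{\mathrm{Pf}[L|_{\mathcal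 V\cup A}]}{\mathrm{Pf}[J_{\mathcal X}+L]},\qquad A\subset\mathcal X\text{ finite},$$ is a Pfaffian point process with correlation kernel $$K=J+(J_{\mathcal X}+L)^{-1}\big|_{\mathcal X\times\mathcal X},$$ that is, $K$ is skew-symmetric and, for every finite $S\subset\mathcal X$, $\sum_{A\supseteq S}\mu_N(A)$ converges absolutely with sum $\mathrm{Pf}[K(p,q)]_{p,q\in S}$. Moreover, $\mu_N$ vanishes off $\Lambda_N$ and on $\Lambda_N$ equals a nonzero constant times $\mathcal W_{N,0}(\cdot|\emptyset)$. -/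

import Mathlib

noncomputable section

/-! ### Pfaffians -/

/-- Pfaffian of a matrix whose rows and columns are indexed by `ι × Fin 2`, the indices being listed
with `(i, 0), (i, 1)` adjacent for each `i : ι`:
`(1 / (2 ^ n n!)) ∑_σ sign σ ∏_i A (σ (i, 0)) (σ (i, 1))` with `n = |ι|`.
The value does not depend on the order in which the elements of `ι` are listed, because exchanging
two adjacent pairs of indices is an even permutation. -/
def pfPairs {ι : Type*} [Fintype ι] [DecidableEq ι]
    (A : Matrix (ι × Fin 2) (ι × Fin 2) ℂ) : ℂ :=
  ((2 : ℂ) ^ Fintype.card ι * (Nat.factorial (Fintype.card ι) : ℂ))⁻¹ *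
    ∑ σ : Equiv.Perm (ι × Fin 2),
      ((Equiv.Perm.sign σ : ℤ) : ℂ) * ∏ i : ι, A (σ (i, 0)) (σ (i, 1))

/-- Pfaffian of an `m × m` matrix, for `m` even: the ordered index set `Fin m` is cut into the
consecutive pairs `(2 i, 2 i + 1)`. -/
def pfFin {m : ℕ} (A : Matrix (Fin m) (Fin m) ℂ) : ℂ :=
  let e : Fin (m / 2) × Fin 2 → Fin m := fun p => ⟨2 * p.1.val + p.2.val, by
    have h1 := p.1.isLt
    have h2 := p.2.isLt
    omega⟩
  pfPairs fun p q => A (e p) (e q)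

/-- A `2 × 2`-matrix valued kernel. -/
abbrev Kernel2 (Z : Type*) := Z → Z → Matrix (Fin 2) (Fin 2) ℂ

/-- Skew-symmetry of a kernel: `K_{ab}(x, y) = -K_{ba}(y, x)`. -/
def Kernel2.IsSkew {Z : Type*} (K : Kernel2 Z) : Prop :=
  ∀ x y a b, K x y a b = -K y x b a

/-- `Pf [K (z i) (z j)]_{i, j}` for a finite family `z` of points. -/
def Kernel2.pfOn {Z ι : Type*} [Fintype ι] [DecidableEq ι] (K : Kernel2 Z) (z : ι → Z) : ℂ :=
  pfPairs fun p q => K (z p.1) (z q.1) p.2 q.2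

/-- `M` is the inverse of the (possibly infinite) matrix `T`: all the entries of `T M` and of `M T`
are given by unconditionally convergent sums, and both products are the identity. -/
def Kernel2.IsInverse {Z : Type*} [DecidableEq Z] (T M : Kernel2 Z) : Prop :=
  (∀ p q, HasSum (fun s => T p s * M s q) (if p = q then 1 else 0)) ∧
    (∀ p q, HasSum (fun s => M p s * T s q) (if p = q then 1 else 0))

/-- The kernel `J (x, y) = [0 1; -1 0] δ_{x, y}`. -/
def kernelJ (Z : Type*) [DecidableEq Z] : Kernel2 Z :=
  fun x y => if x = y then !![0, 1; -1, 0] else 0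

/-- `μ`, a complex measure on the subsets of `Z` charging only the finite ones (given by its values
at single configurations), is a Pfaffian point process with correlation kernel `K`: the kernel is
skew-symmetric, and for every finite set `S` of points the correlation function
`μ {A | S ⊆ A}` is (an unconditionally convergent sum) equal to `Pf [K (x, y)]_{x, y ∈ S}`. -/
def IsPfaffianPointProcess {Z : Type*} [DecidableEq Z] (μ : Finset Z → ℂ) (K : Kernel2 Z) : Prop :=
  K.IsSkew ∧ ∀ S : Finset Z,
    HasSum (fun A : {A : Finset Z // S ⊆ A} => μ A.1) (K.pfOn (fun x : S => (x : Z)))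

/-! ### The half-space TASEP kernel `Ψ` -/

/-- Both circles `|u| = r` and `|w| = R` surround `0, 1, α, 1 - α`, and `1 - u - w` does not vanish
when `u` runs over the first and `w` over the second. -/
structure AdmissibleRadii (α r R : ℝ) : Prop where
  one_lt_left : 1 < r
  one_lt_right : 1 < R
  alpha_lt_left : |α| < r
  alpha_lt_right : |α| < R
  one_sub_alpha_lt_left : |1 - α| < r
  one_sub_alpha_lt_right : |1 - α| < R
  separated : 1 < |r - R|

/-- `Ψ (x, y) = α² ∮_{|u| = r} du/(2πi) ∮_{|w| = R} dw/(2πi) (u - w)/(1 - u - w)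
  · w^{1-x} e^{t(w-1)} / ((w - α)(w - 1)) · u^{1-y} e^{t(u-1)} / ((u - α)(u - 1))`. -/
def Psi (α t r R : ℝ) (x y : ℤ) : ℂ :=
  (α : ℂ) ^ 2 * ((2 * (Real.pi : ℂ) * Complex.I)⁻¹ * ∮ u in C(0, r),
    ((2 * (Real.pi : ℂ) * Complex.I)⁻¹ * ∮ w in C(0, R),
      (u - w) / (1 - u - w) *
        (w ^ (1 - x) * Complex.exp (t * (w - 1)) / ((w - α) * (w - 1))) *
        (u ^ (1 - y) * Complex.exp (t * (u - 1)) / ((u - α) * (u - 1)))))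

/-! ### Triangular arrays and the measure `W_{N,0}(· | ∅)` -/

/-- `φ_k (x, y)`, which is `1_{x ≤ y}` for `x ∈ ℤ` and `1` if `x` is the virtual point `†_k`
(here `none`). -/
def phi : Option ℤ → ℤ → ℂ
  | some x, y => if x ≤ y then 1 else 0
  | none, _ => 1

/-- Triangular arrays with entries in `B`; the entry `z_i^k`, `1 ≤ i ≤ k ≤ N`, is
`z (k - 1) (i - 1)`. -/
abbrev TriArray (N : ℕ) (B : Type) := (k : Fin N) → Fin (k.val + 1) → B

/-- For `k : Fin N` (row `k + 1` in one-based counting) the row preceding it, completed by the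
virtual point: `(z_1^k, …, z_k^k, †_{k+1})`. -/
def prevRow {N : ℕ} (z : TriArray N ℤ) (k : Fin N) (i : Fin (k.val + 1)) : Option ℤ :=
  if h : i.val < k.val then
    some (z ⟨k.val - 1, by have := k.isLt; omega⟩ ⟨i.val, by simp only; omega⟩)
  else none

/-- The last row `(z_1^N, …, z_N^N)` of a triangular array. -/
def lastRow {N : ℕ} (z : TriArray N ℤ) (i : Fin N) : ℤ :=
  z ⟨N - 1, by have := i.isLt; omega⟩ ⟨i.val, by have := i.isLt; simp only; omega⟩

/-- `W_{N,0}(z | ∅) = ∏_k det [φ_k(z_i^{k-1}, z_j^k) ; φ_k(†_k, z_j^k)] · Pf [Ψ(z_i^N, z_j^N)]`. -/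
def weightW (N : ℕ) (α t r R : ℝ) (z : TriArray N ℤ) : ℂ :=
  (∏ k : Fin N, Matrix.det (Matrix.of fun i j : Fin (k.val + 1) => phi (prevRow z k i) (z k j))) *
    pfFin (Matrix.of fun i j : Fin N => Psi α t r R (lastRow z i) (lastRow z j))

/-! ### The state spaces and the kernel `L` -/

/-- The physical points `{1, …, N} × ℤ_{>0}`; the label `i` is represented by `i - 1 : Fin N`. -/
abbrev Phys (N : ℕ) := Fin N × ℕ+

/-- Virtual points `†_1, …, †_N` together with the physical points. -/
abbrev VPhys (N : ℕ) := Fin N ⊕ Phys N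

/-- `A ∈ Λ_N`: the `k`-th fiber of `A` has exactly `k` points, for `k = 1, …, N`. -/
def IsTriangular {N : ℕ} (A : Finset (Phys N)) : Prop :=
  ∀ k : Fin N, (A.filter fun p => p.1 = k).card = k.val + 1

/-- `z` lists, without repetition and in any order, the points of every fiber of `A`: the set `A`
is the triangular array `z`. -/
def Enumerates {N : ℕ} (z : TriArray N ℕ+) (A : Finset (Phys N)) : Prop :=
  (∀ k, Function.Injective (z k)) ∧ ∀ k x, (k, x) ∈ A ↔ ∃ i, z k i = x

/-- The entries of an array of positive integers as integers. -/
def TriArray.toInt {N : ℕ} (z : TriArray N ℕ+) : TriArray N ℤ := fun k i => ((z k i : ℕ) : ℤ)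

/-- The kernel `L` on virtual and physical points. -/
def kernelL (N : ℕ) (α t r R : ℝ) : Kernel2 (VPhys N)
  | .inl i, .inl j =>
      (if i.val + 1 = j.val then !![-1, 0; 0, 0] else 0) +
        (if j.val + 1 = i.val then !![1, 0; 0, 0] else 0)
  | .inl i, .inr (j, x) => if i = j then !![0, 0; phi none x, 0] else 0
  | .inr (i, x), .inl j => if j = i then -(!![0, 0; phi none x, 0]).transpose else 0
  | .inr (i, x), .inr (j, y) =>
      (if i.val + 1 = j.val then !![0, 0; phi (some x) y, 0] else 0) +
        (if j.val + 1 = i.val then !![0, -phi (some y) x; 0, 0] else 0) +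
        (if i.val + 1 = N ∧ j.val + 1 = N then !![0, 0; 0, Psi α t r R x y] else 0)

/-- `Pf [L restricted to V ∪ A]` for a finite set `A` of physical points. -/
def pfL (N : ℕ) (α t r R : ℝ) (A : Finset (Phys N)) : ℂ :=
  (kernelL N α t r R).pfOn (Sum.map id (fun p : A => (p : Phys N)))

/-- `J_X`: the kernel `J` restricted to the physical points, extended by zero. -/
def kernelJX (N : ℕ) : Kernel2 (VPhys N)
  | .inr p, .inr q => kernelJ (Phys N) p q
  | _, _ => 0

/-! ### The normalized measure -/

/-- The terms `(1/n!) Pf [L on (†_1, …, †_N, x_1, …, x_n)]` of the Fredholm Pfaffian of `J_X + L`,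
indexed by `n` and `(x_1, …, x_n) ∈ X^n`. -/
def fredholmTerm (N : ℕ) (α t r R : ℝ) (s : Σ n : ℕ, (Fin n → Phys N)) : ℂ :=
  (Nat.factorial s.1 : ℂ)⁻¹ * (kernelL N α t r R).pfOn (Sum.map id s.2)

/-- The Fredholm Pfaffian `Pf [J_X + L]`. -/
def fredholmPf (N : ℕ) (α t r R : ℝ) : ℂ := ∑' s, fredholmTerm N α t r R s

/-- `μ_N (A) = Pf [L restricted to V ∪ A] / Pf [J_X + L]`. -/
def muN (N : ℕ) (α t r R : ℝ) (A : Finset (Phys N)) : ℂ :=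
  pfL N α t r R A / fredholmPf N α t r R

/-- `J + M` restricted to the physical points. -/
def corrKernel (N : ℕ) (M : Kernel2 (VPhys N)) : Kernel2 (Phys N) :=
  fun p q => kernelJ (Phys N) p q + M (.inr p) (.inr q)

end

/-! ### Algebra of Pfaffians -/

/-! Factorization. If the Pfaffian of `L` over the virtual points and `A` is nonzero, the rows of
`A` have the right sizes: for each `k` there is a diagonal congruence that fixes `L` and has
determinant `2 ^ (1 + #row (k-1) - #row k)`, so row `k` has exactly one point more than row `k - 1`.
On a triangular array, the second components are moved cyclically along the chains `†_i, z_i^i, …,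
z_i^N`. The matrix then becomes block diagonal. One block is bipartite and gives the product of the
determinants of `φ`. The other is the direct sum of the virtual block `Θ` and of `Ψ` on the last
row, and gives `Pf Ψ`. All signs cancel.

Correlations. On a finite box, summing `Pf L` over the configurations that contain `S` gives `Pf (T
- J_S)` with `T = J_X + L`. Computing the Pfaffian of one bordered matrix by its two Schur
complements yields `Pf (T - J_S) = Pf T * Pf_S (J + T⁻¹)`. The passage to the infinite space rests
on an explicit inverse. The rows of `T M = 1` are recursions along weakly increasing paths: they are
solved by path counts and by the pairings of path counts with `Ψ`. What remains is an `N × N` system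
whose matrix `G` is the Gram matrix of `Ψ` against the path counts from the virtual points
(`hasSum_rowTerm_homSol`, `hasSum_rowTerm_parametrix`). If `Ψ` is cut off at height `n`, the
infinite inverse restricts to the inverse of the matrix of `T` on the box
(`kernelMatrix_mul_inverse`), and it converges as the cut-off is removed. Exponential decay of `Ψ`
gives absolute convergence.

Nondegeneracy. The analytic core is `det G ≠ 0`. Writing `e^{tζ} = 1 + ζ ∫ e^{sζ} ds` with `ζ = u +
w - 1` cancels the denominator of `Ψ` and exhibits `Ψ` as a time integral of Wronskians of contour
modes. Summation against the path counts replaces the modes by real functions `Q_k` with `Q_k' = (α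
- 1) Q_k + p_k + p_k'` and `Q_k(0) = 0`, where `p_k` is a polynomial of degree `k + 1` with `p_k(0)
= 0`. By de Bruijn's formula `Pf G` is, up to a nonzero factor, the integral of a symmetric
determinant over a cube of dimension `N / 2`. This determinant has no zero at distinct positive
times: a zero would give a combination `Q` of the `Q_k` with `N / 2` double zeros, and Rolle's
theorem together with a negative root of `p + p'` would give `p + p'` one zero more than its degree
allows (`eq_zero_of_double_zeros`).

Normalization. All configurations of nonzero weight have the same number of points, so the
correlation function at such a configuration is its own weight. If the total mass vanished, all
correlation functions and hence all weights would vanish, although the finite matrices are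
invertible (`tsum_fredholmTermOf_ne_zero`). -/

noncomputable section PfaffianAlgebra

open Equiv Finset

variable {ι κ : Type*} [Fintype ι] [DecidableEq ι] [Fintype κ] [DecidableEq κ]

/-- The Pfaffian `pfPairs` of an array given as a plain function. -/
def pfaff (A : ι × Fin 2 → ι × Fin 2 → ℂ) : ℂ := pfPairs (Matrix.of A)

/-- The polarized, unnormalized Pfaffian. -/
def pfPolar (A : ι → ι × Fin 2 → ι × Fin 2 → ℂ) : ℂ :=
  ∑ σ : Perm (ι × Fin 2), ((Perm.sign σ : ℤ) : ℂ) * ∏ i : ι, A i (σ (i, 0)) (σ (i, 1))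

theorem pfaff_eq_pfPolar (A : ι × Fin 2 → ι × Fin 2 → ℂ) :
    pfaff A = ((2 : ℂ) ^ Fintype.card ι * (Nat.factorial (Fintype.card ι) : ℂ))⁻¹ *
      pfPolar fun _ => A := rfl

theorem pfPolar_reindex (e : ι ≃ κ) (A : κ → κ × Fin 2 → κ × Fin 2 → ℂ) :
    (pfPolar fun i p q => A (e i) (e p.1, p.2) (e q.1, q.2)) = pfPolar A := by
  unfold pfPolar
  refine Fintype.sum_equiv (Equiv.permCongr (Equiv.prodCongr e (Equiv.refl (Fin 2)))) _ _ ?_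
  intro σ
  rw [Perm.sign_permCongr]
  congr 1
  refine Fintype.prod_equiv e _ _ fun i => ?_
  simp [Equiv.permCongr_apply, Prod.map]

theorem pfaff_reindex (e : ι ≃ κ) (A : κ × Fin 2 → κ × Fin 2 → ℂ) :
    (pfaff fun p q => A (e p.1, p.2) (e q.1, q.2)) = pfaff A := by
  rw [pfaff_eq_pfPolar, pfaff_eq_pfPolar, Fintype.card_congr e]
  congr 1
  exact pfPolar_reindex e fun _ => A

theorem pfPolar_comp_perm (τ : Perm (ι × Fin 2)) (A : ι → ι × Fin 2 → ι × Fin 2 → ℂ) :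
    (pfPolar fun i p q => A i (τ p) (τ q)) = ((Perm.sign τ : ℤ) : ℂ) * pfPolar A := by
  unfold pfPolar
  rw [Finset.mul_sum]
  refine Fintype.sum_equiv (Equiv.mulLeft τ) _ _ fun σ => ?_
  simp only [Equiv.coe_mulLeft, Perm.sign_mul, Perm.coe_mul, Function.comp_apply, Units.val_mul,
    Int.cast_mul]
  rw [← mul_assoc, ← mul_assoc, ← Int.cast_mul, ← Units.val_mul, Int.units_mul_self]
  simp

theorem pfaff_comp_perm (τ : Perm (ι × Fin 2)) (A : ι × Fin 2 → ι × Fin 2 → ℂ) :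
    (pfaff fun p q => A (τ p) (τ q)) = ((Perm.sign τ : ℤ) : ℂ) * pfaff A := by
  rw [pfaff_eq_pfPolar, pfaff_eq_pfPolar, pfPolar_comp_perm τ fun _ => A]
  ring

/-- Relabelling the slots by `π` amounts to moving both members of the pairs by the same `π`; a
permutation acting on two copies is even. -/
theorem pfPolar_comp_slot (π : Perm ι) (A : ι → ι × Fin 2 → ι × Fin 2 → ℂ) :
    (pfPolar fun i => A (π i)) = pfPolar A := by
  conv_rhs => rw [← pfPolar_reindex π A]
  have h := pfPolar_comp_perm (Equiv.prodCongr π (Equiv.refl (Fin 2))) fun i => A (π i)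
  have hs : Perm.sign (Equiv.prodCongr π (Equiv.refl (Fin 2))) = 1 := by
    have : (Equiv.prodCongr π (Equiv.refl (Fin 2))) = Equiv.prodCongrLeft fun _ : Fin 2 => π := by
      ext ⟨a, b⟩ <;> simp
    rw [this, Perm.sign_prodCongrLeft]
    simp
  rw [hs] at h
  simp only [Units.val_one, Int.cast_one, one_mul] at h
  rw [← h]
  rfl

theorem pfaff_smul_diag (f : ι × Fin 2 → ℂ) (A : ι × Fin 2 → ι × Fin 2 → ℂ) :
    (pfaff fun p q => f p * f q * A p q) = (∏ p, f p) * pfaff A := by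
  rw [pfaff_eq_pfPolar, pfaff_eq_pfPolar, mul_left_comm]
  congr 1
  unfold pfPolar
  rw [Finset.mul_sum]
  refine Finset.sum_congr rfl fun σ _ => ?_
  rw [← Equiv.prod_comp σ f, Fintype.prod_prod_type]
  simp only [Fin.prod_univ_two, Finset.prod_mul_distrib]
  ring

/-- A diagonal congruence multiplies the Pfaffian by its determinant, so an array that it fixes has
Pfaffian zero unless that determinant is one. This is the weight-counting device that excludes
configurations with wrong row sizes. -/
theorem pfaff_eq_zero_of_scaling (f : ι × Fin 2 → ℂ) (A : ι × Fin 2 → ι × Fin 2 → ℂ)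
    (hA : ∀ p q, f p * f q * A p q = A p q) (hf : ∏ p, f p ≠ 1) : pfaff A = 0 := by
  have h := pfaff_smul_diag f A
  have h2 : (fun p q => f p * f q * A p q) = A := by
    funext p q
    exact hA p q
  rw [h2] at h
  have h3 : (∏ p, f p - 1) * pfaff A = 0 := by
    linear_combination -h
  exact (mul_eq_zero.mp h3).resolve_left (sub_ne_zero.mpr hf)

/-- Congruence: `Pf (B A Bᵀ) = det B * Pf A`. -/
theorem pfPairs_congruence (B A : Matrix (ι × Fin 2) (ι × Fin 2) ℂ) :
    pfPairs (B * A * B.transpose) = B.det * pfPairs A := by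
  unfold pfPairs
  rw [mul_left_comm]
  congr 1
  have key : ∀ σ : Perm (ι × Fin 2), ∏ i : ι, (B * A * B.transpose) (σ (i, 0)) (σ (i, 1)) =
      ∑ f : ι → (ι × Fin 2) × (ι × Fin 2),
        ∏ i, (B (σ (i, 0)) (f i).1 * B (σ (i, 1)) (f i).2 * A (f i).1 (f i).2) := by
    intro σ
    rw [← Fintype.piFinset_univ]
    refine Eq.trans ?_ (Finset.prod_univ_sum (fun _ => univ)
      fun (i : ι) (f : (ι × Fin 2) × (ι × Fin 2)) =>
        B (σ (i, 0)) f.1 * B (σ (i, 1)) f.2 * A f.1 f.2)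
    refine Finset.prod_congr rfl fun i _ => ?_
    rw [Fintype.sum_prod_type, Matrix.mul_apply]
    rw [Finset.sum_comm]
    refine Finset.sum_congr rfl fun q _ => ?_
    rw [Matrix.mul_apply, Finset.sum_mul]
    refine Finset.sum_congr rfl fun p _ => ?_
    simp only [Matrix.transpose_apply]
    ring
  simp_rw [key, Finset.mul_sum]
  rw [Finset.sum_comm]
  -- A choice of two summation indices for every slot is a map `g` on the index set. The sum over
  -- `σ` is then the determinant of the columns of `B` selected by `g`, which vanishes unless `g` is
  -- a permutation.
  let E : (ι → (ι × Fin 2) × (ι × Fin 2)) ≃ (ι × Fin 2 → ι × Fin 2) :=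
    { toFun := fun f p => if p.2 = 0 then (f p.1).1 else (f p.1).2
      invFun := fun g i => (g (i, 0), g (i, 1))
      left_inv := fun f => by ext i <;> simp
      right_inv := fun g => by
        funext ⟨i, a⟩
        fin_cases a <;> simp }
  have h1 : ∀ f : ι → (ι × Fin 2) × (ι × Fin 2),
      ∑ σ : Perm (ι × Fin 2), ((Perm.sign σ : ℤ) : ℂ) *
        ∏ i, (B (σ (i, 0)) (f i).1 * B (σ (i, 1)) (f i).2 * A (f i).1 (f i).2) =
      (∏ i, A (E f (i, 0)) (E f (i, 1))) * (B.submatrix id (E f)).det := by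
    intro f
    rw [Matrix.det_apply', Finset.mul_sum]
    refine Finset.sum_congr rfl fun σ _ => ?_
    rw [Fintype.prod_prod_type]
    simp only [Fin.prod_univ_two, Finset.prod_mul_distrib, Matrix.submatrix_apply, id, E,
      Equiv.coe_fn_mk]
    simp
    ring
  simp_rw [h1]
  rw [E.sum_comp fun g => (∏ i, A (g (i, 0)) (g (i, 1))) * (B.submatrix id g).det]
  have h2 : ∀ g : ι × Fin 2 → ι × Fin 2, ¬ Function.Bijective g →
      (B.submatrix id g).det = 0 := by
    intro g hg
    rw [← Finite.injective_iff_bijective, Function.Injective] at hg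
    push Not at hg
    obtain ⟨i, j, hij, hne⟩ := hg
    exact Matrix.det_zero_of_column_eq hne fun k => by simp [hij]
  have h3 : ∑ g : ι × Fin 2 → ι × Fin 2, (∏ i, A (g (i, 0)) (g (i, 1))) *
      (B.submatrix id g).det = ∑ g : ι × Fin 2 → ι × Fin 2 with Function.Bijective g,
        (∏ i, A (g (i, 0)) (g (i, 1))) * (B.submatrix id g).det := by
    refine (Finset.sum_subset (Finset.filter_subset _ _) fun f _ hf => ?_).symm
    rw [h2 f (by simpa using hf), mul_zero]
  rw [h3]
  symm
  refine Finset.sum_bij (fun σ _ => (σ : ι × Fin 2 → ι × Fin 2))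
    (fun σ _ => by simp) (fun _ _ _ _ h => DFunLike.coe_injective h)
    (fun g hg => ⟨Equiv.ofBijective g (by simpa using hg), mem_univ _, rfl⟩) fun σ _ => ?_
  rw [Matrix.det_permute']
  ring

/-- If the slots in `κ` carry matrices supported on `κ`, the polarized Pfaffian factors. -/
theorem pfPolar_sum (A : ι ⊕ κ → (ι ⊕ κ) × Fin 2 → (ι ⊕ κ) × Fin 2 → ℂ)
    (hl : ∀ k i a q, A (.inr k) (.inl i, a) q = 0)
    (hr : ∀ k i a p, A (.inr k) p (.inl i, a) = 0) :
    pfPolar A = (pfPolar fun i p q => A (.inl i) (.inl p.1, p.2) (.inl q.1, q.2)) *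
      pfPolar fun k p q => A (.inr k) (.inr p.1, p.2) (.inr q.1, q.2) := by
  classical
  let d : (ι ⊕ κ) × Fin 2 ≃ ι × Fin 2 ⊕ κ × Fin 2 := Equiv.sumProdDistrib ι κ (Fin 2)
  let term : Perm (ι × Fin 2 ⊕ κ × Fin 2) → ℂ := fun τ => ((Perm.sign τ : ℤ) : ℂ) *
    ((∏ i : ι, A (.inl i) (d.symm (τ (.inl (i, 0)))) (d.symm (τ (.inl (i, 1))))) *
      ∏ k : κ, A (.inr k) (d.symm (τ (.inr (k, 0)))) (d.symm (τ (.inr (k, 1)))))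
  have h0 : pfPolar A = ∑ τ, term τ := by
    unfold pfPolar
    refine Fintype.sum_equiv d.permCongr _ _ fun σ => ?_
    simp only [term, Perm.sign_permCongr, Fintype.prod_sum_type, Equiv.permCongr_apply,
      Equiv.symm_apply_apply]
    rfl
  -- A permutation that does not preserve the two blocks puts an index of the first block into a
  -- slot of `κ`, where the matrix of that slot vanishes.
  have h1 : ∑ τ, term τ = ∑ τ ∈ (((Perm.sumCongrHom (ι × Fin 2) (κ × Fin 2)).range :
      Set (Perm (ι × Fin 2 ⊕ κ × Fin 2)))).toFinset, term τ := by
    refine (Finset.sum_subset (Finset.subset_univ _) ?_).symm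
    rintro τ - hτ
    have hτ1 : ¬ Set.MapsTo τ (Set.range Sum.inr) (Set.range Sum.inr) := by
      rw [← Perm.perm_mapsTo_inl_iff_mapsTo_inr]
      rw [Set.mem_toFinset] at hτ
      exact mt Perm.mem_sumCongrHom_range_of_perm_mapsTo_inl hτ
    have hτ2 : ∃ k a, ∃ p, τ (.inr (k, a)) = .inl p := by
      by_contra hcon
      push Not at hcon
      apply hτ1
      rintro _ ⟨⟨k, a⟩, rfl⟩
      rcases hx : τ (.inr (k, a)) with p | q
      · exact absurd hx (hcon k a p)
      · exact ⟨q, rfl⟩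
    obtain ⟨k, a, ⟨i, b⟩, hk⟩ := hτ2
    have hd : d.symm (.inl (i, b)) = (.inl i, b) := rfl
    have hz : A (.inr k) (d.symm (τ (.inr (k, 0)))) (d.symm (τ (.inr (k, 1)))) = 0 := by
      fin_cases a
      · simp only [Fin.zero_eta] at hk
        rw [hk, hd, hl]
      · simp only [Fin.mk_one] at hk
        rw [hk, hd, hr]
    simp only [term]
    rw [Finset.prod_eq_zero (Finset.mem_univ k) hz]
    simp
  rw [h0, h1]
  unfold pfPolar
  simp_rw [Finset.sum_mul_sum, ← Finset.sum_product', Finset.univ_product_univ]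
  symm
  refine Finset.sum_nbij (fun σ ↦ σ.fst.sumCongr σ.snd) ?_ ?_ ?_ ?_
  · intro σ₁₂ _
    rw [Set.mem_toFinset]
    exact ⟨σ₁₂, rfl⟩
  · intro σ₁ _ σ₂ _
    dsimp only
    intro h
    have h2 : ∀ x, Perm.sumCongr σ₁.fst σ₁.snd x = Perm.sumCongr σ₂.fst σ₂.snd x :=
      DFunLike.congr_fun h
    simp only [Sum.map_inr, Sum.map_inl, Perm.sumCongr_apply, Sum.forall, Sum.inl.injEq,
      Sum.inr.injEq] at h2
    ext x : 2
    · exact h2.left x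
    · exact h2.right x
  · intro σ hσ
    rw [mem_coe, Set.mem_toFinset] at hσ
    obtain ⟨σ₁₂, hσ₁₂⟩ := hσ
    use σ₁₂
    rw [← hσ₁₂]
    simp
  · rintro ⟨σ₁, σ₂⟩ -
    simp only [term, Perm.sign_sumCongr, Units.val_mul, Int.cast_mul, Perm.sumCongr_apply,
      Sum.map_inl, Sum.map_inr]
    have e1 : ∀ p : ι × Fin 2, d.symm (.inl p) = (.inl p.1, p.2) := fun _ => rfl
    have e2 : ∀ p : κ × Fin 2, d.symm (.inr p) = (.inr p.1, p.2) := fun _ => rfl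
    simp only [e1, e2]
    ring

theorem pfPolar_add (A B : ι × Fin 2 → ι × Fin 2 → ℂ) :
    (pfPolar fun _ : ι => A + B) =
      ∑ s : Finset ι, pfPolar fun i => if i ∈ s then A else B := by
  unfold pfPolar
  rw [Finset.sum_comm]
  refine Finset.sum_congr rfl fun σ _ => ?_
  rw [← Finset.mul_sum]
  congr 1
  simp only [Pi.add_apply]
  rw [Finset.prod_add]
  simp only [Finset.powerset_univ]
  refine Finset.sum_congr rfl fun s _ => ?_
  rw [← Finset.prod_mul_prod_compl s]
  congr 1
  · exact Finset.prod_congr rfl fun i hi => by rw [if_pos hi]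
  · rw [Finset.compl_eq_univ_sdiff]
    exact Finset.prod_congr rfl fun i hi => by rw [if_neg (Finset.mem_sdiff.mp hi).2]

theorem pfPolar_ite_of_card_eq (A B : ι × Fin 2 → ι × Fin 2 → ℂ) {s t : Finset ι}
    (h : s.card = t.card) :
    (pfPolar fun i => if i ∈ s then A else B) = pfPolar fun i => if i ∈ t then A else B := by
  obtain ⟨π, hπ⟩ : ∃ π : Perm ι, ∀ i, i ∈ s ↔ π i ∈ t := by
    have e : {i // i ∈ s} ≃ {i // i ∈ t} := Finset.equivOfCardEq h
    refine ⟨e.extendSubtype, fun i => ?_⟩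
    by_cases hi : i ∈ s
    · simp only [hi, true_iff]
      exact e.extendSubtype_mem i hi
    · simp only [hi, false_iff]
      exact e.extendSubtype_not_mem i hi
  rw [← pfPolar_comp_slot π fun i => if i ∈ t then A else B]
  simp only [hπ]

/-- Block diagonal Pfaffians. -/
theorem pfaff_sum (A : (ι ⊕ κ) × Fin 2 → (ι ⊕ κ) × Fin 2 → ℂ)
    (hl : ∀ i a k b, A (.inl i, a) (.inr k, b) = 0)
    (hr : ∀ i a k b, A (.inr k, b) (.inl i, a) = 0) :
    pfaff A = (pfaff fun p q : ι × Fin 2 => A (.inl p.1, p.2) (.inl q.1, q.2)) *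
      pfaff fun p q : κ × Fin 2 => A (.inr p.1, p.2) (.inr q.1, q.2) := by
  let X : (ι ⊕ κ) × Fin 2 → (ι ⊕ κ) × Fin 2 → ℂ := fun p q =>
    if p.1.isLeft ∧ q.1.isLeft then A p q else 0
  let Y : (ι ⊕ κ) × Fin 2 → (ι ⊕ κ) × Fin 2 → ℂ := fun p q =>
    if p.1.isRight ∧ q.1.isRight then A p q else 0
  have hA : A = X + Y := by
    funext ⟨p, a⟩ ⟨q, b⟩
    rcases p with p | p <;> rcases q with q | q <;> simp [X, Y, hl, hr]
  let s₀ : Finset (ι ⊕ κ) := Finset.univ.map Function.Embedding.inl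
  have hs₀ : s₀.card = Fintype.card ι := by simp [s₀]
  -- In a nonzero term each slot is filled by two indices of one block, so the slots carrying `X`
  -- use up exactly the indices of the first block.
  have hX : ∀ σ : Perm ((ι ⊕ κ) × Fin 2), ∀ s : Finset (ι ⊕ κ),
      (∏ i, (if i ∈ s then X else Y) (σ (i, 0)) (σ (i, 1))) ≠ 0 → s.card = Fintype.card ι := by
    intro σ s hne
    have hi : ∀ i, (if i ∈ s then X else Y) (σ (i, 0)) (σ (i, 1)) ≠ 0 := fun i =>
      (Finset.prod_ne_zero_iff.mp hne) i (mem_univ i)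
    have hmem : ∀ p : (ι ⊕ κ) × Fin 2, p.1 ∈ s ↔ (σ p).1.isLeft := by
      rintro ⟨i, a⟩
      have := hi i
      by_cases his : i ∈ s
      · rw [if_pos his] at this
        have h2 := (ite_ne_right_iff.mp this).1
        simp only [his, true_iff]
        fin_cases a
        · exact h2.1
        · exact h2.2
      · rw [if_neg his] at this
        have h2 := (ite_ne_right_iff.mp this).1
        simp only [his, false_iff]
        fin_cases a
        · simpa using h2.1
        · simpa using h2.2
    have hc : (s ×ˢ (univ : Finset (Fin 2))).card = (s₀ ×ˢ (univ : Finset (Fin 2))).card := by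
      refine Finset.card_bij (fun p _ => σ p) ?_ (fun _ _ _ _ h => σ.injective h) ?_
      · intro p hp
        have := (hmem p).mp (by simpa using hp)
        rw [Finset.mem_product]
        refine ⟨?_, mem_univ _⟩
        rcases hσ : (σ p).1 with x | x
        · simp [s₀]
        · simp [hσ] at this
      · intro q hq
        refine ⟨σ.symm q, ?_, by simp⟩
        rw [Finset.mem_product]
        refine ⟨(hmem _).mpr ?_, mem_univ _⟩
        rw [Finset.mem_product] at hq
        obtain ⟨x, -, hx⟩ := Finset.mem_map.mp hq.1
        simp only [Equiv.apply_symm_apply]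
        rw [← hx]
        rfl
    rw [Finset.card_product, Finset.card_product] at hc
    simp only [card_univ, Fintype.card_fin] at hc
    omega
  have hzero : ∀ s : Finset (ι ⊕ κ), s.card ≠ Fintype.card ι →
      (pfPolar fun i => if i ∈ s then X else Y) = 0 := by
    intro s hs
    refine Finset.sum_eq_zero fun σ _ => ?_
    by_contra hne
    exact hs (hX σ s (right_ne_zero_of_mul hne))
  have hfac : (pfPolar fun i => if i ∈ s₀ then X else Y) =
      (pfPolar fun _ : ι => (fun p q : ι × Fin 2 => A (.inl p.1, p.2) (.inl q.1, q.2))) *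
        pfPolar fun _ : κ => (fun p q : κ × Fin 2 => A (.inr p.1, p.2) (.inr q.1, q.2)) := by
    rw [pfPolar_sum]
    · congr 2
      · funext i p q
        simp [s₀, X]
      · funext i p q
        simp [s₀, Y]
    · intro k i a q
      simp [s₀, Y]
    · intro k i a q
      simp [s₀, Y]
  -- All admissible sets of slots contribute equally; their binomial number reconciles the three
  -- factorial normalizations.
  have hsum : (pfPolar fun _ : ι ⊕ κ => A) = ((Fintype.card (ι ⊕ κ)).choose (Fintype.card ι) : ℂ) *
      pfPolar fun i => if i ∈ s₀ then X else Y := by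
    rw [hA, pfPolar_add]
    rw [← Finset.sum_subset (Finset.subset_univ
      (Finset.powersetCard (Fintype.card ι) (univ : Finset (ι ⊕ κ))))]
    · rw [Finset.sum_congr rfl (g := fun _ => pfPolar fun i => if i ∈ s₀ then X else Y)]
      · rw [Finset.sum_const, Finset.card_powersetCard, nsmul_eq_mul, Finset.card_univ]
      · intro s hs
        exact pfPolar_ite_of_card_eq X Y ((Finset.mem_powersetCard.mp hs).2.trans hs₀.symm)
    · intro s _ hs
      apply hzero
      simpa [Finset.mem_powersetCard] using hs
  rw [pfaff_eq_pfPolar, pfaff_eq_pfPolar, pfaff_eq_pfPolar, hsum, hfac, Fintype.card_sum]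
  have hch := Nat.choose_mul_factorial_mul_factorial
    (Nat.le_add_right (Fintype.card ι) (Fintype.card κ))
  rw [Nat.add_sub_cancel_left] at hch
  have hch' : (((Fintype.card ι + Fintype.card κ).choose (Fintype.card ι) : ℕ) : ℂ) *
      (Fintype.card ι).factorial * (Fintype.card κ).factorial =
        (Fintype.card ι + Fintype.card κ).factorial := by exact_mod_cast hch
  have f1 : ((Fintype.card ι).factorial : ℂ) ≠ 0 := by exact_mod_cast Nat.factorial_ne_zero _
  have f2 : ((Fintype.card κ).factorial : ℂ) ≠ 0 := by exact_mod_cast Nat.factorial_ne_zero _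
  have f3 : ((Fintype.card ι + Fintype.card κ).factorial : ℂ) ≠ 0 := by
    exact_mod_cast Nat.factorial_ne_zero _
  rw [pow_add, ← hch']
  rw [← hch'] at f3
  have f4 := left_ne_zero_of_mul (left_ne_zero_of_mul f3)
  field_simp

end PfaffianAlgebra

/-! ### Pfaffians of kernels: Fredholm expansion and Schur complements. -/

noncomputable section PfaffianKernels

set_option linter.unusedSectionVars false

open Equiv Finset

variable {ι κ : Type*} [Fintype ι] [DecidableEq ι] [Fintype κ] [DecidableEq κ]

/-- The standard symplectic `2 × 2` matrix as a plain function. -/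
def sympl (a b : Fin 2) : ℂ := (!![0, 1; -1, 0] : Matrix (Fin 2) (Fin 2) ℂ) a b

@[simp] theorem sympl_zero_zero : sympl 0 0 = 0 := rfl
@[simp] theorem sympl_zero_one : sympl 0 1 = 1 := rfl
@[simp] theorem sympl_one_zero : sympl 1 0 = -1 := rfl
@[simp] theorem sympl_one_one : sympl 1 1 = 0 := rfl

theorem pfPolar_unit (A : Unit × Fin 2 → Unit × Fin 2 → ℂ) :
    (pfPolar fun _ => A) = A ((), 0) ((), 1) - A ((), 1) ((), 0) := by
  unfold pfPolar
  have h : (univ : Finset (Perm (Unit × Fin 2))) = {1, Equiv.swap ((), 0) ((), 1)} := by decide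
  have hne : (1 : Perm (Unit × Fin 2)) ≠ Equiv.swap ((), 0) ((), 1) := by decide
  rw [h, Finset.sum_pair hne, Perm.sign_swap (by decide)]
  simp
  ring

/-- In the expansion over slots at most one slot carries the added block, since two of them would
need four distinct indices at one point. That slot may be any of the `card ι + 1` slots and
contributes `1 - (-1) = 2`; the normalization absorbs both factors. -/
theorem pfaff_add_sympl_unit (A : (ι ⊕ Unit) × Fin 2 → (ι ⊕ Unit) × Fin 2 → ℂ) :
    (pfaff fun p q => A p q +
      if p.1 = .inr () ∧ q.1 = .inr () then sympl p.2 q.2 else 0) =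
    pfaff A + pfaff fun p q : ι × Fin 2 => A (.inl p.1, p.2) (.inl q.1, q.2) := by
  set Y : (ι ⊕ Unit) × Fin 2 → (ι ⊕ Unit) × Fin 2 → ℂ := fun p q =>
    if p.1 = .inr () ∧ q.1 = .inr () then sympl p.2 q.2 else 0 with hY
  have hYs : ∀ p q, Y p q ≠ 0 → p.1 = .inr () ∧ q.1 = .inr () := by
    intro p q h
    by_contra hcon
    exact h (by simp only [hY, if_neg hcon])
  have hzero : ∀ s : Finset (ι ⊕ Unit), s ≠ univ → s.card + 1 ≠ Fintype.card (ι ⊕ Unit) →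
      (pfPolar fun i => if i ∈ s then A else Y) = 0 := by
    intro s h1 h2
    have hc : 1 < sᶜ.card := by
      have h3 := Finset.card_add_card_compl s
      have h4 : sᶜ.card ≠ 0 := by
        rw [Finset.card_ne_zero, Finset.nonempty_iff_ne_empty]
        exact fun h => h1 (by simpa using h)
      omega
    obtain ⟨i, hi, j, hj, hij⟩ := Finset.one_lt_card.mp hc
    rw [Finset.mem_compl] at hi hj
    refine Finset.sum_eq_zero fun σ _ => ?_
    by_contra hne
    have hp := Finset.prod_ne_zero_iff.mp (right_ne_zero_of_mul hne)
    have hi' := hp i (mem_univ _)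
    have hj' := hp j (mem_univ _)
    simp only [if_neg hi] at hi'
    simp only [if_neg hj] at hj'
    obtain ⟨a1, a2⟩ := hYs _ _ hi'
    obtain ⟨b1, -⟩ := hYs _ _ hj'
    have e : ∀ x y : Fin 2, x ≠ y → ∀ z, z = x ∨ z = y := by decide
    have n12 : (σ (i, 0)).2 ≠ (σ (i, 1)).2 := fun h => by
      have := σ.injective (Prod.ext (a1.trans a2.symm) h)
      simp at this
    rcases e _ _ n12 (σ (j, 0)).2 with h | h
    · have := σ.injective (Prod.ext (b1.trans a1.symm) h)
      exact hij (congrArg Prod.fst this).symm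
    · have := σ.injective (Prod.ext (b1.trans a2.symm) h)
      exact hij (congrArg Prod.fst this).symm
  let s₀ : Finset (ι ⊕ Unit) := Finset.univ.map Function.Embedding.inl
  have hs₀ : s₀.card = Fintype.card ι := by simp [s₀]
  have hfac : (pfPolar fun i => if i ∈ s₀ then A else Y) =
      (pfPolar fun _ : ι => (fun p q : ι × Fin 2 => A (.inl p.1, p.2) (.inl q.1, q.2))) * 2 := by
    rw [pfPolar_sum]
    · congr 1
      · congr 1
        funext i p q
        simp [s₀]
      · have : (fun (k : Unit) (p q : Unit × Fin 2) =>
            (if (Sum.inr k : ι ⊕ Unit) ∈ s₀ then A else Y) (Sum.inr p.1, p.2) (Sum.inr q.1, q.2)) =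
            fun _ p q => sympl p.2 q.2 := by
          funext k p q
          simp [s₀, hY]
        rw [this, pfPolar_unit]
        norm_num
    · intro k i a q
      simp [s₀, hY]
    · intro k i a q
      simp [s₀, hY]
  have hsum : (pfPolar fun _ : ι ⊕ Unit => A + Y) = (pfPolar fun _ => A) +
      ((Fintype.card ι + 1 : ℕ) : ℂ) * pfPolar fun i => if i ∈ s₀ then A else Y := by
    rw [pfPolar_add]
    have hnot : (univ : Finset (ι ⊕ Unit)) ∉ Finset.powersetCard (Fintype.card ι) univ := by
      simp [Finset.mem_powersetCard]
    rw [← Finset.sum_subset (Finset.subset_univ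
      (insert univ (Finset.powersetCard (Fintype.card ι) (univ : Finset (ι ⊕ Unit)))))]
    · rw [Finset.sum_insert hnot]
      congr 1
      · simp
      rw [Finset.sum_congr rfl (g := fun _ => pfPolar fun i => if i ∈ s₀ then A else Y)]
      · rw [Finset.sum_const, Finset.card_powersetCard, nsmul_eq_mul, Finset.card_univ]
        simp
      · intro s hs
        exact pfPolar_ite_of_card_eq A Y ((Finset.mem_powersetCard.mp hs).2.trans hs₀.symm)
    · intro s _ hs
      rw [Finset.mem_insert, not_or] at hs
      refine hzero s hs.1 ?_
      have := hs.2
      simp only [Finset.mem_powersetCard, Finset.subset_univ, true_and] at this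
      simpa using this
  change pfaff (A + Y) = _
  rw [pfaff_eq_pfPolar, pfaff_eq_pfPolar, pfaff_eq_pfPolar, hsum, hfac]
  have hc : Fintype.card (ι ⊕ Unit) = Fintype.card ι + 1 := by simp
  have f1 : ((Fintype.card ι).factorial : ℂ) ≠ 0 := by exact_mod_cast Nat.factorial_ne_zero _
  have f2 : ((Fintype.card ι + 1 : ℕ) : ℂ) ≠ 0 := Nat.cast_ne_zero.mpr (Nat.succ_ne_zero _)
  rw [hc, Nat.factorial_succ, pow_succ, Nat.cast_mul]
  field_simp

/-! ### Kernels restricted to finite sets -/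

variable {Z : Type*} [DecidableEq Z]

/-- `Pf [K (x, y)]_{x, y ∈ s}`. -/
def Kernel2.pfSet (K : Kernel2 Z) (s : Finset Z) : ℂ := K.pfOn fun x : s => (x : Z)

theorem Kernel2.pfOn_eq_pfaff (K : Kernel2 Z) (z : ι → Z) :
    K.pfOn z = pfaff fun p q => K (z p.1) (z q.1) p.2 q.2 := rfl

theorem Kernel2.pfOn_comp_equiv (K : Kernel2 Z) (e : ι ≃ κ) (z : κ → Z) :
    K.pfOn (fun i => z (e i)) = K.pfOn z := by
  rw [K.pfOn_eq_pfaff, K.pfOn_eq_pfaff]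
  exact pfaff_reindex e fun p q => K (z p.1) (z q.1) p.2 q.2

theorem Kernel2.pfOn_congr (K : Kernel2 Z) (e : ι ≃ κ) {y : ι → Z} {z : κ → Z}
    (h : ∀ i, y i = z (e i)) : K.pfOn y = K.pfOn z := by
  rw [← K.pfOn_comp_equiv e z]
  congr 1
  funext i
  exact h i

/-- Exchanging the first components of the two coinciding points leaves the array unchanged but
reverses the sign of the Pfaffian. -/
theorem Kernel2.pfOn_eq_zero_of_eq (K : Kernel2 Z) (z : ι → Z) {i j : ι} (hij : i ≠ j)
    (h : z i = z j) : K.pfOn z = 0 := by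
  have h1 := pfaff_comp_perm (Equiv.swap (i, (0 : Fin 2)) (j, 0))
    fun p q => K (z p.1) (z q.1) p.2 q.2
  rw [Perm.sign_swap (by simpa using hij), ← K.pfOn_eq_pfaff] at h1
  have hsw : ∀ p : ι × Fin 2, z ((Equiv.swap (i, (0 : Fin 2)) (j, 0)) p).1 = z p.1 ∧
      ((Equiv.swap (i, (0 : Fin 2)) (j, 0)) p).2 = p.2 := by
    intro p
    rw [Equiv.swap_apply_def]
    split_ifs with h1 h2
    · simp [h1, h]
    · simp [h2, h]
    · simp
  simp only [hsw] at h1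
  rw [← K.pfOn_eq_pfaff] at h1
  simp at h1
  have : (2 : ℂ) * K.pfOn z = 0 := by linear_combination h1
  simpa using this

/-- `J` on the points of `Y`, extended by zero. -/
def kernelJOn (Y : Finset Z) : Kernel2 Z :=
  fun p q => if p = q ∧ p ∈ Y then !![0, 1; -1, 0] else 0

theorem kernelJOn_apply (Y : Finset Z) (p q : Z) (a b : Fin 2) :
    kernelJOn Y p q a b = if p = q ∧ p ∈ Y then sympl a b else 0 := by
  unfold kernelJOn sympl
  split_ifs <;> rfl

theorem Kernel2.pfSet_add_kernelJOn_singleton (K : Kernel2 Z) {s : Finset Z} {y : Z} (hy : y ∈ s) :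
    (K + kernelJOn {y}).pfSet s = K.pfSet s + K.pfSet (s.erase y) := by
  let z : {x // x ∈ s.erase y} ⊕ Unit → Z := Sum.elim (fun x => x.1) fun _ => y
  let e : {x // x ∈ s.erase y} ⊕ Unit ≃ {x // x ∈ s} :=
    { toFun := Sum.elim (fun x => ⟨x.1, Finset.mem_of_mem_erase x.2⟩) fun _ => ⟨y, hy⟩
      invFun := fun x => if h : x.1 = y then .inr () else .inl ⟨x.1, Finset.mem_erase.mpr ⟨h, x.2⟩⟩
      left_inv := by
        rintro (⟨x, hx⟩ | _)
        · simp [(Finset.mem_erase.mp hx).1]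
        · simp
      right_inv := by
        rintro ⟨x, hx⟩
        by_cases h : x = y <;> simp [h] }
  have hz : ∀ i, z i = (e i).1 := by
    rintro (x | _) <;> rfl
  have h1 : ∀ K' : Kernel2 Z, K'.pfSet s = K'.pfOn z := fun K' => (K'.pfOn_congr e hz).symm
  rw [h1, h1]
  unfold Kernel2.pfSet
  rw [Kernel2.pfOn_eq_pfaff, Kernel2.pfOn_eq_pfaff, Kernel2.pfOn_eq_pfaff]
  have h2 := pfaff_add_sympl_unit fun p q => K (z p.1) (z q.1) p.2 q.2
  refine Eq.trans ?_ h2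
  congr 1
  funext p q
  simp only [Pi.add_apply, Matrix.add_apply, kernelJOn_apply]
  congr 1
  have hzy : ∀ i, z i = y ↔ i = .inr () := by
    rintro (⟨x, hx⟩ | _)
    · simp only [z, Sum.elim_inl, reduceCtorEq, iff_false]
      exact (Finset.mem_erase.mp hx).1
    · simp [z]
  congr 1
  simp only [Finset.mem_singleton, hzy, eq_iff_iff]
  constructor
  · rintro ⟨h, h'⟩
    rw [h', eq_comm] at h
    exact ⟨h', (hzy _).mp h⟩
  · rintro ⟨h, h'⟩
    exact ⟨by rw [h, h'], h⟩

/-- The finite form of the Fredholm expansion: each point of `Y` is either retained in the Pfaffian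
of `K` or absorbed by its own symplectic block. -/
theorem Kernel2.pfSet_add_kernelJOn (K : Kernel2 Z) (Y : Finset Z) : ∀ s : Finset Z, Y ⊆ s →
    (K + kernelJOn Y).pfSet s = ∑ B ∈ Y.powerset, K.pfSet (s \ B) := by
  induction Y using Finset.induction_on with
  | empty =>
    intro s _
    have : K + kernelJOn ∅ = K := by
      funext p q
      simp [kernelJOn]
    simp [this]
  | insert y Y hy ih =>
    intro s hs
    have hys : y ∈ s := hs (Finset.mem_insert_self _ _)
    have hYs : Y ⊆ s := (Finset.subset_insert _ _).trans hs
    have h1 : K + kernelJOn (insert y Y) = (K + kernelJOn Y) + kernelJOn {y} := by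
      rw [add_assoc]
      congr 1
      funext p q
      simp only [kernelJOn, Pi.add_apply, Finset.mem_insert, Finset.mem_singleton]
      by_cases hpq : p = q <;> by_cases hpy : p = y <;> by_cases hpY : p ∈ Y <;>
        simp_all
    rw [h1, Kernel2.pfSet_add_kernelJOn_singleton _ hys, ih s hYs, ih (s.erase y), add_comm,
      Finset.sum_powerset_insert hy, add_comm]
    · congr 1
      refine Finset.sum_congr rfl fun B _ => ?_
      congr 1
      ext x
      simp only [Finset.mem_sdiff, Finset.mem_erase, Finset.mem_insert]
      tauto
    · intro x hx
      exact Finset.mem_erase.mpr ⟨fun h => hy (h ▸ hx), hYs hx⟩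

/-! ### Schur complements -/

/-- The direct sum of copies of the standard symplectic matrix. -/
def symplMatrix (ι : Type*) [DecidableEq ι] : Matrix (ι × Fin 2) (ι × Fin 2) ℂ :=
  Matrix.of fun p q => if p.1 = q.1 then sympl p.2 q.2 else 0

/-- In the Fredholm expansion with `K = 0`, only the term with all points removed survives, and it
is an empty Pfaffian. -/
theorem pfPairs_symplMatrix : pfPairs (symplMatrix ι) = 1 := by
  have h := Kernel2.pfSet_add_kernelJOn (0 : Kernel2 ι) univ univ subset_rfl
  rw [zero_add] at h
  have h1 : (kernelJOn (univ : Finset ι)).pfSet univ = pfPairs (symplMatrix ι) := by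
    have : (kernelJOn (univ : Finset ι)).pfSet univ =
        (kernelJOn (univ : Finset ι)).pfOn fun i : ι => i :=
      Kernel2.pfOn_congr _ (Equiv.subtypeUnivEquiv fun x => mem_univ x) fun i => rfl
    rw [this]
    unfold Kernel2.pfOn
    congr 1
    funext p q
    simp [kernelJOn_apply, symplMatrix]
  rw [← h1, h, Finset.sum_eq_single univ]
  · rw [Finset.sdiff_self]
    simp [Kernel2.pfSet, Kernel2.pfOn, pfPairs]
  · intro B _ hB
    have : ∃ x, x ∉ B := by
      by_contra hcon
      push Not at hcon
      exact hB (Finset.eq_univ_of_forall hcon)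
    obtain ⟨x, hx⟩ := this
    have hc : Finset.card (univ \ B) ≠ 0 := Finset.card_ne_zero.mpr ⟨x, by simp [hx]⟩
    simp [Kernel2.pfSet, Kernel2.pfOn, pfPairs, hc]
  · simp

theorem symplMatrix_mul_self : symplMatrix ι * symplMatrix ι = -1 := by
  ext ⟨i, a⟩ ⟨j, b⟩
  rw [Matrix.mul_apply, Fintype.sum_prod_type, Finset.sum_eq_single i]
  · simp only [symplMatrix, Matrix.of_apply, Fin.sum_univ_two, if_true]
    by_cases hij : i = j
    · subst hij
      fin_cases a <;> fin_cases b <;> simp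
    · simp [hij]
  · intro k _ hk
    simp [symplMatrix, hk.symm]
  · simp

theorem symplMatrix_transpose : (symplMatrix ι).transpose = -symplMatrix ι := by
  ext ⟨i, a⟩ ⟨j, b⟩
  simp only [symplMatrix, Matrix.transpose_apply, Matrix.of_apply, Matrix.neg_apply, @eq_comm _ j i]
  split_ifs
  · fin_cases a <;> fin_cases b <;> simp
  · simp

/-- A `2 × 2` block matrix with the index set rearranged into pairs. -/
def pairBlocks (T : Matrix (ι × Fin 2) (ι × Fin 2) ℂ) (B : Matrix (ι × Fin 2) (κ × Fin 2) ℂ)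
    (B' : Matrix (κ × Fin 2) (ι × Fin 2) ℂ) (C : Matrix (κ × Fin 2) (κ × Fin 2) ℂ) :
    Matrix ((ι ⊕ κ) × Fin 2) ((ι ⊕ κ) × Fin 2) ℂ :=
  (Matrix.fromBlocks T B B' C).submatrix (Equiv.sumProdDistrib ι κ (Fin 2))
    (Equiv.sumProdDistrib ι κ (Fin 2))

theorem pfPairs_pairBlocks_diag (T : Matrix (ι × Fin 2) (ι × Fin 2) ℂ)
    (C : Matrix (κ × Fin 2) (κ × Fin 2) ℂ) :
    pfPairs (pairBlocks T 0 0 C) = pfPairs T * pfPairs C :=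
  pfaff_sum (pairBlocks T 0 0 C) (fun _ _ _ _ => rfl) fun _ _ _ _ => rfl

theorem pfPairs_pairBlocks_congruence {T : Matrix (ι × Fin 2) (ι × Fin 2) ℂ}
    {B : Matrix (ι × Fin 2) (κ × Fin 2) ℂ} {B' : Matrix (κ × Fin 2) (ι × Fin 2) ℂ}
    {C : Matrix (κ × Fin 2) (κ × Fin 2) ℂ}
    (E : Matrix (ι × Fin 2 ⊕ κ × Fin 2) (ι × Fin 2 ⊕ κ × Fin 2) ℂ) (hE : E.det = 1)
    {T₁ : Matrix (ι × Fin 2) (ι × Fin 2) ℂ}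
    {B₁ : Matrix (ι × Fin 2) (κ × Fin 2) ℂ} {B₁' : Matrix (κ × Fin 2) (ι × Fin 2) ℂ}
    {C₁ : Matrix (κ × Fin 2) (κ × Fin 2) ℂ}
    (h : E * Matrix.fromBlocks T B B' C * E.transpose = Matrix.fromBlocks T₁ B₁ B₁' C₁) :
    pfPairs (pairBlocks T B B' C) = pfPairs (pairBlocks T₁ B₁ B₁' C₁) := by
  let d := Equiv.sumProdDistrib ι κ (Fin 2)
  have h1 := pfPairs_congruence (E.submatrix d d) (pairBlocks T B B' C)
  rw [Matrix.det_submatrix_equiv_self, hE, one_mul] at h1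
  rw [← h1]
  congr 1
  unfold pairBlocks
  rw [Matrix.transpose_submatrix, Matrix.submatrix_mul_equiv, Matrix.submatrix_mul_equiv, h]

/-- Block elimination is a congruence by a unitriangular matrix, hence of determinant one, after
which the Pfaffian splits. -/
theorem pfPairs_schur_left {T T' : Matrix (ι × Fin 2) (ι × Fin 2) ℂ} (hT' : T'.transpose = -T')
    (h1 : T * T' = 1) (B : Matrix (ι × Fin 2) (κ × Fin 2) ℂ)
    (C : Matrix (κ × Fin 2) (κ × Fin 2) ℂ) :
    pfPairs (pairBlocks T B (-B.transpose) C) = pfPairs T * pfPairs (C + B.transpose * T' * B) := by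
  have h2 : T' * T = 1 := mul_eq_one_comm.mp h1
  rw [← pfPairs_pairBlocks_diag]
  refine pfPairs_pairBlocks_congruence (Matrix.fromBlocks 1 0 (B.transpose * T') 1) (by simp) ?_
  rw [Matrix.fromBlocks_transpose, Matrix.fromBlocks_multiply, Matrix.fromBlocks_multiply]
  simp [Matrix.mul_assoc, hT', h2]
  rw [← Matrix.mul_assoc, h1]
  simp [add_comm]

theorem pfPairs_schur_right (T : Matrix (ι × Fin 2) (ι × Fin 2) ℂ)
    (B : Matrix (ι × Fin 2) (κ × Fin 2) ℂ) {C C' : Matrix (κ × Fin 2) (κ × Fin 2) ℂ}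
    (hC' : C'.transpose = -C') (h1 : C * C' = 1) :
    pfPairs (pairBlocks T B (-B.transpose) C) = pfPairs (T + B * C' * B.transpose) * pfPairs C := by
  have h2 : C' * C = 1 := mul_eq_one_comm.mp h1
  rw [← pfPairs_pairBlocks_diag]
  refine pfPairs_pairBlocks_congruence (Matrix.fromBlocks 1 (-(B * C')) 0 1) (by simp) ?_
  rw [Matrix.fromBlocks_transpose, Matrix.fromBlocks_multiply, Matrix.fromBlocks_multiply]
  simp [Matrix.mul_assoc, hC', h2]
  rw [← Matrix.mul_assoc, h1]
  simp

/-- `Pf (T - J_S) = Pf T * Pf_S (J + T⁻¹)`. -/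
theorem pfPairs_sub_sympl {T T' : Matrix (ι × Fin 2) (ι × Fin 2) ℂ} (hT' : T'.transpose = -T')
    (h1 : T * T' = 1) (g : κ → ι) (hg : Function.Injective g) :
    pfPairs (Matrix.of fun p q => T p q - if p.1 = q.1 ∧ p.1 ∈ Set.range g then sympl p.2 q.2 else 0)
      = pfPairs T * pfPairs (Matrix.of fun p q : κ × Fin 2 =>
        symplMatrix κ p q + T' (g p.1, p.2) (g q.1, q.2)) := by
  classical
  -- `B` is the inclusion of the `κ` indices. The bordered matrix with diagonal blocks `T` and `J`
  -- is computed by eliminating either block; the two Schur complements are the two matrices to be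
  -- compared.
  let B : Matrix (ι × Fin 2) (κ × Fin 2) ℂ := Matrix.of fun p q => if p = (g q.1, q.2) then 1 else 0
  have hl := pfPairs_schur_left hT' h1 B (symplMatrix κ)
  have hr := pfPairs_schur_right T B (C := symplMatrix κ) (C' := -symplMatrix κ)
    (by simp [symplMatrix_transpose]) (by simp [symplMatrix_mul_self])
  rw [pfPairs_symplMatrix, mul_one] at hr
  have e1 : symplMatrix κ + B.transpose * T' * B = Matrix.of fun p q : κ × Fin 2 =>
      symplMatrix κ p q + T' (g p.1, p.2) (g q.1, q.2) := by
    ext p q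
    simp [Matrix.mul_apply, B]
  have e2 : T + B * (-symplMatrix κ) * B.transpose = Matrix.of fun p q => T p q -
      if p.1 = q.1 ∧ p.1 ∈ Set.range g then sympl p.2 q.2 else 0 := by
    ext ⟨i, a⟩ ⟨j, b⟩
    have e3 : (B * (-symplMatrix κ) * B.transpose) (i, a) (j, b) =
        -∑ l : κ, ∑ k : κ, if i = g k ∧ j = g l ∧ k = l then sympl a b else 0 := by
      rw [Matrix.mul_apply, Fintype.sum_prod_type, ← Finset.sum_neg_distrib]
      refine Finset.sum_congr rfl fun l _ => ?_
      simp only [Matrix.mul_apply, Fintype.sum_prod_type]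
      rw [← Finset.sum_neg_distrib]
      simp only [Finset.sum_mul]
      rw [Finset.sum_comm]
      refine Finset.sum_congr rfl fun k _ => ?_
      simp only [B, symplMatrix, Matrix.of_apply, Matrix.neg_apply, Matrix.transpose_apply,
        Prod.mk.injEq, Fin.sum_univ_two]
      by_cases hkl : k = l
      · subst hkl
        by_cases hik : i = g k <;> by_cases hjl : j = g k <;>
          fin_cases a <;> fin_cases b <;> simp [hik, hjl]
      · simp [hkl]
    rw [Matrix.add_apply, e3, Matrix.of_apply, ← sub_eq_add_neg]
    congr 1
    simp only [Set.mem_range]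
    split_ifs with hij
    · obtain ⟨hij, k, hk⟩ := hij
      subst hij
      subst hk
      rw [Finset.sum_eq_single k, Finset.sum_eq_single k]
      · simp
      · intro l _ hl
        simp [hl]
      · simp
      · intro l _ hl
        refine Finset.sum_eq_zero fun m _ => if_neg ?_
        rintro ⟨h1, h2, h3⟩
        exact hl (hg h2).symm
      · simp
    · refine Finset.sum_eq_zero fun l _ => Finset.sum_eq_zero fun k _ => if_neg ?_
      rintro ⟨h1, h2, h3⟩
      subst h3
      exact hij ⟨h1.trans h2.symm, k, h1.symm⟩
  rw [← e1, ← e2, ← hl, hr]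

/-- The Pfaffian of `[S 1; -1 0]` does not depend on the skew matrix `S`, since a congruence with
upper right block `S / 2` removes `S`. By Schur complement it equals `Pf T * Pf T'` for `S = T`, and
`Pf J * Pf (-J) ≠ 0` for `S = J`. -/
theorem pfPairs_ne_zero_of_inverse {T T' : Matrix (ι × Fin 2) (ι × Fin 2) ℂ}
    (hT : T.transpose = -T) (hT' : T'.transpose = -T') (h1 : T * T' = 1) : pfPairs T ≠ 0 := by
  have hflat : ∀ S : Matrix (ι × Fin 2) (ι × Fin 2) ℂ, S.transpose = -S →
      pfPairs (pairBlocks S 1 (-(1 : Matrix (ι × Fin 2) (ι × Fin 2) ℂ).transpose) 0) =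
        pfPairs (pairBlocks (0 : Matrix (ι × Fin 2) (ι × Fin 2) ℂ) 1
          (-(1 : Matrix (ι × Fin 2) (ι × Fin 2) ℂ).transpose) 0) := by
    intro S hS
    refine pfPairs_pairBlocks_congruence (Matrix.fromBlocks 1 ((2⁻¹ : ℂ) • S) 0 1) (by simp) ?_
    rw [Matrix.fromBlocks_transpose, Matrix.fromBlocks_multiply, Matrix.fromBlocks_multiply]
    simp [hS]
    module
  have hJ : (symplMatrix ι).transpose = -symplMatrix ι := symplMatrix_transpose
  have hA := pfPairs_schur_left hT' h1 (1 : Matrix (ι × Fin 2) (ι × Fin 2) ℂ) 0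
  have hB := pfPairs_schur_left (T := symplMatrix ι) (T' := -symplMatrix ι) (by simp [hJ])
    (by simp [symplMatrix_mul_self]) (1 : Matrix (ι × Fin 2) (ι × Fin 2) ℂ) 0
  rw [hflat _ hT] at hA
  rw [hflat _ hJ, hA, pfPairs_symplMatrix] at hB
  simp only [Matrix.transpose_one, one_mul, mul_one, zero_add] at hB
  intro h0
  rw [h0, zero_mul, ← hJ] at hB
  have hneg : (pfPairs (symplMatrix ι).transpose) ≠ 0 := by
    have h2 := pfaff_smul_diag (fun p : ι × Fin 2 => if p.2 = 0 then (-1 : ℂ) else 1)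
      (symplMatrix ι)
    have h3 : (fun p q : ι × Fin 2 => (if p.2 = 0 then (-1 : ℂ) else 1) *
        (if q.2 = 0 then (-1 : ℂ) else 1) * symplMatrix ι p q) = (symplMatrix ι).transpose := by
      rw [hJ]
      funext ⟨i, a⟩ ⟨j, b⟩
      simp only [symplMatrix, Matrix.of_apply, Matrix.neg_apply]
      by_cases hij : i = j <;> fin_cases a <;> fin_cases b <;> simp [hij]
    rw [h3] at h2
    have h4 : pfaff (symplMatrix ι) = 1 := pfPairs_symplMatrix
    rw [h4, mul_one] at h2
    change pfaff (symplMatrix ι).transpose ≠ 0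
    rw [h2]
    refine Finset.prod_ne_zero_iff.mpr fun p _ => ?_
    split_ifs <;> norm_num
  exact hneg hB.symm

/-- If `A v = 0`, choose `w` with `v ⬝ w = 1`. The congruence by `1 + w vᵀ` fixes the skew matrix
`A` and has determinant 2, so `Pf A = 2 Pf A`. -/
theorem det_ne_zero_of_pfPairs_ne_zero {A : Matrix (ι × Fin 2) (ι × Fin 2) ℂ}
    (hA : A.transpose = -A) (h : pfPairs A ≠ 0) : A.det ≠ 0 := by
  intro hdet
  obtain ⟨v, hv, hAv⟩ := Matrix.exists_mulVec_eq_zero_iff.mpr hdet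
  obtain ⟨p, hp⟩ := Function.ne_iff.mp hv
  let w : ι × Fin 2 → ℂ := Pi.single p (v p)⁻¹
  have hvA : Matrix.vecMul v A = 0 := by
    rw [← Matrix.mulVec_transpose, hA, Matrix.neg_mulVec, hAv, neg_zero]
  have h1 := pfPairs_congruence (1 + Matrix.vecMulVec w v) A
  have h2 : (1 + Matrix.vecMulVec w v) * A * (1 + Matrix.vecMulVec w v).transpose = A := by
    have e1 : Matrix.vecMulVec w v * A = 0 := by
      rw [Matrix.vecMulVec_mul, hvA, Matrix.vecMulVec_zero]
    have e2 : A * Matrix.vecMulVec v w = 0 := by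
      rw [Matrix.mul_vecMulVec, hAv, Matrix.zero_vecMulVec]
    rw [Matrix.transpose_add, Matrix.transpose_one, Matrix.transpose_vecMulVec, Matrix.add_mul,
      Matrix.one_mul, e1, add_zero, Matrix.mul_add, e2, Matrix.mul_one, add_zero]
  have h3 : (1 + Matrix.vecMulVec w v).det = 2 := by
    rw [Matrix.vecMulVec_eq Unit, Matrix.det_one_add_replicateCol_mul_replicateRow]
    have : v ⬝ᵥ w = 1 := by
      simp only [w, dotProduct_single]
      exact mul_inv_cancel₀ hp
    rw [this]
    norm_num
  rw [h2, h3] at h1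
  apply h
  linear_combination -h1

/-- The Pfaffian of a bipartite array is a determinant. -/
theorem pfaff_bipartite (M : Matrix ι ι ℂ) :
    (pfaff fun p q : ι × Fin 2 => if p.2 = 0 ∧ q.2 = 1 then M p.1 q.1 else
      if p.2 = 1 ∧ q.2 = 0 then -M q.1 p.1 else 0) = M.det := by
  let d : ι × Fin 2 ≃ ι ⊕ ι :=
    { toFun := fun p => if p.2 = 0 then .inl p.1 else .inr p.1
      invFun := Sum.elim (fun i => (i, 0)) fun i => (i, 1)
      left_inv := by
        rintro ⟨i, a⟩
        fin_cases a <;> simp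
      right_inv := by
        rintro (i | i) <;> simp }
  -- The bipartite array is the congruence of the standard symplectic matrix by `M ⊕ 1`.
  let B : Matrix (ι × Fin 2) (ι × Fin 2) ℂ := (Matrix.fromBlocks M 0 0 1).submatrix d d
  have hB : B.det = M.det := by
    rw [Matrix.det_submatrix_equiv_self]
    simp
  have hJ : symplMatrix ι = (Matrix.fromBlocks 0 1 (-1) 0).submatrix d d := by
    ext ⟨i, a⟩ ⟨j, b⟩
    by_cases hij : i = j <;> fin_cases a <;> fin_cases b <;>
      simp [symplMatrix, d, hij]
  have h := pfPairs_congruence B (symplMatrix ι)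
  rw [pfPairs_symplMatrix, mul_one, hB] at h
  rw [← h]
  change pfPairs (Matrix.of _) = _
  congr 1
  rw [hJ]
  simp only [B]
  rw [Matrix.transpose_submatrix, Matrix.submatrix_mul_equiv, Matrix.submatrix_mul_equiv,
    Matrix.fromBlocks_transpose, Matrix.fromBlocks_multiply, Matrix.fromBlocks_multiply]
  ext ⟨i, a⟩ ⟨j, b⟩
  fin_cases a <;> fin_cases b <;> simp [d]

end PfaffianKernels

noncomputable section KernelLPfaffian

open Equiv Finset

/-! ### The kernel `L` for a general function `ψ` in place of `Ψ` -/

/-- The kernel `L` with `Ψ` replaced by an arbitrary function. -/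
def kernelLOf (N : ℕ) (ψ : ℕ+ → ℕ+ → ℂ) : Kernel2 (VPhys N)
  | .inl i, .inl j =>
      (if i.val + 1 = j.val then !![-1, 0; 0, 0] else 0) +
        (if j.val + 1 = i.val then !![1, 0; 0, 0] else 0)
  | .inl i, .inr (j, x) => if i = j then !![0, 0; phi none x, 0] else 0
  | .inr (i, x), .inl j => if j = i then -(!![0, 0; phi none x, 0]).transpose else 0
  | .inr (i, x), .inr (j, y) =>
      (if i.val + 1 = j.val then !![0, 0; phi (some x) y, 0] else 0) +
        (if j.val + 1 = i.val then !![0, -phi (some y) x; 0, 0] else 0) +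
        (if i.val + 1 = N ∧ j.val + 1 = N then !![0, 0; 0, ψ x y] else 0)

theorem kernelL_eq_kernelLOf (N : ℕ) (α t r R : ℝ) :
    kernelL N α t r R = kernelLOf N fun x y => Psi α t r R x y := by
  funext p q
  rcases p with i | ⟨i, x⟩ <;> rcases q with j | ⟨j, y⟩ <;> rfl

/-- The entries between virtual points. -/
def thetaMatrix (N : ℕ) : Matrix (Fin N) (Fin N) ℂ :=
  Matrix.of fun i j => (if i.val + 1 = j.val then -1 else 0) + if j.val + 1 = i.val then 1 else 0

variable {N : ℕ} (ψ : ℕ+ → ℕ+ → ℂ)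

theorem kernelLOf_inl_inl (i j : Fin N) (a b : Fin 2) :
    kernelLOf N ψ (.inl i) (.inl j) a b = if a = 0 ∧ b = 0 then thetaMatrix N i j else 0 := by
  simp only [kernelLOf, thetaMatrix, Matrix.of_apply, Matrix.add_apply]
  split_ifs <;> fin_cases a <;> fin_cases b <;> simp_all

theorem kernelLOf_inl_inr (i : Fin N) (q : Phys N) (a b : Fin 2) :
    kernelLOf N ψ (.inl i) (.inr q) a b = if i = q.1 ∧ a = 1 ∧ b = 0 then 1 else 0 := by
  obtain ⟨j, x⟩ := q
  simp only [kernelLOf, phi]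
  split_ifs <;> fin_cases a <;> fin_cases b <;> simp_all

theorem kernelLOf_inr_inl (p : Phys N) (j : Fin N) (a b : Fin 2) :
    kernelLOf N ψ (.inr p) (.inl j) a b = if p.1 = j ∧ a = 0 ∧ b = 1 then -1 else 0 := by
  obtain ⟨i, x⟩ := p
  simp only [kernelLOf, phi, @eq_comm _ j i]
  split_ifs <;> fin_cases a <;> fin_cases b <;> simp_all

theorem kernelLOf_inr_inr (p q : Phys N) (a b : Fin 2) :
    kernelLOf N ψ (.inr p) (.inr q) a b =
      (if p.1.val + 1 = q.1.val ∧ p.2 ≤ q.2 ∧ a = 1 ∧ b = 0 then 1 else 0) +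
      (if q.1.val + 1 = p.1.val ∧ q.2 ≤ p.2 ∧ a = 0 ∧ b = 1 then -1 else 0) +
      if p.1.val + 1 = N ∧ q.1.val + 1 = N ∧ a = 1 ∧ b = 1 then ψ p.2 q.2 else 0 := by
  obtain ⟨i, x⟩ := p
  obtain ⟨j, y⟩ := q
  have h : ∀ x y : ℕ+, phi (some ((x : ℕ) : ℤ)) ((y : ℕ) : ℤ) = if x ≤ y then 1 else 0 := by
    intro x y
    simp [phi]
  simp only [kernelLOf, h, Matrix.add_apply]
  congr 1
  · congr 1
    · by_cases h1 : i.val + 1 = j.val <;> by_cases h2 : x ≤ y <;>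
        fin_cases a <;> fin_cases b <;> simp [h1, h2]
    · by_cases h1 : j.val + 1 = i.val <;> by_cases h2 : y ≤ x <;>
        fin_cases a <;> fin_cases b <;> simp [h1, h2]
  · by_cases h1 : i.val + 1 = N <;> by_cases h2 : j.val + 1 = N <;>
        fin_cases a <;> fin_cases b <;> simp [h1, h2]

theorem kernelLOf_isSkew (hψ : ∀ x y, ψ x y = -ψ y x) : (kernelLOf N ψ).IsSkew := by
  rintro (i | ⟨i, x⟩) (j | ⟨j, y⟩) a b
  · simp only [kernelLOf_inl_inl, thetaMatrix, Matrix.of_apply]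
    fin_cases a <;> fin_cases b <;> simp
    split_ifs <;> simp
  · rw [kernelLOf_inl_inr, kernelLOf_inr_inl]
    by_cases hij : i = j <;> fin_cases a <;> fin_cases b <;> simp [hij, @eq_comm _ j i]
  · rw [kernelLOf_inl_inr, kernelLOf_inr_inl]
    by_cases hij : i = j <;> fin_cases a <;> fin_cases b <;> simp [hij, @eq_comm _ j i]
  · simp only [kernelLOf_inr_inr]
    fin_cases a <;> fin_cases b <;> simp
    · split_ifs <;> simp
    · split_ifs <;> simp
    · rw [hψ x y]
      by_cases h1 : i.val + 1 = N <;> by_cases h2 : j.val + 1 = N <;> simp [h1, h2]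

/-! ### Vanishing off the triangular arrays -/

/-- Give weight 2 to the second component of `†_k` and to the second components of the points in the
row before `k`, weight 1/2 to the first components of the points in row `k`, and weight 1 otherwise.
Every nonzero entry of `L` joins indices of total weight 1, so the product of all weights must be 1.
-/
theorem card_fiber_of_pfOn_ne_zero {ι : Type*} [Fintype ι] [DecidableEq ι] (z : ι → Phys N)
    (h : (kernelLOf N ψ).pfOn (Sum.map id z) ≠ 0) (k : Fin N) :
    (univ.filter fun i => (z i).1 = k).card =
      (univ.filter fun i => (z i).1.val + 1 = k.val).card + 1 := by
  let f : (Fin N ⊕ ι) × Fin 2 → ℂ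
    | (.inl j, 0) => 1
    | (.inl j, 1) => if j = k then 2 else 1
    | (.inr i, 0) => if (z i).1 = k then 2⁻¹ else 1
    | (.inr i, 1) => if (z i).1.val + 1 = k.val then 2 else 1
  have f1 : ∀ j, f (.inl j, 0) = 1 := fun _ => rfl
  have f2 : ∀ j, f (.inl j, 1) = if j = k then 2 else 1 := fun _ => rfl
  have f3 : ∀ i, f (.inr i, 0) = if (z i).1 = k then 2⁻¹ else 1 := fun _ => rfl
  have f4 : ∀ i, f (.inr i, 1) = if (z i).1.val + 1 = k.val then 2 else 1 := fun _ => rfl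
  by_contra hne
  apply h
  refine pfaff_eq_zero_of_scaling f
    (fun p q => kernelLOf N ψ (Sum.map id z p.1) (Sum.map id z q.1) p.2 q.2) ?_ ?_
  · rintro ⟨p, a⟩ ⟨q, b⟩
    rcases p with i | i <;> rcases q with j | j
    · simp only [Sum.map_inl, kernelLOf_inl_inl]
      fin_cases a <;> fin_cases b <;> simp [f1]
    · simp only [Sum.map_inl, Sum.map_inr, id]
      rw [kernelLOf_inl_inr]
      fin_cases a <;> fin_cases b <;> simp [f2, f3]
      refine ite_congr rfl (fun hij => ?_) fun _ => rfl
      rw [hij]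
      split_ifs <;> simp
    · simp only [Sum.map_inl, Sum.map_inr, id]
      rw [kernelLOf_inr_inl]
      fin_cases a <;> fin_cases b <;> simp [f2, f3]
      refine ite_congr rfl (fun hij => ?_) fun _ => rfl
      rw [hij]
      split_ifs <;> simp
    · simp only [Sum.map_inr]
      rw [kernelLOf_inr_inr]
      fin_cases a <;> fin_cases b <;> simp [f3, f4]
      · refine ite_congr rfl (fun h1 => ?_) fun _ => rfl
        replace h1 := h1.1
        by_cases h2 : (z i).1 = k
        · have : (z j).1.val + 1 = k.val := by rw [h1, h2]
          simp [h2, this]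
        · have : (z j).1.val + 1 ≠ k.val := fun h => h2 (Fin.ext (h1.symm.trans h))
          simp [h2, this]
      · refine ite_congr rfl (fun h1 => ?_) fun _ => rfl
        replace h1 := h1.1
        by_cases h2 : (z j).1 = k
        · have : (z i).1.val + 1 = k.val := by rw [h1, h2]
          simp [h2, this]
        · have : (z i).1.val + 1 ≠ k.val := fun h => h2 (Fin.ext (h1.symm.trans h))
          simp [h2, this]
      · refine ite_congr rfl (fun ⟨h1, h2⟩ => ?_) fun _ => rfl
        have h3 : (z i).1.val + 1 ≠ k.val := by have := k.isLt; omega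
        have h4 : (z j).1.val + 1 ≠ k.val := by have := k.isLt; omega
        simp [h3, h4]
  · rw [Fintype.prod_prod_type]
    simp only [Fin.prod_univ_two, Fintype.prod_sum_type, Finset.prod_mul_distrib, f1, f2, f3, f4,
      Finset.prod_ite, Finset.prod_const, one_pow, mul_one, one_mul, Finset.filter_eq',
      Finset.mem_univ, if_true, Finset.card_singleton, pow_one]
    intro h1
    rw [inv_pow, mul_comm (2 : ℂ), inv_mul_eq_one₀ (pow_ne_zero _ two_ne_zero),
      ← pow_succ] at h1
    exact hne (Nat.pow_right_injective le_rfl (by exact_mod_cast h1))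

theorem card_fiber_eq_of_pfOn_ne_zero {ι : Type*} [Fintype ι] [DecidableEq ι] (z : ι → Phys N)
    (h : (kernelLOf N ψ).pfOn (Sum.map id z) ≠ 0) (k : Fin N) :
    (univ.filter fun i => (z i).1 = k).card = k.val + 1 := by
  obtain ⟨k, hk⟩ := k
  induction k with
  | zero =>
    rw [card_fiber_of_pfOn_ne_zero ψ z h]
    simp
  | succ k ih =>
    rw [card_fiber_of_pfOn_ne_zero ψ z h]
    have := ih (by omega)
    simp only [Fin.ext_iff] at this
    simpa using this

theorem pfOn_eq_zero_of_not_isTriangular {A : Finset (Phys N)} (hA : ¬ IsTriangular A) :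
    (kernelLOf N ψ).pfOn (Sum.map id fun p : A => (p : Phys N)) = 0 := by
  by_contra h
  apply hA
  intro k
  rw [← card_fiber_eq_of_pfOn_ne_zero ψ _ h k]
  refine Finset.card_bij' (fun p hp => ⟨p, (Finset.mem_filter.mp hp).1⟩) (fun p _ => p.1)
    ?_ ?_ ?_ ?_ <;> simp

/-! ### Signs of permutations of sigma types -/

/-- Both sides are homomorphisms on a product of groups. They are compared on a single factor, where
the permutation is an extension by the identity. -/
theorem sign_sigmaCongrRight {ι : Type*} [Fintype ι] [DecidableEq ι] {β : ι → Type*}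
    [∀ i, Fintype (β i)] [∀ i, DecidableEq (β i)] (σ : ∀ i, Perm (β i)) :
    Perm.sign (Perm.sigmaCongrRight σ) = ∏ i, Perm.sign (σ i) := by
  let F : (∀ i, Perm (β i)) →* ℤˣ := Perm.sign.comp (Perm.sigmaCongrRightHom β)
  let G : (∀ i, Perm (β i)) →* ℤˣ := ∏ i, Perm.sign.comp (Pi.evalMonoidHom (fun i => Perm (β i)) i)
  have hFG : F = G := by
    refine MonoidHom.pi_ext fun i τ => ?_
    have h1 : F (Pi.mulSingle i τ) = Perm.sign τ := by
      change Perm.sign (Perm.sigmaCongrRight (Pi.mulSingle i τ)) = _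
      have : Perm.sigmaCongrRight (Pi.mulSingle i τ) =
          τ.extendDomain (Equiv.sigmaSubtype (β := β) i).symm := by
        ext1 ⟨j, x⟩
        by_cases hj : j = i
        · subst hj
          have := Perm.extendDomain_apply_image τ (Equiv.sigmaSubtype (β := β) j).symm x
          refine Eq.trans ?_ this.symm
          simp [Equiv.sigmaSubtype]
        · refine Eq.trans ?_ (Perm.extendDomain_apply_not_subtype τ
            (Equiv.sigmaSubtype (β := β) i).symm (b := ⟨j, x⟩) hj).symm
          simp [Pi.mulSingle_eq_of_ne hj]
      rw [this, Perm.sign_extendDomain]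
    have h2 : G (Pi.mulSingle i τ) = Perm.sign τ := by
      simp only [G, MonoidHom.finsetProd_apply, MonoidHom.comp_apply, Pi.evalMonoidHom_apply]
      rw [Finset.prod_eq_single i]
      · simp
      · intro j _ hj
        simp [Pi.mulSingle_eq_of_ne hj]
      · simp
    rw [h1, h2]
  have := DFunLike.congr_fun hFG σ
  simpa [F, G, MonoidHom.finsetProd_apply] using this

end KernelLPfaffian

/-! ### Factorization of the Pfaffian of `L` on triangular arrays. -/

noncomputable section TriangularArrays

open Equiv Finset

/-- The pairs `(k, i)` labelling the entries of a triangular array. -/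
abbrev TriIndex (N : ℕ) := Σ k : Fin N, Fin (k.val + 1)

/-- Virtual points and array entries arranged in chains `†_i, z_i^i, z_i^{i+1}, …`. -/
def chainEquiv (N : ℕ) : Fin N ⊕ TriIndex N ≃ Σ i : Fin N, Fin (N - i.val + 1) where
  toFun := Sum.elim (fun i => ⟨i, 0⟩) fun s =>
    ⟨⟨s.2.val, by have := s.1.isLt; have := s.2.isLt; omega⟩,
      ⟨s.1.val - s.2.val + 1, by have := s.1.isLt; have := s.2.isLt; simp only; omega⟩⟩
  invFun := fun c => if h : c.2.val = 0 then .inl c.1 else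
    .inr ⟨⟨c.1.val + (c.2.val - 1), by have := c.1.isLt; have := c.2.isLt; omega⟩,
      ⟨c.1.val, by simp only; omega⟩⟩
  left_inv := by
    rintro (i | ⟨⟨k, hk⟩, ⟨i, hi⟩⟩)
    · simp
    · refine (dif_neg (Nat.succ_ne_zero _)).trans ?_
      simp only [Sum.elim_inr]
      simp only at hi
      congr 1
      have : i + (k - i + 1 - 1) = k := by omega
      congr 1
      · exact Fin.ext this
      · congr 1
        · simp only [this]
        · exact proof_irrel_heq _ _
  right_inv := by
    rintro ⟨⟨i, hi⟩, ⟨m, hm⟩⟩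
    by_cases h : m = 0
    · subst h
      simp
    · simp only [h, dif_neg, not_false_eq_true, Sum.elim_inr]
      congr 2
      omega

/-- The permutation moving every point to its predecessor in its chain, cyclically. -/
def chainShift (N : ℕ) : Perm (Fin N ⊕ TriIndex N) :=
  (chainEquiv N).symm.permCongr (Perm.sigmaCongrRight fun _ => (finRotate _).symm)

theorem chainShift_inl {N : ℕ} (i : Fin N) :
    chainShift N (.inl i) = .inr ⟨⟨N - 1, by have := i.isLt; omega⟩,
      ⟨i.val, by have := i.isLt; simp only; omega⟩⟩ := by
  rw [chainShift, Equiv.permCongr_apply, Equiv.symm_apply_eq, Equiv.symm_symm]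
  have h1 : chainEquiv N (.inl i) = ⟨i, 0⟩ := rfl
  rw [h1]
  simp only [Equiv.sigmaCongrRight_apply, chainEquiv, Equiv.coe_fn_mk, Sum.elim_inr]
  congr 1
  rw [Equiv.symm_apply_eq]
  have h2 : (⟨N - 1 - i.val + 1, by have := i.isLt; omega⟩ : Fin (N - i.val + 1)) = Fin.last _ := by
    ext
    have := i.isLt
    simp only [Fin.val_last]
    omega
  rw [h2, finRotate_last]

theorem chainShift_inr {N : ℕ} (s : TriIndex N) :
    chainShift N (.inr s) = if h : s.2.val < s.1.val then
      .inr ⟨⟨s.1.val - 1, by have := s.1.isLt; omega⟩, ⟨s.2.val, by simp only; omega⟩⟩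
      else .inl s.1 := by
  obtain ⟨⟨k, hk⟩, ⟨i, hi⟩⟩ := s
  simp only at hi
  rw [chainShift, Equiv.permCongr_apply, Equiv.symm_apply_eq, Equiv.symm_symm]
  split_ifs with h
  · simp only at h
    simp only [Equiv.sigmaCongrRight_apply, chainEquiv, Equiv.coe_fn_mk, Sum.elim_inr]
    simp only [Sigma.mk.injEq, heq_eq_eq, true_and]
    rw [Equiv.symm_apply_eq]
    ext
    rw [coe_finRotate_of_ne_last]
    · simp only
      omega
    · rw [Ne, Fin.ext_iff]
      simp only [Fin.val_last]
      omega
  · simp only at h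
    have hik : i = k := by omega
    subst hik
    simp only [Equiv.sigmaCongrRight_apply, chainEquiv, Equiv.coe_fn_mk, Sum.elim_inr, Sum.elim_inl]
    simp only [Sigma.mk.injEq, heq_eq_eq, true_and]
    rw [Equiv.symm_apply_eq]
    ext
    rw [coe_finRotate_of_ne_last]
    · simp
    · rw [Ne, Fin.ext_iff]
      simp only [Fin.val_last, Fin.val_zero]
      omega

/-- A chain of one virtual point and `m` array entries is a cycle of sign `(-1) ^ m`, and the chains
together contain every array entry once. -/
theorem sign_chainShift (N : ℕ) :
    Perm.sign (chainShift N) = (-1) ^ Fintype.card (TriIndex N) := by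
  have h1 : Fintype.card (TriIndex N) = ∑ i : Fin N, (N - i.val) := by
    have h := Fintype.card_congr (chainEquiv N)
    rw [Fintype.card_sum, Fintype.card_sigma (α := fun i : Fin N => Fin (N - i.val + 1))] at h
    simp only [Fintype.card_fin, Finset.sum_add_distrib, Finset.sum_const, Finset.card_univ,
      smul_eq_mul, mul_one] at h
    omega
  rw [chainShift, Perm.sign_permCongr, sign_sigmaCongrRight, h1, ← Finset.prod_pow_eq_pow_sum]
  refine Finset.prod_congr rfl fun i _ => ?_
  rw [Perm.sign_symm, sign_finRotate]
  simp

/-- `ι × Fin 2` as a sum of two copies of `ι`. -/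
def prodFinTwoEquivSum (ι : Type*) : ι × Fin 2 ≃ ι ⊕ ι where
  toFun := fun p => if p.2 = 0 then .inl p.1 else .inr p.1
  invFun := Sum.elim (fun i => (i, 0)) fun i => (i, 1)
  left_inv := by
    rintro ⟨i, a⟩
    fin_cases a <;> simp
  right_inv := by
    rintro (i | i) <;> simp

/-- For `N` even, `{0, …, N - 1}` cut into consecutive pairs. -/
def evenPairs {N : ℕ} (hN : Even N) : Fin (N / 2) × Fin 2 ≃ Fin N where
  toFun := fun p => ⟨2 * p.1.val + p.2.val, by
    have h1 := p.1.isLt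
    have h2 := p.2.isLt
    omega⟩
  invFun := fun k => (⟨k.val / 2, by
    have := k.isLt
    obtain ⟨m, rfl⟩ := hN
    omega⟩, ⟨k.val % 2, by omega⟩)
  left_inv := by
    rintro ⟨⟨j, hj⟩, ⟨a, ha⟩⟩
    simp only [Prod.mk.injEq, Fin.mk.injEq]
    omega
  right_inv := by
    rintro ⟨k, hk⟩
    simp only [Fin.mk.injEq]
    omega

/-- The Pfaffian of `Θ` on the first components and `C` on the second ones. -/
theorem pfaff_theta_front {N : ℕ} (hN : Even N) (C : Matrix (Fin N) (Fin N) ℂ) :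
    (pfaff fun p q : Fin N × Fin 2 => if p.2 = 0 ∧ q.2 = 0 then thetaMatrix N p.1 q.1 else
      if p.2 = 1 ∧ q.2 = 1 then C p.1 q.1 else 0) = pfFin C := by
  set n := N / 2 with hn
  let e := evenPairs hN
  let F : Fin N × Fin 2 → Fin N × Fin 2 → ℂ := fun p q =>
    if p.2 = 0 ∧ q.2 = 0 then thetaMatrix N p.1 q.1 else
      if p.2 = 1 ∧ q.2 = 1 then C p.1 q.1 else 0
  change pfaff F = _
  rw [← pfaff_reindex e F]
  -- Passing from pairs of components of one position to pairs of positions of one component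
  -- exchanges the two middle entries in each group of four: one transposition for each of the `n`
  -- groups.
  let π : Perm ((Fin n × Fin 2) × Fin 2) := (Equiv.prodAssoc _ _ _).symm.permCongr
    (Equiv.prodCongrRight fun _ : Fin n => Equiv.prodComm (Fin 2) (Fin 2))
  have hπ : ∀ p, π p = ((p.1.1, p.2), p.1.2) := fun p => rfl
  have hsign : Perm.sign π = (-1) ^ n := by
    have hc : Perm.sign (Equiv.prodComm (Fin 2) (Fin 2)) = -1 := by decide
    simp only [π, Perm.sign_permCongr, Perm.sign_prodCongrRight, hc]
    simp
  have h1 := pfaff_comp_perm π fun p q => F (e p.1, p.2) (e q.1, q.2)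
  have h2 : ((Perm.sign π : ℤ) : ℂ) = (-1) ^ n := by
    rw [hsign]
    push_cast
    rfl
  rw [h2] at h1
  have h3 := pfaff_reindex (prodFinTwoEquivSum (Fin n)).symm
    fun p q => F (e (π p).1, (π p).2) (e (π q).1, (π q).2)
  rw [h1, pfaff_sum] at h3
  -- `Θ` joins even positions to odd ones only, so its Pfaffian is the determinant of a triangular
  -- matrix with diagonal entries `-1`; this cancels the sign of `π`.
  · have hA : (pfaff fun p q : Fin n × Fin 2 => if p.2 = 0 ∧ q.2 = 1 then
        (Matrix.of fun j j' : Fin n => thetaMatrix N (e (j, 0)) (e (j', 1))) p.1 q.1 else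
        if p.2 = 1 ∧ q.2 = 0 then
          -(Matrix.of fun j j' : Fin n => thetaMatrix N (e (j, 0)) (e (j', 1))) q.1 p.1 else 0) =
          (-1) ^ n := by
      rw [pfaff_bipartite, Matrix.det_of_isLowerTriangular]
      · have : ∀ i : Fin n, thetaMatrix N (e (i, 0)) (e (i, 1)) = -1 := by
          intro i
          simp [thetaMatrix, e, evenPairs]
          omega
        simp [this]
      · intro i j hij
        have hij' : i < j := hij
        rw [Fin.lt_def] at hij'
        simp [thetaMatrix, e, evenPairs]
        rw [if_neg (by omega), if_neg (by omega), add_zero]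
    have hB : (fun p q : Fin n × Fin 2 =>
        F (e (π ((prodFinTwoEquivSum (Fin n)).symm (.inl p.1), p.2)).1,
          (π ((prodFinTwoEquivSum (Fin n)).symm (.inl p.1), p.2)).2)
          (e (π ((prodFinTwoEquivSum (Fin n)).symm (.inl q.1), q.2)).1,
          (π ((prodFinTwoEquivSum (Fin n)).symm (.inl q.1), q.2)).2)) =
        fun p q : Fin n × Fin 2 => if p.2 = 0 ∧ q.2 = 1 then
        (Matrix.of fun j j' : Fin n => thetaMatrix N (e (j, 0)) (e (j', 1))) p.1 q.1 else
        if p.2 = 1 ∧ q.2 = 0 then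
          -(Matrix.of fun j j' : Fin n => thetaMatrix N (e (j, 0)) (e (j', 1))) q.1 p.1 else 0 := by
      funext ⟨i, a⟩ ⟨j, b⟩
      simp only [hπ, prodFinTwoEquivSum, Equiv.coe_fn_symm_mk, Sum.elim_inl, F]
      fin_cases a <;> fin_cases b <;> simp [thetaMatrix, e, evenPairs]
      · rw [if_neg (by omega), if_neg (by omega), add_zero]
      · split_ifs <;> simp_all
      · rw [if_neg (by omega), if_neg (by omega), add_zero]
    rw [hB, hA] at h3
    have hpow : ((-1 : ℂ) ^ n) ≠ 0 := pow_ne_zero _ (by norm_num)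
    rw [← mul_left_cancel₀ hpow h3]
    rfl
  · intro i a k b
    simp [hπ, prodFinTwoEquivSum, F]
  · intro i a k b
    simp [hπ, prodFinTwoEquivSum, F]

theorem det_blockDiagonal_sigma {o : Type*} [Fintype o] [LinearOrder o] {m : o → Type*}
    [∀ k, Fintype (m k)] [∀ k, DecidableEq (m k)] (φ : ∀ k, Matrix (m k) (m k) ℂ) :
    (Matrix.blockDiagonal' φ).det = ∏ k, (φ k).det := by
  rw [(Matrix.blockTriangular_blockDiagonal' φ).det_fintype]
  refine Finset.prod_congr rfl fun k _ => ?_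
  rw [← Matrix.det_submatrix_equiv_self (Equiv.sigmaSubtype (β := m) k).symm]
  congr 1
  ext i j
  exact Matrix.blockDiagonal'_apply_eq φ k i j

/-- The Pfaffian of `L` over a triangular array factors. -/
theorem pfOn_triArray {N : ℕ} (hN : Even N) (ψ : ℕ+ → ℕ+ → ℂ) (z : TriArray N ℕ+) :
    (kernelLOf N ψ).pfOn (Sum.map id fun s : TriIndex N => ((s.1, z s.1 s.2) : Phys N)) =
      (∏ k : Fin N, Matrix.det
        (Matrix.of fun i j : Fin (k.val + 1) => phi (prevRow z.toInt k i) (z.toInt k j))) *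
      pfFin (Matrix.of fun i j : Fin N =>
        ψ (z ⟨N - 1, by have := i.isLt; omega⟩ ⟨i.val, by have := i.isLt; simp only; omega⟩)
          (z ⟨N - 1, by have := i.isLt; omega⟩ ⟨j.val, by have := j.isLt; simp only; omega⟩)) := by
  let w : Fin N ⊕ TriIndex N → VPhys N := Sum.map id fun s => (s.1, z s.1 s.2)
  have w1 : ∀ i, w (.inl i) = .inl i := fun _ => rfl
  have w2 : ∀ s, w (.inr s) = .inr (s.1, z s.1 s.2) := fun _ => rfl
  let A : (Fin N ⊕ TriIndex N) × Fin 2 → (Fin N ⊕ TriIndex N) × Fin 2 → ℂ := fun p q =>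
    kernelLOf N ψ (w p.1) (w q.1) p.2 q.2
  -- Only second components are shifted. The first component of an array entry now stands beside the
  -- second component of its predecessor, and the first component of `†_i` beside the second
  -- component of `z_i^N`. The virtual labels and the array labels decouple.
  let τ : Perm ((Fin N ⊕ TriIndex N) × Fin 2) :=
    Equiv.prodCongrLeft fun a => if a = 0 then 1 else chainShift N
  have hτ0 : ∀ s, τ (s, 0) = (s, 0) := fun s => rfl
  have hτ1 : ∀ s, τ (s, 1) = (chainShift N s, 1) := fun s => rfl
  have hsign : ((Perm.sign τ : ℤ) : ℂ) = (-1) ^ Fintype.card (TriIndex N) := by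
    simp only [τ, Perm.sign_prodCongrLeft, Fin.prod_univ_two]
    simp [sign_chainShift]
  have h1 := pfaff_comp_perm τ A
  rw [hsign] at h1
  let φ : ∀ k : Fin N, Matrix (Fin (k.val + 1)) (Fin (k.val + 1)) ℂ := fun k =>
    Matrix.of fun i j => phi (prevRow z.toInt k i) (z.toInt k j)
  have key : ∀ s s' : TriIndex N, kernelLOf N ψ (.inr (s.1, z s.1 s.2))
      (w (chainShift N (.inr s'))) 0 1 = -(Matrix.blockDiagonal' φ).transpose s s' := by
    intro s s'
    rw [chainShift_inr]
    obtain ⟨k, i⟩ := s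
    obtain ⟨k', i'⟩ := s'
    rw [Matrix.transpose_apply]
    by_cases hk : k' = k
    · subst hk
      rw [Matrix.blockDiagonal'_apply_eq]
      simp only [φ, Matrix.of_apply, prevRow, TriArray.toInt]
      split_ifs with h
      · rw [w2, kernelLOf_inr_inr]
        have : k'.val - 1 + 1 = k'.val := by omega
        simp only [this, phi]
        simp
        split_ifs <;> simp
      · rw [w1, kernelLOf_inr_inl]
        simp [phi]
    · rw [Matrix.blockDiagonal'_apply_ne _ _ _ hk, neg_zero]
      split_ifs with h
      · rw [w2, kernelLOf_inr_inr]
        have h' : k'.val ≠ k.val := fun h => hk (Fin.ext h)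
        have : k'.val - 1 + 1 ≠ k.val := by simp only at h; omega
        simp [this]
      · rw [w1, kernelLOf_inr_inl]
        simp [Ne.symm hk]
  have key' : ∀ s s' : TriIndex N, kernelLOf N ψ (w (chainShift N (.inr s')))
      (.inr (s.1, z s.1 s.2)) 1 0 = (Matrix.blockDiagonal' φ).transpose s s' := by
    intro s s'
    have h := key s s'
    rw [← neg_eq_iff_eq_neg] at h
    rw [← h]
    rcases hw : w (chainShift N (.inr s')) with j | q
    · rw [kernelLOf_inl_inr, kernelLOf_inr_inl]
      by_cases hj : j = s.1 <;> simp [hj, @eq_comm _ s.1 j]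
    · rw [kernelLOf_inr_inr, kernelLOf_inr_inr]
      simp
      split_ifs <;> simp
  have hfront : (pfaff fun p q : Fin N × Fin 2 => A (τ (.inl p.1, p.2)) (τ (.inl q.1, q.2))) =
      pfFin (Matrix.of fun i j : Fin N =>
        ψ (z ⟨N - 1, by have := i.isLt; omega⟩ ⟨i.val, by have := i.isLt; simp only; omega⟩)
          (z ⟨N - 1, by have := i.isLt; omega⟩ ⟨j.val, by have := j.isLt; simp only; omega⟩)) := by
    rw [← pfaff_theta_front hN]
    congr 1
    funext ⟨i, a⟩ ⟨j, b⟩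
    have hi := i.isLt
    have hs : N - 1 + 1 = N := by omega
    fin_cases a <;> fin_cases b <;>
      simp [hτ0, hτ1, A, chainShift_inl, w1, w2, kernelLOf_inl_inl, kernelLOf_inl_inr,
        kernelLOf_inr_inl, kernelLOf_inr_inr, hs]
  -- This block is bipartite with entries `-φ`; the sign from negating the determinant is the sign
  -- of the chain shift.
  have hback : (pfaff fun p q : TriIndex N × Fin 2 => A (τ (.inr p.1, p.2)) (τ (.inr q.1, q.2))) =
      (-1) ^ Fintype.card (TriIndex N) * ∏ k, (φ k).det := by
    rw [← det_blockDiagonal_sigma, ← Matrix.det_transpose, ← Matrix.det_neg, ← pfaff_bipartite]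
    congr 1
    funext ⟨s, a⟩ ⟨s', b⟩
    fin_cases a <;> fin_cases b
    · simp [hτ0, A, w2, kernelLOf_inr_inr]
    · simp [hτ0, hτ1, A, w2, key, -Matrix.blockDiagonal'_transpose]
    · simp [hτ0, hτ1, A, w2, key', -Matrix.blockDiagonal'_transpose]
    · refine Eq.trans ?_ (show (0 : ℂ) = _ by simp)
      simp only [hτ1, A, chainShift_inr, Fin.mk_one]
      have hs := s.1.isLt
      have hs' := s'.1.isLt
      split_ifs with h1 h2 h2
      · rw [w2, w2, kernelLOf_inr_inr]
        have : s.1.val - 1 + 1 ≠ N := by omega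
        simp [this]
      · rw [w2, w1, kernelLOf_inr_inl]
        simp
      · rw [w1, w2, kernelLOf_inl_inr]
        simp
      · rw [w1, w1, kernelLOf_inl_inl]
        simp
  rw [pfaff_sum, hfront, hback] at h1
  · have hpow : ((-1 : ℂ) ^ Fintype.card (TriIndex N)) ≠ 0 := pow_ne_zero _ (by norm_num)
    have h2 : (kernelLOf N ψ).pfOn w = pfaff A := rfl
    change (kernelLOf N ψ).pfOn w = _
    rw [h2]
    apply mul_left_cancel₀ hpow
    rw [← h1]
    ring
  · rintro i a s b
    have hi := i.isLt
    have hs : s.1.val < N := s.1.isLt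
    fin_cases a <;> fin_cases b
    · simp [hτ0, A, w1, w2, kernelLOf_inl_inr]
    · simp only [hτ0, hτ1, A, w1, chainShift_inr, Fin.mk_one, Fin.zero_eta]
      split_ifs
      · simp [w2, kernelLOf_inl_inr]
      · simp [w1, kernelLOf_inl_inl]
    · simp only [hτ0, hτ1, A, w2, chainShift_inl, Fin.mk_one, Fin.zero_eta]
      rw [kernelLOf_inr_inr]
      have : N - 1 + 1 ≠ s.1.val := by omega
      simp [this]
    · simp only [hτ1, A, w2, chainShift_inl, chainShift_inr, Fin.mk_one]
      split_ifs with h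
      · rw [w2, kernelLOf_inr_inr]
        have : s.1.val - 1 + 1 ≠ N := by omega
        simp [this]
      · rw [w1, kernelLOf_inr_inl]
        simp
  · rintro i a s b
    have hi := i.isLt
    have hs : s.1.val < N := s.1.isLt
    fin_cases a <;> fin_cases b
    · simp [hτ0, A, w1, w2, kernelLOf_inr_inl]
    · simp only [hτ0, hτ1, A, w1, chainShift_inr, Fin.mk_one, Fin.zero_eta]
      split_ifs
      · simp [w2, kernelLOf_inr_inl]
      · simp [w1, kernelLOf_inl_inl]
    · simp only [hτ0, hτ1, A, w2, chainShift_inl, Fin.mk_one, Fin.zero_eta]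
      rw [kernelLOf_inr_inr]
      have : N - 1 + 1 ≠ s.1.val := by omega
      simp [this]
    · simp only [hτ1, A, w2, chainShift_inl, chainShift_inr, Fin.mk_one]
      split_ifs with h
      · rw [w2, kernelLOf_inr_inr]
        have : s.1.val - 1 + 1 ≠ N := by omega
        simp [this]
      · rw [w1, kernelLOf_inl_inr]
        simp

theorem pfL_eq_weightW {N : ℕ} (hN : Even N) (α t r R : ℝ) (A : Finset (Phys N))
    (z : TriArray N ℕ+) (hz : Enumerates z A) :
    pfL N α t r R A = weightW N α t r R z.toInt := by
  have hinj : Function.Injective fun s : TriIndex N => ((s.1, z s.1 s.2) : Phys N) := by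
    rintro ⟨k, i⟩ ⟨k', i'⟩ h
    simp only [Prod.mk.injEq] at h
    obtain ⟨rfl, h⟩ := h
    rw [hz.1 k h]
  let e : TriIndex N ≃ A := Equiv.ofBijective
    (fun s => ⟨(s.1, z s.1 s.2), (hz.2 _ _).mpr ⟨s.2, rfl⟩⟩)
    ⟨fun s s' h => hinj (congrArg Subtype.val h), by
      rintro ⟨⟨k, x⟩, hx⟩
      obtain ⟨i, hi⟩ := (hz.2 k x).mp hx
      exact ⟨⟨k, i⟩, Subtype.ext (Prod.ext rfl hi)⟩⟩
  have h1 : pfL N α t r R A = (kernelLOf N fun x y => Psi α t r R x y).pfOn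
      (Sum.map id fun s : TriIndex N => ((s.1, z s.1 s.2) : Phys N)) := by
    unfold pfL
    rw [kernelL_eq_kernelLOf]
    refine (Kernel2.pfOn_congr _ (Equiv.sumCongr (Equiv.refl _) e) ?_).symm
    rintro (i | s) <;> rfl
  rw [h1, pfOn_triArray hN]
  rfl

end TriangularArrays

/-! ### Circle integrals with an exponential time parameter. -/

noncomputable section CircleIntegrals

open Complex MeasureTheory Filter Topology Metric Set

theorem circleIntegral_eq_of_differentiable_outside {f : ℂ → ℂ} {ρ₀ r R : ℝ} (h0 : 0 ≤ ρ₀)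
    (hf : ∀ z, ρ₀ < ‖z‖ → DifferentiableAt ℂ f z) (hr : ρ₀ < r) (hR : ρ₀ < R) :
    (∮ z in C(0, R), f z) = ∮ z in C(0, r), f z := by
  wlog hle : r ≤ R generalizing r R
  · exact (this hR hr (le_of_not_ge hle)).symm
  refine circleIntegral_eq_of_differentiable_on_annulus_off_countable (h0.trans_lt hr) hle
    Set.countable_empty ?_ ?_
  · intro z hz
    refine (hf z ?_).continuousAt.continuousWithinAt
    have : r ≤ ‖z‖ := by simpa using hz.2
    linarith
  · intro z hz
    refine hf z ?_
    have : r < ‖z‖ := by simpa using hz.1.2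
    linarith

/-- The circle may be enlarged at will, and the integrand decays faster than the reciprocal of its
length. -/
theorem circleIntegral_eq_zero_of_differentiable_outside {f : ℂ → ℂ} {ρ₀ r : ℝ} (h0 : 0 ≤ ρ₀)
    (hf : ∀ z, ρ₀ < ‖z‖ → DifferentiableAt ℂ f z) (hr : ρ₀ < r)
    (hlim : Tendsto (fun z => z * f z) (Bornology.cobounded ℂ) (𝓝 0)) :
    (∮ z in C(0, r), f z) = 0 := by
  rw [← norm_le_zero_iff]
  refine le_of_forall_pos_le_add fun ε hε => ?_
  rw [zero_add]
  have hev : ∀ᶠ z in Bornology.cobounded ℂ, ‖z * f z‖ < ε / (2 * Real.pi) := by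
    have := hlim.norm
    rw [norm_zero] at this
    exact this.eventually_lt_const (by positivity)
  rw [← comap_norm_atTop, eventually_comap] at hev
  obtain ⟨R₀, hR₀⟩ := (hev.and (eventually_gt_atTop (max ρ₀ 1))).exists
  have hRρ : ρ₀ < R₀ := (le_max_left _ _).trans_lt hR₀.2
  have hR1 : 1 < R₀ := (le_max_right _ _).trans_lt hR₀.2
  rw [← circleIntegral_eq_of_differentiable_outside h0 hf hr hRρ]
  have hb : ∀ z ∈ sphere (0 : ℂ) R₀, ‖f z‖ ≤ ε / (2 * Real.pi) / R₀ := by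
    intro z hz
    have hz' : ‖z‖ = R₀ := by simpa using hz
    have := hR₀.1 z hz'
    rw [norm_mul, hz'] at this
    rw [le_div_iff₀ (by linarith), mul_comm]
    exact this.le
  refine (circleIntegral.norm_integral_le_of_norm_le_const (by linarith) hb).trans (le_of_eq ?_)
  have := Real.pi_pos
  field_simp

theorem continuous_deriv_circleMap (ρ : ℝ) : Continuous fun θ : ℝ => deriv (circleMap 0 ρ) θ := by
  simp only [deriv_circleMap]
  exact (continuous_circleMap 0 ρ).mul continuous_const

theorem circleIntegral_intervalIntegral_swap {h : ℝ → ℂ → ℂ} {ρ a b : ℝ}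
    (hc : Continuous fun p : ℝ × ℝ => h p.1 (circleMap 0 ρ p.2)) :
    (∮ w in C(0, ρ), ∫ s in a..b, h s w) = ∫ s in a..b, ∮ w in C(0, ρ), h s w := by
  simp only [circleIntegral, smul_eq_mul, ← intervalIntegral.integral_const_mul]
  rw [intervalIntegral_intervalIntegral_swap]
  have hcont : Continuous (Function.uncurry fun θ s : ℝ =>
      deriv (circleMap 0 ρ) θ * h s (circleMap 0 ρ θ)) := by
    have h1 : Continuous fun p : ℝ × ℝ => h p.2 (circleMap 0 ρ p.1) :=
      hc.comp (continuous_snd.prodMk continuous_fst)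
    exact ((continuous_deriv_circleMap ρ).comp continuous_fst).mul h1
  exact (hcont.continuousOn.integrableOn_compact (isCompact_uIcc.prod isCompact_uIcc)).mono_set
    (Set.prod_mono uIoc_subset_uIcc uIoc_subset_uIcc)

theorem circleIntegral_circleIntegral_swap {h : ℂ → ℂ → ℂ} {r ρ : ℝ}
    (hc : Continuous fun p : ℝ × ℝ => h (circleMap 0 r p.1) (circleMap 0 ρ p.2)) :
    (∮ u in C(0, r), ∮ w in C(0, ρ), h u w) = ∮ w in C(0, ρ), ∮ u in C(0, r), h u w := by
  simp only [circleIntegral, smul_eq_mul, ← intervalIntegral.integral_const_mul]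
  rw [intervalIntegral_intervalIntegral_swap]
  · simp only [mul_left_comm]
  have hcont : Continuous (Function.uncurry fun θ s : ℝ =>
      deriv (circleMap 0 r) θ * (deriv (circleMap 0 ρ) s *
        h (circleMap 0 r θ) (circleMap 0 ρ s))) := by
    exact ((continuous_deriv_circleMap r).comp continuous_fst).mul
      (((continuous_deriv_circleMap ρ).comp continuous_snd).mul hc)
  exact (hcont.continuousOn.integrableOn_compact (isCompact_uIcc.prod isCompact_uIcc)).mono_set
    (Set.prod_mono uIoc_subset_uIcc uIoc_subset_uIcc)

/-- `(2πi)⁻¹ ∮_{|w| = ρ} F(w) e^{s(w-1)} dw`. -/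
def circleExp (ρ : ℝ) (F : ℂ → ℂ) (s : ℝ) : ℂ :=
  (2 * (Real.pi : ℂ) * I)⁻¹ * ∮ w in C(0, ρ), F w * exp (s * (w - 1))

theorem circleExp_congr {ρ : ℝ} (hρ : 0 ≤ ρ) {F G : ℂ → ℂ} (h : ∀ w, ‖w‖ = ρ → F w = G w) (s : ℝ) :
    circleExp ρ F s = circleExp ρ G s := by
  unfold circleExp
  congr 1
  refine circleIntegral.integral_congr hρ fun w hw => ?_
  rw [h w (by simpa using hw)]

theorem continuous_circleExp_integrand {ρ : ℝ} {F : ℂ → ℂ}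
    (hF : ContinuousOn F (sphere 0 |ρ|)) :
    Continuous fun p : ℝ × ℝ => F (circleMap 0 ρ p.2) * exp (p.1 * (circleMap 0 ρ p.2 - 1)) := by
  have h1 : Continuous fun p : ℝ × ℝ => F (circleMap 0 ρ p.2) :=
    (hF.comp_continuous (continuous_circleMap 0 ρ) fun θ => circleMap_mem_sphere' 0 ρ θ).comp
      continuous_snd
  have h2 : Continuous fun p : ℝ × ℝ => circleMap 0 ρ p.2 :=
    (continuous_circleMap 0 ρ).comp continuous_snd
  exact h1.mul (((continuous_ofReal.comp continuous_fst).mul (h2.sub continuous_const)).cexp)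

theorem circleIntegrable_mul_exp {ρ : ℝ} {F : ℂ → ℂ} (hF : ContinuousOn F (sphere 0 |ρ|)) (s : ℝ) :
    CircleIntegrable (fun w => F w * exp (s * (w - 1))) 0 ρ :=
  ContinuousOn.circleIntegrable' (hF.mul (by fun_prop))

theorem circleExp_add {ρ : ℝ} {F G : ℂ → ℂ} (hF : ContinuousOn F (sphere 0 |ρ|))
    (hG : ContinuousOn G (sphere 0 |ρ|)) (s : ℝ) :
    circleExp ρ (fun w => F w + G w) s = circleExp ρ F s + circleExp ρ G s := by
  unfold circleExp
  rw [← mul_add, ← circleIntegral.integral_add (circleIntegrable_mul_exp hF s)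
    (circleIntegrable_mul_exp hG s)]
  simp only [add_mul]

theorem circleExp_const_mul (ρ : ℝ) (F : ℂ → ℂ) (c : ℂ) (s : ℝ) :
    circleExp ρ (fun w => c * F w) s = c * circleExp ρ F s := by
  unfold circleExp
  simp only [mul_assoc]
  rw [circleIntegral.integral_const_mul]
  ring

theorem norm_circleExp_le {ρ C T : ℝ} (hρ : 0 ≤ ρ) {F : ℂ → ℂ} (hF : ∀ w, ‖w‖ = ρ → ‖F w‖ ≤ C)
    {s : ℝ} (hs : |s| ≤ T) : ‖circleExp ρ F s‖ ≤ ρ * (C * Real.exp (T * (ρ + 1))) := by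
  refine circleIntegral.norm_two_pi_i_inv_smul_integral_le_of_norm_le_const hρ fun w hw => ?_
  have hw' : ‖w‖ = ρ := by simpa using hw
  have hC : 0 ≤ C := (norm_nonneg _).trans (hF w hw')
  rw [norm_mul]
  refine mul_le_mul (hF w hw') ?_ (norm_nonneg _) hC
  refine (Complex.norm_exp_le_exp_norm _).trans (Real.exp_le_exp.mpr ?_)
  rw [norm_mul, Complex.norm_real, Real.norm_eq_abs]
  refine mul_le_mul hs ?_ (norm_nonneg _) ((abs_nonneg s).trans hs)
  refine (norm_sub_le _ _).trans ?_
  simp [hw']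

/-- The exponential brings down a factor `w - 1`. This turns algebraic relations between the
integrands into differential equations in time. -/
theorem hasDerivAt_circleExp {ρ : ℝ} {F : ℂ → ℂ} (hF : ContinuousOn F (sphere 0 |ρ|)) (s : ℝ) :
    HasDerivAt (circleExp ρ F) (circleExp ρ (fun w => F w * (w - 1)) s) s := by
  unfold circleExp
  refine HasDerivAt.const_mul _ ?_
  simp only [circleIntegral, smul_eq_mul]
  have hF' : Continuous fun θ : ℝ => F (circleMap 0 ρ θ) :=
    hF.comp_continuous (continuous_circleMap 0 ρ) fun θ => circleMap_mem_sphere' 0 ρ θ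
  have hd := continuous_deriv_circleMap ρ
  have hm := continuous_circleMap 0 ρ
  let G : ℝ → ℝ → ℂ := fun x θ =>
    deriv (circleMap 0 ρ) θ * (F (circleMap 0 ρ θ) * exp (x * (circleMap 0 ρ θ - 1)))
  let G' : ℝ → ℝ → ℂ := fun x θ => deriv (circleMap 0 ρ) θ *
    (F (circleMap 0 ρ θ) * (circleMap 0 ρ θ - 1) * exp (x * (circleMap 0 ρ θ - 1)))
  have hG'c : Continuous (Function.uncurry G') := by
    simp only [G', Function.uncurry_def]
    have h1 : Continuous fun p : ℝ × ℝ => F (circleMap 0 ρ p.2) := hF'.comp continuous_snd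
    have h2 : Continuous fun p : ℝ × ℝ => deriv (circleMap 0 ρ) p.2 := hd.comp continuous_snd
    have h3 : Continuous fun p : ℝ × ℝ => circleMap 0 ρ p.2 := hm.comp continuous_snd
    exact h2.mul ((h1.mul (h3.sub continuous_const)).mul
      (((continuous_ofReal.comp continuous_fst).mul (h3.sub continuous_const)).cexp))
  obtain ⟨C, hC⟩ := ((isCompact_closedBall s 1).prod
    (isCompact_uIcc (a := (0 : ℝ)) (b := 2 * Real.pi))).exists_bound_of_continuousOn
      hG'c.continuousOn
  have hGc : ∀ x, Continuous (G x) := by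
    intro x
    exact hd.mul (hF'.mul ((continuous_const.mul (hm.sub continuous_const)).cexp))
  refine (intervalIntegral.hasDerivAt_integral_of_dominated_loc_of_deriv_le (F := G) (F' := G')
    (bound := fun _ => C) (ball_mem_nhds s one_pos) ?_ ?_ ?_ ?_ ?_ ?_).2
  · exact Eventually.of_forall fun x => (hGc x).aestronglyMeasurable
  · exact (hGc s).intervalIntegrable _ _
  · exact (hG'c.comp (Continuous.prodMk_right s)).aestronglyMeasurable
  · refine ae_of_all _ fun θ hθ x hx => ?_
    exact hC (x, θ) ⟨ball_subset_closedBall hx, uIoc_subset_uIcc hθ⟩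
  · exact intervalIntegrable_const
  · refine ae_of_all _ fun θ _ x _ => ?_
    simp only [G, G']
    refine HasDerivAt.const_mul _ ?_
    rw [mul_assoc]
    refine HasDerivAt.const_mul _ ?_
    have h1 : HasDerivAt (fun x : ℝ => (x : ℂ) * (circleMap 0 ρ θ - 1)) (circleMap 0 ρ θ - 1) x := by
      simpa using (Complex.ofRealCLM.hasDerivAt (x := x)).mul_const (circleMap 0 ρ θ - 1)
    convert! h1.cexp using 1
    ring

theorem continuous_circleExp {ρ : ℝ} {F : ℂ → ℂ} (hF : ContinuousOn F (sphere 0 |ρ|)) :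
    Continuous (circleExp ρ F) :=
  continuous_iff_continuousAt.mpr fun s => (hasDerivAt_circleExp hF s).continuousAt

theorem hasSum_circleExp {ι : Type*} [Countable ι] {ρ : ℝ} {F : ι → ℂ → ℂ} {G : ℂ → ℂ} {b : ι → ℝ}
    (hρ : 0 ≤ ρ) (hF : ∀ n, ContinuousOn (F n) (sphere 0 ρ)) (hb : Summable b)
    (hFb : ∀ n w, ‖w‖ = ρ → ‖F n w‖ ≤ b n)
    (hsum : ∀ w, ‖w‖ = ρ → HasSum (fun n => F n w) (G w)) (s : ℝ) :
    HasSum (fun n => circleExp ρ (F n) s) (circleExp ρ G s) := by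
  unfold circleExp
  refine HasSum.mul_left _ ?_
  simp only [circleIntegral, smul_eq_mul]
  have hnorm : ∀ θ, ‖circleMap 0 ρ θ‖ = ρ := fun θ => by simp [abs_of_nonneg hρ]
  have hd := continuous_deriv_circleMap ρ
  have hm := continuous_circleMap 0 ρ
  let E : ℝ := Real.exp (|s| * (ρ + 1))
  refine intervalIntegral.hasSum_integral_of_dominated_convergence (fun n _ => ρ * (b n * E))
    ?_ ?_ ?_ ?_ ?_
  · intro n
    have h1 : Continuous fun θ : ℝ => F n (circleMap 0 ρ θ) :=
      (hF n).comp_continuous (continuous_circleMap 0 ρ) fun θ => by simpa using hnorm θ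
    exact (hd.mul (h1.mul ((continuous_const.mul
      (hm.sub continuous_const)).cexp))).aestronglyMeasurable
  · intro n
    refine ae_of_all _ fun θ _ => ?_
    have hbn : 0 ≤ b n := (norm_nonneg _).trans (hFb n _ (hnorm θ))
    rw [norm_mul, norm_mul]
    refine mul_le_mul (by simp [abs_of_nonneg hρ]) ?_ (by positivity) hρ
    refine mul_le_mul (hFb n _ (hnorm θ)) ?_ (norm_nonneg _) hbn
    refine (Complex.norm_exp_le_exp_norm _).trans (Real.exp_le_exp.mpr ?_)
    rw [norm_mul, Complex.norm_real, Real.norm_eq_abs]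
    refine mul_le_mul_of_nonneg_left ?_ (abs_nonneg s)
    refine (norm_sub_le _ _).trans ?_
    rw [hnorm, norm_one]
  · exact ae_of_all _ fun θ _ => (hb.mul_right E).mul_left ρ
  · exact intervalIntegrable_const
  · refine ae_of_all _ fun θ _ => ?_
    exact ((hsum _ (hnorm θ)).mul_right _).mul_left _

theorem circleExp_radius {ρ₀ r R : ℝ} (h0 : 0 ≤ ρ₀) {F : ℂ → ℂ}
    (hF : ∀ z, ρ₀ < ‖z‖ → DifferentiableAt ℂ F z) (hr : ρ₀ < r) (hR : ρ₀ < R) (s : ℝ) :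
    circleExp R F s = circleExp r F s := by
  unfold circleExp
  congr 1
  refine circleIntegral_eq_of_differentiable_outside h0 (fun z hz => ?_) hr hR
  exact (hF z hz).mul (by fun_prop)

theorem circleExp_zero_eq_zero {ρ₀ r : ℝ} (h0 : 0 ≤ ρ₀) {F : ℂ → ℂ}
    (hF : ∀ z, ρ₀ < ‖z‖ → DifferentiableAt ℂ F z) (hr : ρ₀ < r)
    (hlim : Tendsto (fun z => z * F z) (Bornology.cobounded ℂ) (𝓝 0)) : circleExp r F 0 = 0 := by
  unfold circleExp
  simp only [ofReal_zero, zero_mul, exp_zero, mul_one]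
  rw [circleIntegral_eq_zero_of_differentiable_outside h0 hF hr hlim, mul_zero]

end CircleIntegrals

/-! ### The kernel `Ψ` as a time integral of Wronskians. -/

noncomputable section PsiKernel

open Complex MeasureTheory Filter Topology Metric Set

/-- `w^{1-n} / ((w - α)(w - 1))`. -/
def psiFactor (α : ℝ) (n : ℕ) (w : ℂ) : ℂ := w * w⁻¹ ^ n / ((w - α) * (w - 1))

theorem sub_ne_zero_of_norm_lt {w a : ℂ} (h : ‖a‖ < ‖w‖) : w - a ≠ 0 := by
  rw [sub_ne_zero]
  rintro rfl
  exact lt_irrefl _ h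

theorem ne_zero_of_one_lt_norm {w : ℂ} (h : 1 < ‖w‖) : w ≠ 0 := by
  rw [← norm_pos_iff]
  linarith

theorem differentiableAt_psiFactor {α : ℝ} (n : ℕ) {w : ℂ} (h : max 1 |α| < ‖w‖) :
    DifferentiableAt ℂ (psiFactor α n) w := by
  have h1 : 1 < ‖w‖ := (le_max_left _ _).trans_lt h
  have hα : |α| < ‖w‖ := (le_max_right _ _).trans_lt h
  have hw := ne_zero_of_one_lt_norm h1
  have hw1 : w - 1 ≠ 0 := sub_ne_zero_of_norm_lt (by simpa using h1)
  have hwα : w - α ≠ 0 := sub_ne_zero_of_norm_lt (by simpa using hα)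
  unfold psiFactor
  refine DifferentiableAt.div ?_ (by fun_prop) (mul_ne_zero hwα hw1)
  exact differentiableAt_id.mul ((differentiableAt_id.inv hw).pow n)

theorem continuousOn_psiFactor {α ρ : ℝ} (n : ℕ) (h : max 1 |α| < ρ) :
    ContinuousOn (psiFactor α n) (sphere 0 |ρ|) := by
  intro w hw
  refine (differentiableAt_psiFactor n ?_).continuousAt.continuousWithinAt
  have : ‖w‖ = |ρ| := by simpa using hw
  rw [this]
  exact h.trans_le (le_abs_self ρ)

theorem mul_psiFactor_succ {α : ℝ} (n : ℕ) {w : ℂ} (hw : w ≠ 0) :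
    w * psiFactor α (n + 1) w = psiFactor α n w := by
  unfold psiFactor
  rw [pow_succ, ← mul_div_assoc]
  congr 1
  field_simp

/-- The pairing factor vanishes at infinity fast enough for the contour to be removed. -/
theorem circleIntegral_pairing_eq_zero {α ρ : ℝ} (n : ℕ) (a c : ℂ) (h : max 1 |α| < ρ)
    (ha : ‖a‖ + 1 < ρ) :
    (∮ w in C(0, ρ), (a - w) / (1 - a - w) * psiFactor α (n + 1) w * c) = 0 := by
  have hρ₀ : max (max 1 |α|) (‖a‖ + 1) < ρ := max_lt h ha
  refine circleIntegral_eq_zero_of_differentiable_outside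
    ((zero_le_one.trans (le_max_left _ _)).trans (le_max_left _ _)) (fun z hz => ?_) hρ₀ ?_
  · have hz1 : max 1 |α| < ‖z‖ := (le_max_left _ _).trans_lt hz
    have hz2 : ‖a‖ + 1 < ‖z‖ := (le_max_right _ _).trans_lt hz
    have hne : 1 - a - z ≠ 0 := by
      have := sub_ne_zero_of_norm_lt (w := z) (a := 1 - a)
        ((norm_sub_le _ _).trans_lt (by rw [norm_one]; linarith))
      intro h0
      exact this (by linear_combination -h0)
    exact ((DifferentiableAt.div (by fun_prop) (by fun_prop) hne).mul
      (differentiableAt_psiFactor _ hz1)).mul_const c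
  -- In the variable `v = 1 / w`, the integrand multiplied by `w` extends continuously to `v = 0`,
  -- with value 0 because of the power `v ^ (n + 1)`.
  · have hcont : ContinuousAt (fun v : ℂ => (a * v - 1) / ((1 - a) * v - 1) *
        (v ^ (n + 1) / ((1 - α * v) * (1 - v))) * c) 0 := by
      refine ContinuousAt.mul (ContinuousAt.mul (ContinuousAt.div (by fun_prop) (by fun_prop)
        (by simp)) (ContinuousAt.div (by fun_prop) (by fun_prop) (by simp))) (by fun_prop)
    have h0 := hcont.tendsto.comp (tendsto_inv₀_cobounded (α := ℂ))
    simp only [ne_eq, Nat.add_eq_zero_iff, one_ne_zero, and_false, not_false_eq_true, zero_pow,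
      zero_div, mul_zero, zero_mul] at h0
    refine h0.congr' ?_
    have hev : ∀ᶠ z in Bornology.cobounded ℂ, max (max 1 |α|) (‖a‖ + 1) < ‖z‖ :=
      tendsto_norm_cobounded_atTop.eventually_gt_atTop _
    filter_upwards [hev] with z hz
    have hz1 : 1 < ‖z‖ := ((le_max_left _ _).trans (le_max_left _ _)).trans_lt hz
    have hzα : |α| < ‖z‖ := ((le_max_right _ _).trans (le_max_left _ _)).trans_lt hz
    have hz2 : ‖a‖ + 1 < ‖z‖ := (le_max_right _ _).trans_lt hz
    have hne : 1 - a - z ≠ 0 := by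
      have := sub_ne_zero_of_norm_lt (w := z) (a := 1 - a)
        ((norm_sub_le _ _).trans_lt (by rw [norm_one]; linarith))
      intro h0
      exact this (by linear_combination -h0)
    have hw := ne_zero_of_one_lt_norm hz1
    have hw1 : z - 1 ≠ 0 := sub_ne_zero_of_norm_lt (by simpa using hz1)
    have hwα : z - α ≠ 0 := sub_ne_zero_of_norm_lt (by simpa using hzα)
    simp only [Function.comp_apply, psiFactor]
    have e1 : (a * z⁻¹ - 1) / ((1 - a) * z⁻¹ - 1) = (a - z) / (1 - a - z) := by
      have : (1 - a) * z⁻¹ - 1 = (1 - a - z) * z⁻¹ := by field_simp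
      rw [this, div_eq_div_iff (mul_ne_zero hne (inv_ne_zero hw)) hne]
      field_simp
    have e2 : z⁻¹ ^ (n + 1) / ((1 - α * z⁻¹) * (1 - z⁻¹)) =
        z * (z * z⁻¹ ^ (n + 1) / ((z - α) * (z - 1))) := by
      have : (1 - α * z⁻¹) * (1 - z⁻¹) = (z - α) * (z - 1) * (z⁻¹ * z⁻¹) := by field_simp
      rw [this]
      field_simp
    rw [e1, e2]
    ring

/-- If `u + w = 1`, the triangle inequality forces the two moduli to differ by at most 1. -/
theorem add_sub_one_ne_zero_of_separated {r R : ℝ} (h : 1 < |r - R|) {u w : ℂ} (hu : ‖u‖ = r)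
    (hw : ‖w‖ = R) : 1 - u - w ≠ 0 := by
  intro h0
  have h1 : w = 1 - u := by linear_combination -h0
  have h2 : ‖u‖ ≤ ‖w‖ + 1 := by
    have : u = 1 - w := by linear_combination -h0
    rw [this]
    refine (norm_sub_le _ _).trans ?_
    rw [norm_one]
    linarith
  have h3 : ‖w‖ ≤ ‖u‖ + 1 := by
    rw [h1]
    refine (norm_sub_le _ _).trans ?_
    rw [norm_one]
    linarith
  rw [hu, hw] at h2 h3
  rcases lt_abs.mp h with h | h <;> linarith

theorem continuous_pairing {α r R : ℝ} (hr : max 1 |α| < r) (hR : max 1 |α| < R)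
    (h : 1 < |r - R|) (m n : ℕ) :
    Continuous fun p : ℝ × ℝ => (circleMap 0 r p.1 - circleMap 0 R p.2) /
      (1 - circleMap 0 r p.1 - circleMap 0 R p.2) * psiFactor α (m + 1) (circleMap 0 R p.2) *
        psiFactor α (n + 1) (circleMap 0 r p.1) := by
  have hr0 : 0 < r := zero_lt_one.trans ((le_max_left _ _).trans_lt hr)
  have hR0 : 0 < R := zero_lt_one.trans ((le_max_left _ _).trans_lt hR)
  have h1 : Continuous fun p : ℝ × ℝ => circleMap 0 r p.1 :=
    (continuous_circleMap 0 r).comp continuous_fst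
  have h2 : Continuous fun p : ℝ × ℝ => circleMap 0 R p.2 :=
    (continuous_circleMap 0 R).comp continuous_snd
  have h3 : Continuous fun p : ℝ × ℝ => psiFactor α (m + 1) (circleMap 0 R p.2) :=
    (continuousOn_psiFactor _ hR).comp_continuous h2 fun p => circleMap_mem_sphere' 0 R p.2
  have h4 : Continuous fun p : ℝ × ℝ => psiFactor α (n + 1) (circleMap 0 r p.1) :=
    (continuousOn_psiFactor _ hr).comp_continuous h1 fun p => circleMap_mem_sphere' 0 r p.1
  refine (((h1.sub h2).div ((continuous_const.sub h1).sub h2) fun p => ?_).mul h3).mul h4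
  exact add_sub_one_ne_zero_of_separated h (by simp [abs_of_pos hr0]) (by simp [abs_of_pos hR0])

/-- At `t = 0` the double contour integral vanishes. -/
theorem circleIntegral_pairing_pairing_eq_zero {α r R : ℝ} (hr : max 1 |α| < r)
    (hR : max 1 |α| < R) (h : 1 < |r - R|) (m n : ℕ) :
    (∮ u in C(0, r), ∮ w in C(0, R), (u - w) / (1 - u - w) * psiFactor α (m + 1) w *
      psiFactor α (n + 1) u) = 0 := by
  have hr0 : 0 < r := zero_lt_one.trans ((le_max_left _ _).trans_lt hr)
  have hR0 : 0 < R := zero_lt_one.trans ((le_max_left _ _).trans_lt hR)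
  -- The larger circle is pushed to infinity. The pole of the pairing factor lies inside it, because
  -- its radius exceeds that of the other circle by more than 1.
  rcases lt_abs.mp h with h1 | h1
  · rw [circleIntegral_circleIntegral_swap (continuous_pairing hr hR h m n)]
    have : EqOn (fun w => ∮ u in C(0, r), (u - w) / (1 - u - w) * psiFactor α (m + 1) w *
      psiFactor α (n + 1) u) (fun _ => (0 : ℂ)) (sphere 0 R) := by
      intro w hw
      have hw' : ‖w‖ = R := by simpa using hw
      have := circleIntegral_pairing_eq_zero (α := α) (ρ := r) n w (-psiFactor α (m + 1) w) hr
        (by rw [hw']; linarith)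
      refine Eq.trans ?_ this
      refine circleIntegral.integral_congr (E := ℂ) hr0.le fun u _ => ?_
      rw [show 1 - u - w = 1 - w - u by ring, show u - w = -(w - u) by ring]
      ring
    rw [circleIntegral.integral_congr hR0.le this]
    simp [circleIntegral]
  · have : EqOn (fun u => ∮ w in C(0, R), (u - w) / (1 - u - w) * psiFactor α (m + 1) w *
      psiFactor α (n + 1) u) (fun _ => (0 : ℂ)) (sphere 0 r) := by
      intro u hu
      have hu' : ‖u‖ = r := by simpa using hu
      exact circleIntegral_pairing_eq_zero m u _ hR (by rw [hu']; linarith)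
    rw [circleIntegral.integral_congr hr0.le this]
    simp [circleIntegral]

theorem AdmissibleRadii.max_lt_left {α r R : ℝ} (h : AdmissibleRadii α r R) : max 1 |α| < r :=
  max_lt h.one_lt_left h.alpha_lt_left

theorem AdmissibleRadii.max_lt_right {α r R : ℝ} (h : AdmissibleRadii α r R) : max 1 |α| < R :=
  max_lt h.one_lt_right h.alpha_lt_right

/-- With `ζ = u + w - 1`, the factor in front of the integral cancels the denominator of `Ψ`, which
decouples the two contours. -/
theorem exp_mul_eq_one_add_integral (t : ℝ) (ζ : ℂ) :
    exp (t * ζ) = 1 + ζ * ∫ s in (0 : ℝ)..t, exp (s * ζ) := by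
  have hd : ∀ s ∈ uIcc 0 t, HasDerivAt (fun s : ℝ => exp (s * ζ)) (ζ * exp (s * ζ)) s := by
    intro s _
    have h1 : HasDerivAt (fun x : ℝ => (x : ℂ) * ζ) ζ s := by
      simpa using (Complex.ofRealCLM.hasDerivAt (x := s)).mul_const ζ
    convert! h1.cexp using 1
    ring
  have := intervalIntegral.integral_eq_sub_of_hasDerivAt hd
    (by apply Continuous.intervalIntegrable; fun_prop)
  rw [intervalIntegral.integral_const_mul] at this
  rw [this]
  simp

theorem zpow_one_sub_nat {w : ℂ} (hw : w ≠ 0) (n : ℕ) :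
    w ^ (1 - (n : ℤ)) = w * w⁻¹ ^ n := by
  rw [zpow_sub₀ hw, zpow_one, zpow_natCast, inv_pow, div_eq_mul_inv]

set_option maxHeartbeats 800000 in
/-- The double contour integral `Ψ` as a single time integral. -/
theorem Psi_eq_integral_of_radii {α r R : ℝ} (t : ℝ) (h : AdmissibleRadii α r R) (m n : ℕ) :
    Psi α t r R ((m + 1 : ℕ) : ℤ) ((n + 1 : ℕ) : ℤ) = (α : ℂ) ^ 2 * exp (-t) *
      ∫ s in (0 : ℝ)..t, exp s *
        (circleExp R (psiFactor α m) s * circleExp r (psiFactor α (n + 1)) s -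
          circleExp R (psiFactor α (m + 1)) s * circleExp r (psiFactor α n) s) := by
  have hr := h.max_lt_left
  have hR := h.max_lt_right
  have hr0 : 0 < r := zero_lt_one.trans ((le_max_left _ _).trans_lt hr)
  have hR0 : 0 < R := zero_lt_one.trans ((le_max_left _ _).trans_lt hR)
  set κ : ℂ := (2 * (Real.pi : ℂ) * I)⁻¹ with hκ
  let Fm := psiFactor α (m + 1)
  let Fn := psiFactor α (n + 1)
  let q : ℂ → ℂ → ℝ → ℂ := fun u w s =>
    exp s * ((w - u) * (Fm w * exp (s * (w - 1))) * (Fn u * exp (s * (u - 1))))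
  have hcm := continuous_circleMap 0 R
  have hcn := continuous_circleMap 0 r
  have hFm : Continuous fun θ : ℝ => Fm (circleMap 0 R θ) :=
    (continuousOn_psiFactor _ hR).comp_continuous hcm fun p => circleMap_mem_sphere' 0 R p
  have hFn : Continuous fun θ : ℝ => Fn (circleMap 0 r θ) :=
    (continuousOn_psiFactor _ hr).comp_continuous hcn fun p => circleMap_mem_sphere' 0 r p
  -- The constant 1 in the expansion of the exponential leaves the double integral at time zero,
  -- which vanishes. In the other term the denominator has disappeared.
  have hInt : ∀ u w, ‖u‖ = r → ‖w‖ = R →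
      (u - w) / (1 - u - w) *
        (w ^ (1 - ((m + 1 : ℕ) : ℤ)) * exp (t * (w - 1)) / ((w - α) * (w - 1))) *
        (u ^ (1 - ((n + 1 : ℕ) : ℤ)) * exp (t * (u - 1)) / ((u - α) * (u - 1))) =
      exp (-t) * ((u - w) / (1 - u - w) * Fm w * Fn u) +
        exp (-t) * ∫ s in (0 : ℝ)..t, q u w s := by
    intro u w hu hw
    have hu0 : u ≠ 0 := by rw [← norm_pos_iff, hu]; exact hr0
    have hw0 : w ≠ 0 := by rw [← norm_pos_iff, hw]; exact hR0
    have hne := add_sub_one_ne_zero_of_separated h.separated hu hw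
    have hne' : w + u - 1 ≠ 0 := fun h0 => hne (by linear_combination -h0)
    rw [zpow_one_sub_nat hu0, zpow_one_sub_nat hw0]
    have hexp := exp_mul_eq_one_add_integral t (w + u - 1)
    have hq : (∫ s in (0 : ℝ)..t, q u w s) =
        (w - u) * Fm w * Fn u * ∫ s in (0 : ℝ)..t, exp (s * (w + u - 1)) := by
      rw [← intervalIntegral.integral_const_mul]
      refine intervalIntegral.integral_congr fun s _ => ?_
      simp only [q]
      rw [show (s : ℂ) * (w + u - 1) = s + s * (w - 1) + s * (u - 1) by ring, exp_add, exp_add]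
      ring
    rw [hq]
    have e1 : exp (t * (w - 1)) * exp (t * (u - 1)) = exp (-t) * exp (t * (w + u - 1)) := by
      rw [← exp_add, ← exp_add]
      congr 1
      ring
    have e2 : (u - w) / (1 - u - w) *
        (w * w⁻¹ ^ (m + 1) * exp (t * (w - 1)) / ((w - α) * (w - 1))) *
        (u * u⁻¹ ^ (n + 1) * exp (t * (u - 1)) / ((u - α) * (u - 1))) =
        (u - w) / (1 - u - w) * Fm w * Fn u * (exp (t * (w - 1)) * exp (t * (u - 1))) := by
      simp only [Fm, Fn, psiFactor]
      ring
    rw [e2, e1, hexp]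
    have e3 : (u - w) / (1 - u - w) * (w + u - 1) = w - u := by
      field_simp
      ring
    linear_combination (exp (-t) * Fm w * Fn u * ∫ s in (0 : ℝ)..t, exp (s * (w + u - 1))) * e3
  have hqc : ∀ u, Continuous fun p : ℝ × ℝ => q u (circleMap 0 R p.2) p.1 := by
    intro u
    have h2 : Continuous fun p : ℝ × ℝ => circleMap 0 R p.2 := hcm.comp continuous_snd
    have h3 : Continuous fun p : ℝ × ℝ => Fm (circleMap 0 R p.2) := hFm.comp continuous_snd
    have h4 : Continuous fun p : ℝ × ℝ => (p.1 : ℂ) := continuous_ofReal.comp continuous_fst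
    exact h4.cexp.mul (((h2.sub continuous_const).mul (h3.mul
      ((h4.mul (h2.sub continuous_const)).cexp))).mul
      (continuous_const.mul ((h4.mul continuous_const).cexp)))
  let S : ℝ → ℂ → ℂ := fun s u =>
    exp s * (circleExp R (psiFactor α m) s * (Fn u * exp (s * (u - 1))) -
      circleExp R Fm s * (psiFactor α n u * exp (s * (u - 1))))
  -- Multiplication by `w` or `u` lowers the index of the corresponding factor by one, so `w - u`
  -- splits the integrand into a difference of two products.
  have hinner : ∀ u, ‖u‖ = r → ∀ s : ℝ, κ * (∮ w in C(0, R), q u w s) = S s u := by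
    intro u hu s
    have hu0 : u ≠ 0 := by rw [← norm_pos_iff, hu]; exact hr0
    have : EqOn (fun w => q u w s) (fun w =>
        (exp s * (Fn u * exp (s * (u - 1)))) * (psiFactor α m w * exp (s * (w - 1))) -
        (exp s * (psiFactor α n u * exp (s * (u - 1)))) * (Fm w * exp (s * (w - 1))))
        (sphere 0 R) := by
      intro w hw
      have hw0 : w ≠ 0 := by
        rw [← norm_pos_iff, show ‖w‖ = R by simpa using hw]
        exact hR0
      simp only [q]
      rw [← mul_psiFactor_succ n hu0, ← mul_psiFactor_succ m hw0]
      simp only [Fm, Fn]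
      ring
    rw [circleIntegral.integral_congr hR0.le this, circleIntegral.integral_sub]
    · rw [circleIntegral.integral_const_mul, circleIntegral.integral_const_mul]
      simp only [S, circleExp, ← hκ]
      ring
    · exact (circleIntegrable_mul_exp (continuousOn_psiFactor m hR) s).const_mul _
    · exact (circleIntegrable_mul_exp (continuousOn_psiFactor (m + 1) hR) s).const_mul _
  have houter : ∀ s : ℝ, κ * (∮ u in C(0, r), S s u) = exp s *
      (circleExp R (psiFactor α m) s * circleExp r Fn s -
        circleExp R Fm s * circleExp r (psiFactor α n) s) := by
    intro s
    have : (fun u => S s u) = fun u =>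
        (exp s * circleExp R (psiFactor α m) s) * (Fn u * exp (s * (u - 1))) -
        (exp s * circleExp R Fm s) * (psiFactor α n u * exp (s * (u - 1))) := by
      funext u
      simp only [S]
      ring
    rw [this, circleIntegral.integral_sub]
    · rw [circleIntegral.integral_const_mul, circleIntegral.integral_const_mul]
      simp only [circleExp, ← hκ]
      ring
    · exact (circleIntegrable_mul_exp (continuousOn_psiFactor (n + 1) hr) s).const_mul _
    · exact (circleIntegrable_mul_exp (continuousOn_psiFactor n hr) s).const_mul _
  have hSc : Continuous fun p : ℝ × ℝ => S p.1 (circleMap 0 r p.2) := by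
    have h4 : Continuous fun p : ℝ × ℝ => (p.1 : ℂ) := continuous_ofReal.comp continuous_fst
    exact h4.cexp.mul ((((continuous_circleExp (continuousOn_psiFactor m hR)).comp
      continuous_fst).mul (continuous_circleExp_integrand (continuousOn_psiFactor (n + 1) hr))).sub
      (((continuous_circleExp (continuousOn_psiFactor (m + 1) hR)).comp
      continuous_fst).mul (continuous_circleExp_integrand (continuousOn_psiFactor n hr))))
  have hpc := continuous_pairing hr hR h.separated m n
  have hmain : EqOn (fun u => κ * ∮ w in C(0, R), (u - w) / (1 - u - w) *
        (w ^ (1 - ((m + 1 : ℕ) : ℤ)) * exp (t * (w - 1)) / ((w - α) * (w - 1))) *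
        (u ^ (1 - ((n + 1 : ℕ) : ℤ)) * exp (t * (u - 1)) / ((u - α) * (u - 1))))
      (fun u => κ * exp (-t) * (∮ w in C(0, R), (u - w) / (1 - u - w) * Fm w * Fn u) +
        exp (-t) * ∫ s in (0 : ℝ)..t, S s u) (sphere 0 r) := by
    intro u hu
    have hu' : ‖u‖ = r := by simpa using hu
    simp only
    rw [circleIntegral.integral_congr hR0.le fun w hw => hInt u w hu' (by simpa using hw),
      circleIntegral.integral_add, circleIntegral.integral_const_mul,
      circleIntegral.integral_const_mul, circleIntegral_intervalIntegral_swap (hqc u)]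
    · rw [intervalIntegral.integral_congr fun s _ => (hinner u hu' s).symm,
        intervalIntegral.integral_const_mul]
      ring
    · have hc : Continuous fun φ : ℝ => (u - circleMap 0 R φ) / (1 - u - circleMap 0 R φ) *
          Fm (circleMap 0 R φ) * Fn u :=
        (((continuous_const.sub hcm).div (continuous_const.sub hcm) fun φ =>
          add_sub_one_ne_zero_of_separated h.separated hu' (by simp [abs_of_pos hR0])).mul
            hFm).mul continuous_const
      exact (hc.intervalIntegrable _ _).const_mul _
    · have hc : Continuous fun φ : ℝ => ∫ s in (0 : ℝ)..t, q u (circleMap 0 R φ) s :=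
        intervalIntegral.continuous_parametric_intervalIntegral_of_continuous'
          (f := fun θ s => q u (circleMap 0 R θ) s)
          ((hqc u).comp (continuous_snd.prodMk continuous_fst)) 0 t
      exact (hc.intervalIntegrable _ _).const_mul _
  unfold Psi
  rw [← hκ, circleIntegral.integral_congr hr0.le hmain, circleIntegral.integral_add,
    circleIntegral.integral_const_mul, circleIntegral.integral_const_mul,
    circleIntegral_pairing_pairing_eq_zero hr hR h.separated,
    circleIntegral_intervalIntegral_swap hSc,
    intervalIntegral.integral_congr fun s _ => (houter s).symm, intervalIntegral.integral_const_mul]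
  · ring
  · have hc : Continuous fun θ : ℝ => ∮ w in C(0, R),
        (circleMap 0 r θ - w) / (1 - circleMap 0 r θ - w) * Fm w * Fn (circleMap 0 r θ) := by
      simp only [circleIntegral, smul_eq_mul]
      exact intervalIntegral.continuous_parametric_intervalIntegral_of_continuous'
        (f := fun θ φ => deriv (circleMap 0 R) φ * ((circleMap 0 r θ - circleMap 0 R φ) /
          (1 - circleMap 0 r θ - circleMap 0 R φ) * Fm (circleMap 0 R φ) * Fn (circleMap 0 r θ)))
        (((continuous_deriv_circleMap R).comp continuous_snd).mul hpc) 0 (2 * Real.pi)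
    exact (hc.intervalIntegrable _ _).const_mul _
  · have hc : Continuous fun θ : ℝ => ∫ s in (0 : ℝ)..t, S s (circleMap 0 r θ) :=
      intervalIntegral.continuous_parametric_intervalIntegral_of_continuous'
        (f := fun θ s => S s (circleMap 0 r θ))
        (hSc.comp (continuous_snd.prodMk continuous_fst)) 0 t
    exact (hc.intervalIntegrable _ _).const_mul _

/-- A radius enclosing `0`, `1` and `α`. -/
def psiRadius (α : ℝ) : ℝ := max 1 |α| + 1

theorem max_lt_psiRadius (α : ℝ) : max 1 |α| < psiRadius α := lt_add_one _

theorem two_le_psiRadius (α : ℝ) : 2 ≤ psiRadius α := by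
  have : 1 ≤ max 1 |α| := le_max_left _ _
  unfold psiRadius
  linarith

/-- `g_n(s) = (2πi)⁻¹ ∮ w^{1-n} e^{s(w-1)} / ((w - α)(w - 1)) dw`. -/
def psiMode (α : ℝ) (n : ℕ) (s : ℝ) : ℂ := circleExp (psiRadius α) (psiFactor α n) s

theorem continuous_psiMode (α : ℝ) (n : ℕ) : Continuous (psiMode α n) :=
  continuous_circleExp (continuousOn_psiFactor n (max_lt_psiRadius α))

/-- `α² e^{-t} ∫_0^t e^s (a(s) d(s) - b(s) c(s)) ds`. -/
def wronskianIntegral (α t : ℝ) (a b c d : ℝ → ℂ) : ℂ :=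
  (α : ℂ) ^ 2 * exp (-t) * ∫ s in (0 : ℝ)..t, exp s * (a s * d s - b s * c s)

/-- After decoupling, each contour can be moved to a common radius. With `g_n` for the modes,
`g_{n+1}' = g_n - g_{n+1}`, so the integrand contains the Wronskian of `g_{m+1}` and `g_{n+1}`. This
makes skew-symmetry visible, though the original contours differ. -/
theorem Psi_eq_wronskianIntegral {α r R : ℝ} (t : ℝ) (h : AdmissibleRadii α r R) (m n : ℕ) :
    Psi α t r R ((m + 1 : ℕ) : ℤ) ((n + 1 : ℕ) : ℤ) =
      wronskianIntegral α t (psiMode α m) (psiMode α (m + 1)) (psiMode α n)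
        (psiMode α (n + 1)) := by
  rw [Psi_eq_integral_of_radii t h]
  have key : ∀ (k : ℕ) (s : ℝ) {ρ : ℝ}, max 1 |α| < ρ →
      circleExp ρ (psiFactor α k) s = psiMode α k s := fun k s ρ hρ =>
    circleExp_radius (zero_le_one.trans (le_max_left _ _))
      (fun z hz => differentiableAt_psiFactor k hz) (max_lt_psiRadius α) hρ s
  simp only [key _ _ h.max_lt_left, key _ _ h.max_lt_right]
  rfl

theorem Psi_skew {α r R : ℝ} (t : ℝ) (h : AdmissibleRadii α r R) (x y : ℕ+) :
    Psi α t r R ((x : ℕ) : ℤ) ((y : ℕ) : ℤ) = -Psi α t r R ((y : ℕ) : ℤ) ((x : ℕ) : ℤ) := by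
  obtain ⟨m, hm⟩ : ∃ m : ℕ, (x : ℕ) = m + 1 := ⟨x.natPred, by simp⟩
  obtain ⟨n, hn⟩ : ∃ n : ℕ, (y : ℕ) = n + 1 := ⟨y.natPred, by simp⟩
  rw [hm, hn, Psi_eq_wronskianIntegral t h, Psi_eq_wronskianIntegral t h, wronskianIntegral,
    wronskianIntegral, ← mul_neg, ← intervalIntegral.integral_neg]
  congr 1
  refine intervalIntegral.integral_congr fun s _ => ?_
  ring

theorem norm_psiFactor_le (α : ℝ) (n : ℕ) {w : ℂ} (hw : ‖w‖ = psiRadius α) :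
    ‖psiFactor α n w‖ ≤ psiRadius α * (psiRadius α)⁻¹ ^ n := by
  have h2 := two_le_psiRadius α
  have e1 : 1 ≤ ‖w - 1‖ := by
    have := norm_sub_norm_le w 1
    rw [norm_one, hw] at this
    linarith
  have e2 : 1 ≤ ‖w - α‖ := by
    have := norm_sub_norm_le w α
    rw [hw, Complex.norm_real, Real.norm_eq_abs] at this
    have h3 : |α| ≤ max 1 |α| := le_max_right _ _
    unfold psiRadius at this
    linarith
  unfold psiFactor
  rw [norm_div, norm_mul, norm_mul, norm_pow, norm_inv, hw]
  exact div_le_self (by positivity) (one_le_mul_of_one_le_of_one_le e2 e1)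

/-- On the chosen circle both denominators have modulus at least 1 and `w⁻¹ ^ n` decays
geometrically. All decay of `Ψ` in its arguments comes from here. -/
theorem exists_norm_psiMode_le (α t : ℝ) :
    ∃ C, 0 ≤ C ∧ ∀ n, ∀ s, |s| ≤ t → ‖psiMode α n s‖ ≤ C * (psiRadius α)⁻¹ ^ n := by
  have h2 := two_le_psiRadius α
  refine ⟨psiRadius α * (psiRadius α * Real.exp (t * (psiRadius α + 1))), by positivity,
    fun n s hs => ?_⟩
  refine (norm_circleExp_le (by linarith) (fun w hw => norm_psiFactor_le α n hw) hs).trans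
    (le_of_eq ?_)
  ring

end PsiKernel

/-! ### De Bruijn's formula and nonvanishing of symmetric integrals. -/

noncomputable section DeBruijn

open MeasureTheory Equiv

variable {ι : Type*} [Fintype ι] [DecidableEq ι]

/-- Antisymmetrizing every slot of the polarized Pfaffian multiplies it by `2 ^ n`. -/
theorem pfPolar_sub_swap (A : ι → ι × Fin 2 → ι × Fin 2 → ℂ) :
    (pfPolar fun i p q => A i p q - A i q p) = 2 ^ Fintype.card ι * pfPolar A := by
  let τ : Finset ι → Perm (ι × Fin 2) := fun T =>
    Equiv.prodCongrRight fun i => if i ∈ T then 1 else swap 0 1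
  have hτ : ∀ T i a, τ T (i, a) = (i, (if i ∈ T then (1 : Perm (Fin 2)) else swap 0 1) a) :=
    fun T i a => rfl
  have hsign : ∀ T, ((Perm.sign (τ T) : ℤ) : ℂ) = (-1) ^ (Finset.univ \ T).card := by
    intro T
    rw [Perm.sign_prodCongrRight, Finset.card_eq_sum_ones, ← Finset.prod_pow_eq_pow_sum]
    simp only [pow_one, apply_ite, Perm.sign_one, Perm.sign_swap (zero_ne_one' (Fin 2))]
    rw [Finset.prod_ite, Finset.prod_const_one, one_mul]
    push_cast
    simp
    congr 1
    congr 1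
    ext i
    simp
  have hterm : ∀ σ : Perm (ι × Fin 2),
      ∏ i, (A i (σ (i, 0)) (σ (i, 1)) - A i (σ (i, 1)) (σ (i, 0))) =
        ∑ T : Finset ι, ((Perm.sign (τ T) : ℤ) : ℂ) *
          ∏ i, A i ((σ * τ T) (i, 0)) ((σ * τ T) (i, 1)) := by
    intro σ
    simp only [sub_eq_add_neg]
    rw [Finset.prod_add, Finset.powerset_univ]
    refine Finset.sum_congr rfl fun T _ => ?_
    rw [hsign, Finset.prod_neg, mul_left_comm]
    congr 1
    rw [← Finset.prod_sdiff (Finset.subset_univ T), mul_comm]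
    congr 1
    · refine Finset.prod_congr rfl fun i hi => ?_
      have hi' : i ∉ T := (Finset.mem_sdiff.mp hi).2
      simp [Perm.mul_apply, hτ, hi']
    · refine Finset.prod_congr rfl fun i hi => ?_
      simp [Perm.mul_apply, hτ, hi]
  unfold pfPolar
  simp only [hterm, Finset.mul_sum]
  rw [Finset.sum_comm]
  have hT : ∀ T : Finset ι, ∑ σ : Perm (ι × Fin 2), ((Perm.sign σ : ℤ) : ℂ) *
      (((Perm.sign (τ T) : ℤ) : ℂ) * ∏ i, A i ((σ * τ T) (i, 0)) ((σ * τ T) (i, 1))) =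
      ∑ σ : Perm (ι × Fin 2), ((Perm.sign σ : ℤ) : ℂ) * ∏ i, A i (σ (i, 0)) (σ (i, 1)) := by
    intro T
    refine Fintype.sum_equiv (Equiv.mulRight (τ T)) _ _ fun σ => ?_
    rw [Equiv.coe_mulRight, Perm.sign_mul]
    push_cast
    ring
  simp only [hT]
  rw [Finset.sum_const, Finset.card_univ, Fintype.card_finset, nsmul_eq_mul, Finset.mul_sum]
  push_cast
  rfl

/-- Each slot is the antisymmetrization of a rank-one array, and for rank-one slots the polarized
Pfaffian is the Leibniz expansion of a determinant. -/
theorem pfPolar_rank_two (M : ι × Fin 2 → ι × Fin 2 → ℂ) :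
    (pfPolar fun i p q => M p (i, 0) * M q (i, 1) - M q (i, 0) * M p (i, 1)) =
      2 ^ Fintype.card ι * (Matrix.of M).det := by
  rw [pfPolar_sub_swap fun i p q => M p (i, 0) * M q (i, 1), Matrix.det_apply']
  congr 1
  refine Finset.sum_congr rfl fun σ _ => ?_
  rw [Fintype.prod_prod_type]
  simp [Fin.prod_univ_two]

/-- **de Bruijn's formula** for the Pfaffian of a matrix of integrated `2 × 2` minors. -/
theorem pfaff_integral_minors {X : Type*} [MeasurableSpace X] (μ : Measure X) [SigmaFinite μ]
    (a : ι × Fin 2 → Fin 2 → X → ℂ)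
    (ha : ∀ p q, Integrable (fun x => a p 0 x * a q 1 x - a q 0 x * a p 1 x) μ) :
    (pfaff fun p q => ∫ x, (a p 0 x * a q 1 x - a q 0 x * a p 1 x) ∂μ) =
      (Nat.factorial (Fintype.card ι) : ℂ)⁻¹ *
        ∫ x : ι → X, (Matrix.of fun p q : ι × Fin 2 => a p q.2 (x q.1)).det
          ∂(Measure.pi fun _ => μ) := by
  have h2 : (2 : ℂ) ^ Fintype.card ι ≠ 0 := pow_ne_zero _ two_ne_zero
  have hpt : ∀ x : ι → X, (2 : ℂ) ^ Fintype.card ι *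
      (Matrix.of fun p q : ι × Fin 2 => a p q.2 (x q.1)).det =
      ∑ σ : Perm (ι × Fin 2), ((Perm.sign σ : ℤ) : ℂ) *
        ∏ i, (a (σ (i, 0)) 0 (x i) * a (σ (i, 1)) 1 (x i) -
          a (σ (i, 1)) 0 (x i) * a (σ (i, 0)) 1 (x i)) := by
    intro x
    rw [← pfPolar_rank_two fun p q : ι × Fin 2 => a p q.2 (x q.1)]
    rfl
  have hI : (2 : ℂ) ^ Fintype.card ι * ∫ x : ι → X,
      (Matrix.of fun p q : ι × Fin 2 => a p q.2 (x q.1)).det ∂(Measure.pi fun _ => μ) =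
      pfPolar fun _ p q => ∫ x, (a p 0 x * a q 1 x - a q 0 x * a p 1 x) ∂μ := by
    rw [← integral_const_mul]
    simp only [hpt]
    rw [integral_finsetSum]
    · refine Finset.sum_congr rfl fun σ _ => ?_
      rw [integral_const_mul, integral_fintype_prod_eq_prod (𝕜 := ℂ) (fun i x =>
        a (σ (i, 0)) 0 x * a (σ (i, 1)) 1 x - a (σ (i, 1)) 0 x * a (σ (i, 0)) 1 x)]
    · intro σ _
      exact (Integrable.fintype_prod fun i => ha (σ (i, 0)) (σ (i, 1))).const_mul _
  rw [pfaff_eq_pfPolar, ← hI, mul_inv]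
  field_simp

/-- A continuous symmetric function that vanishes only on the diagonals of the open orthant has
nonzero integral over every cube. -/
theorem integral_ne_zero_of_symmetric {n : ℕ} {f : (Fin n → ℝ) → ℝ} (hf : Continuous f)
    (hsymm : ∀ (π : Perm (Fin n)) s, f (s ∘ π) = f s)
    (hdiag : ∀ s, ¬ Function.Injective s → f s = 0)
    (hne : ∀ s, StrictMono s → (∀ i, 0 < s i) → f s ≠ 0) {t : ℝ} (ht : 0 < t) :
    (∫ s, f s ∂(Measure.pi fun _ => volume.restrict (Set.Ioc 0 t))) ≠ 0 := by
  -- On this chamber, convex and hence connected, `f` has no zero and so has a constant sign.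
  -- Sorting the coordinates and the vanishing on the diagonals carry the weak sign over to the
  -- whole open orthant.
  let Δ : Set (Fin n → ℝ) := {s | StrictMono s ∧ ∀ i, 0 < s i}
  have hΔ : Convex ℝ Δ := by
    intro s hs s' hs' a b ha hb hab
    have hc : 0 < a ∨ 0 < b := by
      by_contra! hc
      linarith
    refine ⟨fun i j hij => ?_, fun i => ?_⟩
    · have h1 := hs.1 hij
      have h2 := hs'.1 hij
      simp only [Pi.add_apply, Pi.smul_apply, smul_eq_mul]
      rcases hc with hc | hc <;> nlinarith
    · have h1 := hs.2 i
      have h2 := hs'.2 i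
      simp only [Pi.add_apply, Pi.smul_apply, smul_eq_mul]
      rcases hc with hc | hc <;> nlinarith
  obtain ⟨ε, hε, hpos⟩ : ∃ ε : ℝ, ε ≠ 0 ∧ ∀ s ∈ Δ, 0 < ε * f s := by
    by_cases hex : ∃ s ∈ Δ, f s < 0
    · obtain ⟨s₀, hs₀, hneg⟩ := hex
      refine ⟨-1, by norm_num, fun s hs => ?_⟩
      by_contra hcon
      have h0 : 0 ≤ f s := by linarith
      obtain ⟨z, hz, hz0⟩ := hΔ.isPreconnected.intermediate_value hs₀ hs hf.continuousOn
        ⟨hneg.le, h0⟩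
      exact hne z hz.1 hz.2 hz0
    · push Not at hex
      exact ⟨1, one_ne_zero, fun s hs => by
        rw [one_mul]
        exact lt_of_le_of_ne (hex s hs) (hne s hs.1 hs.2).symm⟩
  have hnonneg : ∀ s : Fin n → ℝ, (∀ i, 0 < s i) → 0 ≤ ε * f s := by
    intro s hs
    by_cases hinj : Function.Injective s
    · have hm : StrictMono (s ∘ Tuple.sort s) :=
        (Tuple.monotone_sort s).strictMono_of_injective (hinj.comp (Tuple.sort s).injective)
      rw [← hsymm (Tuple.sort s)]
      exact (hpos _ ⟨hm, fun i => hs _⟩).le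
    · rw [hdiag s hinj, mul_zero]
  have hμ : (Measure.pi fun _ : Fin n => (volume : Measure ℝ).restrict (Set.Ioc 0 t)) =
      volume.restrict (Set.univ.pi fun _ => Set.Ioc 0 t) := by
    rw [volume_pi, Measure.restrict_pi_pi]
  rw [hμ]
  have hms : MeasurableSet (Set.univ.pi fun _ : Fin n => Set.Ioc (0 : ℝ) t) :=
    MeasurableSet.univ_pi fun _ => measurableSet_Ioc
  have hInt : IntegrableOn (fun s => ε * f s) (Set.univ.pi fun _ : Fin n => Set.Ioc (0 : ℝ) t) := by
    refine ((hf.const_mul ε).continuousOn.integrableOn_compact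
      (isCompact_univ_pi fun _ => isCompact_Icc)).mono_set
      (Set.pi_mono fun _ _ => Set.Ioc_subset_Icc_self)
  have hp : 0 < ∫ s in Set.univ.pi fun _ : Fin n => Set.Ioc (0 : ℝ) t, ε * f s := by
    rw [setIntegral_pos_iff_support_of_nonneg_ae]
    · have hopen : IsOpen ((Function.support fun s => ε * f s) ∩
          Set.univ.pi fun _ : Fin n => Set.Ioo (0 : ℝ) t) :=
        ((hf.const_mul ε).isOpen_support).inter
          (isOpen_set_pi Set.finite_univ fun _ _ => isOpen_Ioo)
      refine (hopen.measure_pos volume ?_).trans_le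
        (measure_mono (Set.inter_subset_inter_right _
          (Set.pi_mono fun _ _ => Set.Ioo_subset_Ioc_self)))
      have hn : (0 : ℝ) < n + 1 := by positivity
      refine ⟨fun i => t * ((i : ℝ) + 1) / (n + 1), ?_, fun i _ => ⟨by positivity, ?_⟩⟩
      · refine (hpos _ ⟨fun i j hij => ?_, fun i => by positivity⟩).ne'
        have : (i : ℝ) < (j : ℝ) := by exact_mod_cast hij
        gcongr
      · rw [div_lt_iff₀ hn]
        have : (i : ℝ) < n := by exact_mod_cast i.isLt
        nlinarith
    · refine (ae_restrict_mem hms).mono fun s hs => ?_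
      exact hnonneg s fun i => (hs i trivial).1
    · exact hInt
  rw [integral_const_mul] at hp
  intro h0
  rw [h0, mul_zero] at hp
  exact lt_irrefl _ hp

end DeBruijn

/-! ### Counting zeros by Rolle's theorem. -/

noncomputable section RolleCount

open Polynomial Filter Topology

/-- If `p(0) = 0`, then `p` plus its derivative has a negative root. -/
theorem exists_neg_root_add_derivative (p : ℝ[X]) (hp : p.eval 0 = 0) :
    ∃ c < 0, (p + derivative p).eval c = 0 := by
  -- The function `τ * p (log τ)` tends to 0 at both ends of `(0, 1)`: at 0 because `τ` dominates
  -- powers of the logarithm, at 1 because `p` vanishes at 0. Rolle's theorem yields a critical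
  -- point `τ`, and `log τ` is the negative root.
  have hd : ∀ x ∈ Set.Ioo (0 : ℝ) 1, HasDerivAt (fun τ => τ * p.eval (Real.log τ))
      ((p + derivative p).eval (Real.log x)) x := by
    intro x hx
    have h1 := (p.hasDerivAt (Real.log x)).comp x (Real.hasDerivAt_log hx.1.ne')
    have h2 := (hasDerivAt_id x).mul h1
    convert! h2 using 1
    have := hx.1.ne'
    simp only [eval_add, id, Function.comp_apply, one_mul]
    field_simp
  have h0 : Tendsto (fun τ => τ * p.eval (Real.log τ)) (𝓝[>] 0) (𝓝 0) := by
    have h1 : Tendsto (fun s : ℝ => Real.exp (-s) * p.eval (-s)) atTop (𝓝 0) := by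
      have h3 := Polynomial.tendsto_div_exp_atTop (p.comp (-X))
      refine h3.congr fun s => ?_
      simp [Real.exp_neg, div_eq_inv_mul]
    have h3 : Tendsto (fun τ => -Real.log τ) (𝓝[>] 0) atTop :=
      tendsto_neg_atBot_atTop.comp Real.tendsto_log_nhdsGT_zero
    refine (h1.comp h3).congr' ?_
    filter_upwards [self_mem_nhdsWithin] with τ hτ
    have hτ' : (0 : ℝ) < τ := hτ
    simp [Real.exp_log hτ']
  have h1 : Tendsto (fun τ => τ * p.eval (Real.log τ)) (𝓝[<] 1) (𝓝 0) := by
    have hc : ContinuousAt (fun τ => τ * p.eval (Real.log τ)) 1 :=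
      continuousAt_id.mul (p.continuous.continuousAt.comp (Real.continuousAt_log one_ne_zero))
    have := hc.tendsto
    simp only [Real.log_one, hp, mul_zero] at this
    exact this.mono_left nhdsWithin_le_nhds
  obtain ⟨c, hc, hc0⟩ := exists_hasDerivAt_eq_zero' one_pos h0 h1 hd
  exact ⟨Real.log c, Real.log_neg hc.1 hc.2, hc0⟩

/-- A solution of `deriv Q = β Q + p + deriv p` with `Q(0) = p(0) = 0` has fewer than `n` double zeros on the
positive half-line if `p ≠ 0` has degree at most `2 n`. -/
theorem eq_zero_of_double_zeros {n : ℕ} {p : ℝ[X]} (hdeg : p.natDegree ≤ 2 * n)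
    (hp : p.eval 0 = 0) {β : ℝ} {Q : ℝ → ℝ}
    (hQ : ∀ s, HasDerivAt Q (β * Q s + (p + derivative p).eval s) s) (hQ0 : Q 0 = 0)
    {s : Fin n → ℝ} (hs : StrictMono s) (hpos : ∀ j, 0 < s j) (hz : ∀ j, Q (s j) = 0)
    (hz' : ∀ j, (p + derivative p).eval (s j) = 0) : p = 0 := by
  set H := p + derivative p with hH
  -- With the integrating factor, zeros of the derivative of `f` are zeros of `H`. Rolle's theorem
  -- on the nodes `0, s_1, …, s_n` gives `n` zeros of `H` interlacing with the `n` zeros `s_j`. The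
  -- negative root makes `2 n + 1` in all, one more than the degree permits.
  let f : ℝ → ℝ := fun x => Real.exp (-β * x) * Q x
  have hf : ∀ x, HasDerivAt f (Real.exp (-β * x) * H.eval x) x := by
    intro x
    have h1 : HasDerivAt (fun x => Real.exp (-β * x)) (Real.exp (-β * x) * (-β * 1)) x :=
      ((hasDerivAt_id x).const_mul (-β)).exp
    convert! h1.mul (hQ x) using 1
    ring
  have hroll : ∀ a b, a < b → Q a = 0 → Q b = 0 → ∃ c, a < c ∧ c < b ∧ H.eval c = 0 := by
    intro a b hab ha hb
    obtain ⟨c, hc, hc0⟩ := exists_hasDerivAt_eq_zero hab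
      (fun x _ => (hf x).continuousAt.continuousWithinAt) (by simp [f, ha, hb])
      (fun x _ => hf x)
    exact ⟨c, hc.1, hc.2, (mul_eq_zero.mp hc0).resolve_left (Real.exp_ne_zero _)⟩
  let z : ℕ → ℝ := fun j => if h : 0 < j ∧ j - 1 < n then s ⟨j - 1, h.2⟩ else 0
  have hzs : ∀ j : Fin n, z (j + 1) = s j := by
    intro j
    simp [z]
  have hz0 : z 0 = 0 := by simp [z]
  have hQz : ∀ j ≤ n, Q (z j) = 0 := by
    intro j hj
    rcases j with _ | j
    · rw [hz0, hQ0]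
    · rw [hzs ⟨j, hj⟩, hz]
  have hzlt : ∀ j : Fin n, z j < z (j + 1) := by
    intro j
    rcases j with ⟨_ | j, hj⟩
    · rw [hzs ⟨0, hj⟩]
      simpa [hz0] using hpos _
    · rw [hzs ⟨j + 1, hj⟩]
      simp only
      rw [hzs ⟨j, by omega⟩]
      exact hs (by simp [Fin.lt_def])
  choose ξ hξ1 hξ2 hξ0 using fun j : Fin n => hroll (z j) (z (j + 1)) (hzlt j)
    (hQz j j.isLt.le) (hQz (j + 1) j.isLt)
  have hξs : ∀ j, ξ j < s j := fun j => by rw [← hzs]; exact hξ2 j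
  have hsξ : ∀ i j : Fin n, i < j → s i < ξ j := by
    intro i j hij
    refine lt_of_le_of_lt ?_ (hξ1 j)
    rcases j with ⟨_ | j, hj⟩
    · exact absurd hij (by simp [Fin.lt_def])
    · simp only
      rw [hzs ⟨j, by omega⟩]
      refine hs.monotone ?_
      rw [Fin.lt_def] at hij
      rw [Fin.le_def]
      simp only at hij ⊢
      omega
  have hξpos : ∀ j, 0 < ξ j := by
    intro j
    rcases j with ⟨_ | j, hj⟩
    · have := hξ1 ⟨0, hj⟩
      simpa [hz0] using this
    · exact (hpos ⟨j, by omega⟩).trans (hsξ _ _ (by simp [Fin.lt_def]))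
  have hξmono : StrictMono ξ := fun i j hij => (hξs i).trans (hsξ i j hij)
  obtain ⟨c, hc, hc0⟩ := exists_neg_root_add_derivative p hp
  have hH0 : H = 0 := by
    let root : Option (Fin n ⊕ Fin n) → ℝ := fun o => o.elim c (Sum.elim s ξ)
    refine Polynomial.eq_zero_of_natDegree_lt_card_of_eval_eq_zero H (f := root) ?_ ?_ ?_
    · have hsne : ∀ i j, s i ≠ ξ j := by
        intro i j h
        rcases lt_or_ge i j with hij | hij
        · exact (hsξ i j hij).ne h
        · exact ((hξs j).trans_le (hs.monotone hij)).ne h.symm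
      rintro (_ | i | i) (_ | j | j) h
      · rfl
      · exact absurd h (hc.trans (hpos j)).ne
      · exact absurd h (hc.trans (hξpos j)).ne
      · exact absurd h (hc.trans (hpos i)).ne'
      · exact congrArg _ (congrArg _ (hs.injective h))
      · exact absurd h (hsne i j)
      · exact absurd h (hc.trans (hξpos i)).ne'
      · exact absurd h.symm (hsne j i)
      · exact congrArg _ (congrArg _ (hξmono.injective h))
    · rintro (_ | i | i)
      · exact hc0
      · exact hz' i
      · exact hξ0 i
    · have : H.natDegree ≤ 2 * n := by
        refine (natDegree_add_le _ _).trans (max_le hdeg ?_)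
        exact (natDegree_derivative_le p).trans ((Nat.sub_le _ _).trans hdeg)
      simp only [Fintype.card_option, Fintype.card_sum, Fintype.card_fin]
      omega
  by_contra hne
  have := degree_add_eq_left_of_degree_lt (degree_derivative_lt hne)
  rw [← hH, hH0, degree_zero] at this
  exact hne (degree_eq_bot.mp this.symm)

end RolleCount

/-! ### Binomially weighted modes and their differential equation. -/

noncomputable section GramModes

open Complex MeasureTheory Filter Topology Metric Set Polynomial

/-- `(w / (w - 1))^{k+1} / ((w - α)(w - 1))`, the generating function of the `psiFactor`s weighted
by the binomial coefficients `(m + k).choose k`. -/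
def gramFactor (α : ℝ) (k : ℕ) (w : ℂ) : ℂ := 1 / (1 - w⁻¹) ^ (k + 1) / ((w - α) * (w - 1))

theorem one_sub_inv_ne_zero {w : ℂ} (h : 1 < ‖w‖) : 1 - w⁻¹ ≠ 0 := by
  have hw := ne_zero_of_one_lt_norm h
  have hw1 : w - 1 ≠ 0 := sub_ne_zero_of_norm_lt (by simpa using h)
  intro h0
  apply hw1
  have : w - 1 = w * (1 - w⁻¹) := by field_simp
  rw [this, h0, mul_zero]

theorem differentiableAt_gramFactor {α : ℝ} (k : ℕ) {w : ℂ} (h : max 1 |α| < ‖w‖) :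
    DifferentiableAt ℂ (gramFactor α k) w := by
  have h1 : 1 < ‖w‖ := (le_max_left _ _).trans_lt h
  have hα : |α| < ‖w‖ := (le_max_right _ _).trans_lt h
  have hw := ne_zero_of_one_lt_norm h1
  have hw1 : w - 1 ≠ 0 := sub_ne_zero_of_norm_lt (by simpa using h1)
  have hwα : w - α ≠ 0 := sub_ne_zero_of_norm_lt (by simpa using hα)
  unfold gramFactor
  refine DifferentiableAt.div (DifferentiableAt.div (by fun_prop) ?_
    (pow_ne_zero _ (one_sub_inv_ne_zero h1))) (by fun_prop) (mul_ne_zero hwα hw1)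
  exact ((differentiableAt_const _).sub (differentiableAt_id.inv hw)).pow _

theorem continuousOn_gramFactor (α : ℝ) (k : ℕ) :
    ContinuousOn (gramFactor α k) (sphere 0 |psiRadius α|) := by
  intro w hw
  refine (differentiableAt_gramFactor k ?_).continuousAt.continuousWithinAt
  have : ‖w‖ = |psiRadius α| := by simpa using hw
  rw [this]
  exact (max_lt_psiRadius α).trans_le (le_abs_self _)

/-- `(2πi)⁻¹ ∮ (w / (w - 1))^{k+1} e^{s(w-1)} / ((w - α)(w - 1)) dw`. -/
def gramMode (α : ℝ) (k : ℕ) (s : ℝ) : ℂ := circleExp (psiRadius α) (gramFactor α k) s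

/-- `(2πi)⁻¹ ∮ w (w / (w - 1))^{k+1} e^{s(w-1)} / ((w - α)(w - 1)) dw`. -/
def gramModeShift (α : ℝ) (k : ℕ) (s : ℝ) : ℂ :=
  circleExp (psiRadius α) (fun w => w * gramFactor α k w) s

theorem continuousOn_mul_gramFactor (α : ℝ) (k : ℕ) :
    ContinuousOn (fun w => w * gramFactor α k w) (sphere 0 |psiRadius α|) :=
  continuousOn_id.mul (continuousOn_gramFactor α k)

/-- The binomial series of `(1 - w⁻¹) ^ (-(k + 1))` is summed under the contour integral, where it
converges uniformly since the radius is at least 2. The offsets `c = 0` and `c = 1` give the two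
families that occur in the Wronskian. -/
theorem hasSum_choose_mul_psiMode_add (α : ℝ) (k c : ℕ) (s : ℝ) {G : ℂ → ℂ}
    (hG : ∀ w, 1 < ‖w‖ → w * w⁻¹ ^ c * gramFactor α k w = G w) :
    HasSum (fun m : ℕ => ((m + k).choose k : ℂ) * psiMode α (m + c) s)
      (circleExp (psiRadius α) G s) := by
  have h2 := two_le_psiRadius α
  have h0 : 0 ≤ psiRadius α := by linarith
  have habs : |psiRadius α| = psiRadius α := abs_of_nonneg h0
  have hinv : (psiRadius α)⁻¹ < 1 := inv_lt_one_of_one_lt₀ (by linarith)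
  simp only [psiMode, ← circleExp_const_mul]
  refine hasSum_circleExp h0 (b := fun m => ((m + k).choose k : ℝ) * (psiRadius α)⁻¹ ^ m *
    (psiRadius α)) (fun m => ?_) ?_ (fun m w hw => ?_) (fun w hw => ?_) s
  · have := continuousOn_psiFactor (m + c) (max_lt_psiRadius α)
    rw [habs] at this
    exact continuousOn_const.mul this
  · refine Summable.mul_right _ ?_
    exact summable_choose_mul_geometric_of_norm_lt_one k (by
      rw [Real.norm_eq_abs, abs_of_nonneg (by positivity)]
      exact hinv)
  · rw [norm_mul, mul_assoc]
    simp only [Complex.norm_natCast]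
    refine mul_le_mul_of_nonneg_left ((norm_psiFactor_le α _ hw).trans ?_) (by positivity)
    rw [mul_comm, pow_add]
    refine mul_le_mul_of_nonneg_right ?_ h0
    exact mul_le_of_le_one_right (by positivity) (pow_le_one₀ (by positivity) hinv.le)
  · have hw1 : 1 < ‖w‖ := by rw [hw]; linarith
    have hr : ‖w⁻¹‖ < 1 := by
      rw [norm_inv, hw]
      exact hinv
    have := (hasSum_choose_mul_geometric_of_norm_lt_one k hr).mul_right
      (w * w⁻¹ ^ c / ((w - α) * (w - 1)))
    rw [← hG w hw1]
    convert! this using 1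
    · funext m
      simp only [psiFactor, pow_add]
      ring
    · simp only [gramFactor]
      ring

theorem hasSum_gramModeShift (α : ℝ) (k : ℕ) (s : ℝ) :
    HasSum (fun m : ℕ => ((m + k).choose k : ℂ) * psiMode α m s) (gramModeShift α k s) :=
  hasSum_choose_mul_psiMode_add α k 0 s fun w _ => by rw [pow_zero, mul_one]

theorem hasSum_gramMode (α : ℝ) (k : ℕ) (s : ℝ) :
    HasSum (fun m : ℕ => ((m + k).choose k : ℂ) * psiMode α (m + 1) s) (gramMode α k s) :=
  hasSum_choose_mul_psiMode_add α k 1 s fun w hw => by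
    rw [pow_one, mul_inv_cancel₀ (ne_zero_of_one_lt_norm hw), one_mul]

theorem hasDerivAt_gramMode (α : ℝ) (k : ℕ) (s : ℝ) :
    HasDerivAt (gramMode α k) (gramModeShift α k s - gramMode α k s) s := by
  have h := hasDerivAt_circleExp (continuousOn_gramFactor α k) s
  have e : circleExp (psiRadius α) (fun w => gramFactor α k w * (w - 1)) s =
      gramModeShift α k s - gramMode α k s := by
    have := circleExp_add (continuousOn_mul_gramFactor α k)
      ((continuousOn_gramFactor α k).const_mul (-1)) s
    rw [circleExp_const_mul] at this
    unfold gramModeShift gramMode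
    rw [sub_eq_add_neg, neg_eq_neg_one_mul, ← this]
    congr 1
    funext w
    ring
  rw [← e]
  exact h

/-- Without the exponential the integrand decays like `|w|⁻²`, and the contour can be pushed to
infinity. -/
theorem gramMode_zero (α : ℝ) (k : ℕ) : gramMode α k 0 = 0 := by
  refine circleExp_zero_eq_zero (zero_le_one.trans (le_max_left _ _))
    (fun z hz => differentiableAt_gramFactor k hz) (max_lt_psiRadius α) ?_
  have hcont : ContinuousAt (fun v : ℂ => 1 / (1 - v) ^ (k + 1) *
      (v / ((1 - α * v) * (1 - v)))) 0 :=
    ContinuousAt.mul (ContinuousAt.div (by fun_prop) (by fun_prop) (by simp))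
      (ContinuousAt.div (by fun_prop) (by fun_prop) (by simp))
  have h0 := hcont.tendsto.comp (tendsto_inv₀_cobounded (α := ℂ))
  simp only [zero_div, mul_zero] at h0
  refine h0.congr' ?_
  have hev : ∀ᶠ z in Bornology.cobounded ℂ, max 1 |α| < ‖z‖ :=
    tendsto_norm_cobounded_atTop.eventually_gt_atTop _
  filter_upwards [hev] with z hz
  have hz1 : 1 < ‖z‖ := (le_max_left _ _).trans_lt hz
  have hzα : |α| < ‖z‖ := (le_max_right _ _).trans_lt hz
  have hw := ne_zero_of_one_lt_norm hz1
  have hw1 : z - 1 ≠ 0 := sub_ne_zero_of_norm_lt (by simpa using hz1)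
  have hwα : z - α ≠ 0 := sub_ne_zero_of_norm_lt (by simpa using hzα)
  simp only [Function.comp_apply, gramFactor]
  have : (1 - α * z⁻¹) * (1 - z⁻¹) = (z - α) * (z - 1) * (z⁻¹ * z⁻¹) := by field_simp
  rw [this]
  have e : z⁻¹ / ((z - α) * (z - 1) * (z⁻¹ * z⁻¹)) = z / ((z - α) * (z - 1)) := by field_simp
  rw [e]
  ring

theorem differentiableAt_inv_sub_one_pow (j : ℕ) {w : ℂ} (h : 1 < ‖w‖) :
    DifferentiableAt ℂ (fun w : ℂ => (w - 1)⁻¹ ^ j) w := by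
  have hw1 : w - 1 ≠ 0 := sub_ne_zero_of_norm_lt (by simpa using h)
  have h0 : DifferentiableAt ℂ (fun w : ℂ => w - 1) w := by fun_prop
  exact (h0.inv hw1).pow j

/-- This is the residue at `w = 1`. Differentiation in `s` lowers the order of the pole by one, and
for order at least two the integral vanishes at `s = 0`, so induction applies. -/
theorem circleExp_inv_sub_one_pow {ρ : ℝ} (hρ : 1 < ρ) (j : ℕ) (s : ℝ) :
    circleExp ρ (fun w => (w - 1)⁻¹ ^ (j + 1)) s = ((s ^ j / (Nat.factorial j) : ℝ) : ℂ) := by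
  have hc : ∀ j, ContinuousOn (fun w : ℂ => (w - 1)⁻¹ ^ j) (sphere 0 |ρ|) := by
    intro j w hw
    refine (differentiableAt_inv_sub_one_pow j ?_).continuousAt.continuousWithinAt
    have : ‖w‖ = |ρ| := by simpa using hw
    rw [this]
    exact hρ.trans_le (le_abs_self _)
  induction j generalizing s with
  | zero =>
    have h := DiffContOnCl.two_pi_i_inv_smul_circleIntegral_sub_inv_smul (c := 0) (R := ρ)
      (w := (1 : ℂ)) (f := fun w => exp (s * (w - 1)))
      (Differentiable.diffContOnCl (by fun_prop)) (by simpa using hρ)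
    simp only [smul_eq_mul, sub_self, mul_zero, exp_zero] at h
    simpa [circleExp] using h
  | succ j ih =>
    let d : ℝ → ℂ := fun s => circleExp ρ (fun w => (w - 1)⁻¹ ^ (j + 1 + 1)) s -
      ((s ^ (j + 1) / (Nat.factorial (j + 1)) : ℝ) : ℂ)
    have hd : ∀ s, HasDerivAt d 0 s := by
      intro s
      have h1 := hasDerivAt_circleExp (hc (j + 1 + 1)) s
      have e1 : circleExp ρ (fun w => (w - 1)⁻¹ ^ (j + 1 + 1) * (w - 1)) s =
          ((s ^ j / (Nat.factorial j) : ℝ) : ℂ) := by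
        rw [← ih]
        refine circleExp_congr (by linarith) (fun w hw => ?_) s
        have hw1 : w - 1 ≠ 0 := sub_ne_zero_of_norm_lt (by rw [hw]; simpa using hρ)
        rw [pow_succ _ (j + 1), mul_assoc, inv_mul_cancel₀ hw1, mul_one]
      rw [e1] at h1
      have h2 : HasDerivAt (fun s : ℝ => s ^ (j + 1) / (Nat.factorial (j + 1) : ℝ))
          (s ^ j / (Nat.factorial j : ℝ)) s := by
        convert! (hasDerivAt_pow (j + 1) s).div_const (Nat.factorial (j + 1) : ℝ) using 1
        rw [Nat.factorial_succ]
        have : (Nat.factorial j : ℝ) ≠ 0 := by positivity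
        push_cast
        field_simp
      have h3 := h1.sub h2.ofReal_comp
      rw [sub_self] at h3
      exact h3
    have h0 : circleExp ρ (fun w => (w - 1)⁻¹ ^ (j + 1 + 1)) 0 = 0 := by
      refine circleExp_zero_eq_zero zero_le_one
        (fun z hz => differentiableAt_inv_sub_one_pow _ hz) hρ ?_
      have hcont : ContinuousAt (fun v : ℂ => v ^ (j + 1) * (1 / (1 - v) ^ (j + 1 + 1))) 0 :=
        ContinuousAt.mul (by fun_prop) (ContinuousAt.div (by fun_prop) (by fun_prop) (by simp))
      have h0 := hcont.tendsto.comp (tendsto_inv₀_cobounded (α := ℂ))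
      simp only [ne_eq, Nat.add_eq_zero_iff, one_ne_zero, and_false, not_false_eq_true, zero_pow,
        zero_mul] at h0
      refine h0.congr' ?_
      have hev : ∀ᶠ z in Bornology.cobounded ℂ, 1 < ‖z‖ :=
        tendsto_norm_cobounded_atTop.eventually_gt_atTop _
      filter_upwards [hev] with z hz1
      have hw := ne_zero_of_one_lt_norm hz1
      have hw1 : z - 1 ≠ 0 := sub_ne_zero_of_norm_lt (by simpa using hz1)
      simp only [Function.comp_apply]
      have e1 : 1 - z⁻¹ = (z - 1) * z⁻¹ := by field_simp
      rw [e1, mul_pow, inv_pow, inv_pow, inv_pow, pow_succ z (j + 1)]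
      field_simp
    have hconst := is_const_of_deriv_eq_zero (fun s => (hd s).differentiableAt)
      (fun s => (hd s).deriv) s 0
    have hd0 : d 0 = 0 := by
      simp only [d]
      rw [h0]
      simp
    rw [hd0] at hconst
    exact sub_eq_zero.mp hconst

/-- `∑_j (k choose j) s^{j+1} / (j+1)!`. -/
def gramPoly (k : ℕ) : ℝ[X] :=
  ∑ j ∈ Finset.range (k + 1), Polynomial.C ((k.choose j : ℝ) / (Nat.factorial (j + 1))) * X ^ (j + 1)

theorem gramPoly_eval_zero (k : ℕ) : (gramPoly k).eval 0 = 0 := by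
  simp [gramPoly, eval_finsetSum]

theorem natDegree_gramPoly_le (k : ℕ) : (gramPoly k).natDegree ≤ k + 1 := by
  refine natDegree_sum_le_of_forall_le _ _ fun j hj => ?_
  refine (natDegree_C_mul_X_pow_le _ _).trans ?_
  have := Finset.mem_range.mp hj
  omega

theorem coeff_gramPoly (k j : ℕ) :
    (gramPoly k).coeff (j + 1) = (k.choose j : ℝ) / (Nat.factorial (j + 1)) := by
  unfold gramPoly
  simp only [finsetSum_coeff, coeff_C_mul, coeff_X_pow, add_left_inj, mul_ite, mul_one, mul_zero]
  rw [Finset.sum_ite_eq]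
  split_ifs with h
  · rfl
  · rw [Nat.choose_eq_zero_of_lt (by simpa using h)]
    simp

theorem circleExp_sum {ι : Type*} {ρ : ℝ} (S : Finset ι) {F : ι → ℂ → ℂ}
    (hF : ∀ i, ContinuousOn (F i) (sphere 0 |ρ|)) (s : ℝ) :
    circleExp ρ (fun w => ∑ i ∈ S, F i w) s = ∑ i ∈ S, circleExp ρ (F i) s := by
  classical
  induction S using Finset.induction_on with
  | empty => simp [circleExp, circleIntegral]
  | insert a S ha ih =>
    simp only [Finset.sum_insert ha]
    rw [circleExp_add (hF a) (continuousOn_finsetSum _ fun i _ => hF i), ih]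

theorem eval_gramPoly_add_derivative (k : ℕ) (s : ℝ) :
    (gramPoly k + derivative (gramPoly k)).eval s = ∑ j ∈ Finset.range (k + 1),
      (k.choose j : ℝ) * (s ^ j / Nat.factorial j + s ^ (j + 1) / Nat.factorial (j + 1)) := by
  simp only [gramPoly, derivative_sum, eval_add, eval_finsetSum, ← Finset.sum_add_distrib]
  refine Finset.sum_congr rfl fun j _ => ?_
  simp only [derivative_C_mul_X_pow, eval_mul, eval_C, eval_pow, eval_X, Nat.add_sub_cancel]
  rw [Nat.factorial_succ]
  have : (Nat.factorial j : ℝ) ≠ 0 := by positivity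
  push_cast
  field_simp
  ring

/-- The factor `w - α` cancels the pole at `α`. With `v = 1 / (w - 1)` the integrand becomes `(1 +
v) ^ k * (v + v ^ 2)` times the exponential. The residues at `w = 1` produce the derivative of the
polynomial from `v` and the polynomial itself from `v ^ 2`. -/
theorem gramModeShift_sub (α : ℝ) (k : ℕ) (s : ℝ) :
    gramModeShift α k s - α * gramMode α k s =
      (((gramPoly k + derivative (gramPoly k)).eval s : ℝ) : ℂ) := by
  have h2 := two_le_psiRadius α
  have hρ : 1 < psiRadius α := by linarith
  have hc : ∀ j, ContinuousOn (fun w : ℂ => (w - 1)⁻¹ ^ j) (sphere 0 |psiRadius α|) := by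
    intro j w hw
    refine (differentiableAt_inv_sub_one_pow j ?_).continuousAt.continuousWithinAt
    have : ‖w‖ = |psiRadius α| := by simpa using hw
    rw [this]
    exact hρ.trans_le (le_abs_self _)
  have h1 : gramModeShift α k s - α * gramMode α k s =
      circleExp (psiRadius α) (fun w => w * gramFactor α k w + (-α : ℂ) * gramFactor α k w) s := by
    rw [circleExp_add (continuousOn_mul_gramFactor α k) ((continuousOn_gramFactor α k).const_mul _),
      circleExp_const_mul]
    unfold gramModeShift gramMode
    ring
  have h3 : circleExp (psiRadius α)
      (fun w => w * gramFactor α k w + (-α : ℂ) * gramFactor α k w) s =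
      circleExp (psiRadius α) (fun w => ∑ j ∈ Finset.range (k + 1),
        (k.choose j : ℂ) * ((w - 1)⁻¹ ^ (j + 1) + (w - 1)⁻¹ ^ (j + 1 + 1))) s := by
    refine circleExp_congr (by linarith) (fun w hw => ?_) s
    have hw' : 1 < ‖w‖ := by rw [hw]; exact hρ
    have hw0 := ne_zero_of_one_lt_norm hw'
    have hw1 : w - 1 ≠ 0 := sub_ne_zero_of_norm_lt (by simpa using hw')
    have hwα : w - α ≠ 0 := sub_ne_zero_of_norm_lt (by
      rw [hw, Complex.norm_real]
      exact (le_max_right _ _).trans_lt (max_lt_psiRadius α))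
    have e1 : 1 / (1 - w⁻¹) ^ (k + 1) = ((w - 1)⁻¹ + 1) ^ (k + 1) := by
      rw [one_div, ← inv_pow]
      congr 1
      have : 1 - w⁻¹ = (w - 1) * w⁻¹ := by field_simp
      rw [this]
      field_simp
      ring
    have e2 : w * gramFactor α k w + (-α : ℂ) * gramFactor α k w =
        ((w - 1)⁻¹ + 1) ^ k * ((w - 1)⁻¹ + (w - 1)⁻¹ ^ 2) := by
      unfold gramFactor
      rw [e1]
      generalize hv : ((w - 1)⁻¹ + 1) ^ k = v
      rw [pow_succ, hv]
      field_simp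
      ring
    rw [e2, add_pow, Finset.sum_mul]
    refine Finset.sum_congr rfl fun j _ => ?_
    rw [one_pow]
    ring
  rw [h1, h3, circleExp_sum (Finset.range (k + 1)) (F := fun j w =>
      (k.choose j : ℂ) * ((w - 1)⁻¹ ^ (j + 1) + (w - 1)⁻¹ ^ (j + 1 + 1)))
      fun j => ((hc _).add (hc _)).const_mul _,
    eval_gramPoly_add_derivative]
  push_cast
  refine Finset.sum_congr rfl fun j _ => ?_
  rw [circleExp_const_mul, circleExp_add (hc _) (hc _), circleExp_inv_sub_one_pow hρ,
    circleExp_inv_sub_one_pow hρ]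
  push_cast
  rfl

/-- The functions `gramMode α k` are real-valued and solve a linear differential equation. -/
theorem exists_real_gramMode (α : ℝ) (k : ℕ) : ∃ Q : ℝ → ℝ, Q 0 = 0 ∧
    (∀ s, HasDerivAt Q ((α - 1) * Q s + (gramPoly k + derivative (gramPoly k)).eval s) s) ∧
    ∀ s, gramMode α k s = Q s := by
  set H := gramPoly k + derivative (gramPoly k) with hH
  let β := α - 1
  let Q : ℝ → ℝ := fun s => Real.exp (β * s) * ∫ τ in (0 : ℝ)..s, Real.exp (-β * τ) * H.eval τ
  have hexp : ∀ (γ s : ℝ), HasDerivAt (fun x => Real.exp (γ * x)) (γ * Real.exp (γ * s)) s := by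
    intro γ s
    convert! ((hasDerivAt_id s).const_mul γ).exp using 1
    simp only [id]
    ring
  have hc : Continuous fun τ => Real.exp (-β * τ) * H.eval τ :=
    (Real.continuous_exp.comp (continuous_const.mul continuous_id)).mul H.continuous
  have hQ : ∀ s, HasDerivAt Q (β * Q s + H.eval s) s := by
    intro s
    convert! (hexp β s).mul (hc.integral_hasStrictDerivAt 0 s).hasDerivAt using 1
    simp only [Q]
    have : Real.exp (β * s) * Real.exp (-β * s) = 1 := by
      rw [← Real.exp_add]
      simp
    linear_combination (-(H.eval s)) * this
  have hQ0 : Q 0 = 0 := by simp [Q]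
  refine ⟨Q, hQ0, hQ, fun s => ?_⟩
  -- The mode and `Q` solve the same first-order equation with initial value 0; their difference
  -- times the integrating factor is constant.
  let d : ℝ → ℂ := fun s => (Real.exp (-β * s) : ℝ) * (gramMode α k s - Q s)
  have hd : ∀ s, HasDerivAt d 0 s := by
    intro s
    have h1 := (hasDerivAt_gramMode α k s).sub (hQ s).ofReal_comp
    convert! (hexp (-β) s).ofReal_comp.mul h1 using 1
    have h2 := gramModeShift_sub α k s
    rw [← hH] at h2
    rw [Pi.sub_apply]
    generalize Real.exp (-β * s) = E
    simp only [β]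
    push_cast
    linear_combination (-E : ℂ) * h2
  have hconst := is_const_of_deriv_eq_zero (fun s => (hd s).differentiableAt)
    (fun s => (hd s).deriv) s 0
  have hd0 : d 0 = 0 := by simp [d, gramMode_zero, hQ0]
  rw [hd0] at hconst
  rcases mul_eq_zero.mp hconst with h | h
  · exact absurd (Complex.ofReal_eq_zero.mp h) (Real.exp_ne_zero _)
  · exact sub_eq_zero.mp h

end GramModes

/-! ### Nondegeneracy of the Gram matrix. -/

noncomputable section GramMatrix

open Complex MeasureTheory Filter Topology Metric Set Polynomial

theorem HasSum.mul_prod {ι κ : Type*} {f : ι → ℂ} {g : κ → ℂ} {a b : ℂ} (hf : HasSum f a)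
    (hg : HasSum g b) : HasSum (fun p : ι × κ => f p.1 * g p.2) (a * b) :=
  hf.mul hg (summable_mul_of_summable_norm hf.summable.norm hg.summable.norm)

/-- The Gram matrix entries of `Ψ` against the binomial weights. -/
theorem hasSum_choose_mul_Psi {α t r R : ℝ} (ht : 0 ≤ t) (h : AdmissibleRadii α r R) (k l : ℕ) :
    HasSum (fun p : ℕ × ℕ => ((p.1 + k).choose k : ℂ) *
      Psi α t r R ((p.1 + 1 : ℕ) : ℤ) ((p.2 + 1 : ℕ) : ℤ) * ((p.2 + l).choose l : ℂ))
      (wronskianIntegral α t (gramModeShift α k) (gramMode α k) (gramModeShift α l)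
        (gramMode α l)) := by
  obtain ⟨C, hC, hCb⟩ := exists_norm_psiMode_le α t
  have h2 := two_le_psiRadius α
  have h0 : 0 < psiRadius α := by linarith
  have hinv : (psiRadius α)⁻¹ < 1 := inv_lt_one_of_one_lt₀ (by linarith)
  have hinv0 : 0 ≤ (psiRadius α)⁻¹ := by positivity
  have hCb' : ∀ n, ∀ s, |s| ≤ t → ‖psiMode α (n + 1) s‖ ≤ C * (psiRadius α)⁻¹ ^ n := by
    intro n s hs
    refine (hCb _ s hs).trans (mul_le_mul_of_nonneg_left ?_ hC)
    exact pow_le_pow_of_le_one hinv0 hinv.le (Nat.le_succ n)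
  let b : ℕ → ℕ → ℝ := fun k m => ((m + k).choose k : ℝ) * (psiRadius α)⁻¹ ^ m
  have hb : ∀ k, Summable (b k) := fun k =>
    summable_choose_mul_geometric_of_norm_lt_one k (by
      rw [Real.norm_eq_abs, abs_of_nonneg hinv0]
      exact hinv)
  have hb0 : ∀ k m, 0 ≤ b k m := fun k m => by positivity
  let T : ℕ × ℕ → ℝ → ℂ := fun p s => exp s *
    ((((p.1 + k).choose k : ℂ) * psiMode α p.1 s) *
      (((p.2 + l).choose l : ℂ) * psiMode α (p.2 + 1) s) -
    (((p.1 + k).choose k : ℂ) * psiMode α (p.1 + 1) s) *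
      (((p.2 + l).choose l : ℂ) * psiMode α p.2 s))
  have hterm : ∀ p : ℕ × ℕ, ((p.1 + k).choose k : ℂ) *
      Psi α t r R ((p.1 + 1 : ℕ) : ℤ) ((p.2 + 1 : ℕ) : ℤ) * ((p.2 + l).choose l : ℂ) =
      (α : ℂ) ^ 2 * exp (-t) * ∫ s in (0 : ℝ)..t, T p s := by
    intro p
    rw [Psi_eq_wronskianIntegral t h, wronskianIntegral]
    have : ∫ s in (0 : ℝ)..t, T p s = ((p.1 + k).choose k : ℂ) * ((p.2 + l).choose l : ℂ) *
        ∫ s in (0 : ℝ)..t, exp s * (psiMode α p.1 s * psiMode α (p.2 + 1) s -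
          psiMode α (p.1 + 1) s * psiMode α p.2 s) := by
      rw [← intervalIntegral.integral_const_mul]
      refine intervalIntegral.integral_congr fun s _ => ?_
      simp only [T]
      ring
    rw [this]
    ring
  simp only [hterm]
  unfold wronskianIntegral
  refine HasSum.mul_left _ ?_
  refine intervalIntegral.hasSum_integral_of_dominated_convergence
    (fun p _ => Real.exp t * (2 * C ^ 2) * (b k p.1 * b l p.2)) ?_ ?_ ?_ ?_ ?_
  · intro p
    have hm := fun n => continuous_psiMode α n
    refine Continuous.aestronglyMeasurable ?_
    exact (continuous_ofReal.cexp).mul (((continuous_const.mul (hm _)).mul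
      (continuous_const.mul (hm _))).sub ((continuous_const.mul (hm _)).mul
      (continuous_const.mul (hm _))))
  · intro p
    refine ae_of_all _ fun s hs => ?_
    rw [uIoc_of_le ht] at hs
    have hst : |s| ≤ t := by
      rw [abs_of_pos hs.1]
      exact hs.2
    have hprod : ∀ x y : ℂ, ‖x‖ ≤ C * (psiRadius α)⁻¹ ^ p.1 → ‖y‖ ≤ C * (psiRadius α)⁻¹ ^ p.2 →
        ‖(((p.1 + k).choose k : ℂ) * x) * (((p.2 + l).choose l : ℂ) * y)‖ ≤
          C ^ 2 * (b k p.1 * b l p.2) := by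
      intro x y hx hy
      rw [norm_mul, norm_mul, norm_mul, Complex.norm_natCast, Complex.norm_natCast]
      calc _ ≤ (((p.1 + k).choose k : ℝ) * (C * (psiRadius α)⁻¹ ^ p.1)) *
            (((p.2 + l).choose l : ℝ) * (C * (psiRadius α)⁻¹ ^ p.2)) := by gcongr
        _ = _ := by simp only [b]; ring
    simp only [T]
    rw [norm_mul, mul_assoc (Real.exp t)]
    refine mul_le_mul ?_ ?_ (norm_nonneg _) (Real.exp_nonneg _)
    · rw [Complex.norm_exp, Complex.ofReal_re]
      exact Real.exp_le_exp.mpr hs.2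
    · refine (norm_sub_le _ _).trans ?_
      have e1 := hprod _ _ (hCb p.1 s hst) (hCb' p.2 s hst)
      have e2 := hprod _ _ (hCb' p.1 s hst) (hCb p.2 s hst)
      linarith
  · refine ae_of_all _ fun s _ => Summable.mul_left _ ?_
    exact (hb k).mul_of_nonneg (hb l) (hb0 k) (hb0 l)
  · exact intervalIntegrable_const
  · refine ae_of_all _ fun s _ => HasSum.mul_left _ ?_
    have e1 := HasSum.mul_prod (hasSum_gramModeShift α k s) (hasSum_gramMode α l s)
    have e2 := HasSum.mul_prod (hasSum_gramMode α k s) (hasSum_gramModeShift α l s)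
    exact e1.sub e2

/-- The polynomial of index `k` has degree exactly `k + 1`, so the largest index with nonzero
coefficient cannot be cancelled. -/
theorem gramPoly_linearIndependent {N : ℕ} (c : Fin N → ℝ)
    (h : ∑ k, Polynomial.C (c k) * gramPoly k = 0) : c = 0 := by
  by_contra hc
  obtain ⟨k₁, hk₁⟩ := Function.ne_iff.mp hc
  obtain ⟨k₀, hk₀, hmax⟩ := (Finset.univ.filter fun k => c k ≠ 0).exists_max_image id
    ⟨k₁, by simpa using hk₁⟩
  have hk₀' : c k₀ ≠ 0 := by simpa using hk₀
  have hcoeff := congrArg (fun p => p.coeff (k₀ + 1)) h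
  simp only [finsetSum_coeff, coeff_C_mul, coeff_gramPoly, coeff_zero] at hcoeff
  rw [Finset.sum_eq_single k₀] at hcoeff
  · have : (Nat.factorial (k₀ + 1) : ℝ) ≠ 0 := by positivity
    rcases mul_eq_zero.mp hcoeff with h | h
    · exact hk₀' h
    · simp [this] at h
  · intro k _ hk
    by_cases hck : c k = 0
    · rw [hck, zero_mul]
    · have h1 : k ≤ k₀ := hmax k (by simpa using hck)
      have h2 : k < k₀ := lt_of_le_of_ne h1 hk
      rw [Nat.choose_eq_zero_of_lt h2]
      simp
  · simp

/-- By de Bruijn's formula, the Pfaffian is a multiple of the integral over a cube of a symmetric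
determinant with two columns per time `s_j`, one with the `Q_k(s_j)` and one proportional to
`Q_k'(s_j) + Q_k(s_j)`. A linear relation between its rows at distinct positive times is a
combination of the `Q_k` with a double zero at every `s_j`, which the zero count excludes. -/
theorem det_gram_ne_zero {N : ℕ} (hN : Even N) {α t : ℝ} (hα : 0 < α) (ht : 0 < t) :
    (Matrix.of fun k l : Fin N => wronskianIntegral α t (gramModeShift α k) (gramMode α k)
      (gramModeShift α l) (gramMode α l)).det ≠ 0 := by
  set n := N / 2 with hn
  let e : Fin n × Fin 2 ≃ Fin N := evenPairs hN
  choose Q hQ0 hQd hQ using fun k : ℕ => exists_real_gramMode α k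
  let H : ℕ → ℝ → ℝ := fun k s => (gramPoly k + derivative (gramPoly k)).eval s
  have hshift : ∀ k s, gramModeShift α k s = ((α * Q k s + H k s : ℝ) : ℂ) := by
    intro k s
    have := gramModeShift_sub α k s
    rw [hQ] at this
    push_cast
    linear_combination this
  -- The scalar weight of the time integral is put into the first column of each pair; it does not
  -- vanish because `α > 0`.
  let γ : ℝ → ℝ := fun s => α ^ 2 * Real.exp (-t) * Real.exp s
  have hγ : ∀ s, γ s ≠ 0 := fun s => by positivity
  let aR : Fin n × Fin 2 → Fin 2 → ℝ → ℝ := fun p b s =>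
    if b = 0 then γ s * (α * Q (e p) s + H (e p) s) else Q (e p) s
  have hQc : ∀ k, Continuous (Q k) := fun k =>
    continuous_iff_continuousAt.mpr fun s => (hQd k s).continuousAt
  have hHc : ∀ k, Continuous (H k) := fun k => (gramPoly k + derivative (gramPoly k)).continuous
  have hac : ∀ p b, Continuous (aR p b) := by
    intro p b
    by_cases hb : b = 0
    · simp only [aR, hb, if_true]
      exact (continuous_const.mul Real.continuous_exp).mul
        ((continuous_const.mul (hQc _)).add (hHc _))
    · simp only [aR, hb, if_false]
      exact hQc _
  let D : (Fin n → ℝ) → ℝ := fun s =>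
    (Matrix.of fun p q : Fin n × Fin 2 => aR p q.2 (s q.1)).det
  have hDc : Continuous D := by
    refine Continuous.matrix_det ?_
    refine continuous_matrix fun p q => ?_
    exact (hac p q.2).comp (continuous_apply q.1)
  have hInt : (∫ s, D s ∂(Measure.pi fun _ => volume.restrict (Set.Ioc 0 t))) ≠ 0 := by
    refine integral_ne_zero_of_symmetric hDc ?_ ?_ ?_ ht
    · intro π s
      let τ : Equiv.Perm (Fin n × Fin 2) := Equiv.prodCongrLeft fun _ : Fin 2 => π
      have hs : Equiv.Perm.sign τ = 1 := by
        rw [Equiv.Perm.sign_prodCongrLeft]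
        simp
      have := Matrix.det_permute' τ (Matrix.of fun p q : Fin n × Fin 2 => aR p q.2 (s q.1))
      rw [hs] at this
      simp only [Units.val_one, Int.cast_one, one_mul] at this
      exact this
    · intro s hs
      rw [Function.Injective] at hs
      push Not at hs
      obtain ⟨i, j, hij, hne⟩ := hs
      refine Matrix.det_zero_of_column_eq (i := (i, 0)) (j := (j, 0)) (by simpa using hne) ?_
      intro p
      simp [hij]
    · intro s hs hpos hdet
      obtain ⟨v, hv, hv0⟩ := Matrix.exists_vecMul_eq_zero_iff.mpr hdet
      have hcol : ∀ q : Fin n × Fin 2, ∑ p, v p * aR p q.2 (s q.1) = 0 := fun q => congrFun hv0 q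
      let c : Fin N → ℝ := fun k => v (e.symm k)
      have hsum : ∀ F : ℕ → ℝ, ∑ p, v p * F (e p) = ∑ k : Fin N, c k * F k := by
        intro F
        exact Fintype.sum_equiv e _ _ fun p => by simp [c]
      let P : ℝ[X] := ∑ k : Fin N, Polynomial.C (c k) * gramPoly k
      let q : ℝ → ℝ := fun x => ∑ k : Fin N, c k * Q k x
      have hP : ∀ x, (P + derivative P).eval x = ∑ k : Fin N, c k * H k x := by
        intro x
        simp only [P, H, derivative_sum, derivative_C_mul, eval_add, eval_finsetSum, eval_mul,
          eval_C, ← Finset.sum_add_distrib, mul_add]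
      have hqz : ∀ j, q (s j) = 0 := by
        intro j
        have := hcol (j, 1)
        simp only [aR, one_ne_zero, if_false] at this
        rw [hsum fun k => Q k (s j)] at this
        exact this
      have hPz : ∀ j, (P + derivative P).eval (s j) = 0 := by
        intro j
        have := hcol (j, 0)
        simp only [aR, if_true] at this
        rw [hsum fun k => γ (s j) * (α * Q k (s j) + H k (s j))] at this
        have h1 : ∑ k : Fin N, c k * (γ (s j) * (α * Q k (s j) + H k (s j))) =
            γ (s j) * (α * q (s j) + (P + derivative P).eval (s j)) := by
          rw [hP]
          simp only [q, Finset.mul_sum, ← Finset.sum_add_distrib]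
          refine Finset.sum_congr rfl fun k _ => ?_
          ring
        rw [h1, hqz, mul_zero, zero_add] at this
        exact (mul_eq_zero.mp this).resolve_left (hγ _)
      have hP0 : P = 0 := by
        refine eq_zero_of_double_zeros (n := n) (β := α - 1) (Q := q) ?_ ?_ ?_ ?_ hs hpos hqz hPz
        · refine natDegree_sum_le_of_forall_le _ _ fun k _ => ?_
          refine (natDegree_C_mul_le _ _).trans ((natDegree_gramPoly_le k).trans ?_)
          have := k.isLt
          obtain ⟨m, rfl⟩ := hN
          omega
        · simp [P, eval_finsetSum, gramPoly_eval_zero]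
        · intro x
          rw [hP]
          have h1 := HasDerivAt.fun_sum (u := Finset.univ) fun (k : Fin N) _ =>
            (hQd k x).const_mul (c k)
          convert! h1 using 1
          simp only [q, Finset.mul_sum, ← Finset.sum_add_distrib]
          refine Finset.sum_congr rfl fun k _ => ?_
          simp only [H]
          ring
        · simp [q, hQ0]
      have hc0 := gramPoly_linearIndependent c hP0
      apply hv
      funext p
      have := congrFun hc0 (e p)
      simpa [c] using this
  let a : Fin n × Fin 2 → Fin 2 → ℝ → ℂ := fun p b s => ((aR p b s : ℝ) : ℂ)
  have hdB := pfaff_integral_minors (ι := Fin n) (volume.restrict (Set.Ioc 0 t)) a (by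
    intro p q
    refine Continuous.integrableOn_Ioc ?_
    exact ((continuous_ofReal.comp (hac p 0)).mul (continuous_ofReal.comp (hac q 1))).sub
      ((continuous_ofReal.comp (hac q 0)).mul (continuous_ofReal.comp (hac p 1))))
  have hG : (fun p q : Fin n × Fin 2 =>
      ∫ x, (a p 0 x * a q 1 x - a q 0 x * a p 1 x) ∂(volume.restrict (Set.Ioc 0 t))) =
      fun p q => wronskianIntegral α t (gramModeShift α (e p)) (gramMode α (e p))
      (gramModeShift α (e q)) (gramMode α (e q)) := by
    funext p q
    rw [wronskianIntegral, intervalIntegral.integral_of_le ht.le, ← integral_const_mul]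
    refine integral_congr_ae (ae_of_all _ fun s => ?_)
    simp only [a, aR, γ, hshift, hQ, if_true, one_ne_zero, if_false]
    push_cast
    ring
  have hDet : ∀ x : Fin n → ℝ, (Matrix.of fun p q : Fin n × Fin 2 => a p q.2 (x q.1)).det =
      ((D x : ℝ) : ℂ) := by
    intro x
    have := Complex.ofRealHom.map_det (Matrix.of fun p q : Fin n × Fin 2 => aR p q.2 (x q.1))
    exact this.symm
  rw [hG] at hdB
  simp only [hDet] at hdB
  rw [integral_complex_ofReal] at hdB
  have hpf : pfaff (fun p q : Fin n × Fin 2 => wronskianIntegral α t (gramModeShift α (e p))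
      (gramMode α (e p)) (gramModeShift α (e q)) (gramMode α (e q))) ≠ 0 := by
    rw [hdB]
    refine mul_ne_zero (inv_ne_zero (by exact_mod_cast Nat.factorial_ne_zero _)) ?_
    exact_mod_cast hInt
  have hdet := det_ne_zero_of_pfPairs_ne_zero (A := Matrix.of fun p q : Fin n × Fin 2 =>
    wronskianIntegral α t (gramModeShift α (e p)) (gramMode α (e p)) (gramModeShift α (e q))
      (gramMode α (e q))) (by
    ext p q
    simp only [Matrix.transpose_apply, Matrix.of_apply, Matrix.neg_apply, wronskianIntegral]
    rw [← mul_neg, ← intervalIntegral.integral_neg]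
    congr 1
    refine intervalIntegral.integral_congr fun s _ => ?_
    ring) hpf
  rw [← Matrix.det_submatrix_equiv_self e]
  exact hdet

end GramMatrix

/-! ### The rows of `J_X + L` acting on a column vector. -/

noncomputable section InverseRows

open Filter Topology

variable {N : ℕ}

/-- The kernel `J_X + L` with a general last-row kernel `ψ`. -/
def kernelT (N : ℕ) (ψ : ℕ+ → ℕ+ → ℂ) : Kernel2 (VPhys N) := kernelJX N + kernelLOf N ψ

variable (ψ : ℕ+ → ℕ+ → ℂ)

theorem kernelT_inl_inl (i j : Fin N) (a b : Fin 2) :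
    kernelT N ψ (.inl i) (.inl j) a b = if a = 0 ∧ b = 0 then thetaMatrix N i j else 0 := by
  rw [← kernelLOf_inl_inl (ψ := ψ)]
  simp [kernelT, kernelJX]

theorem kernelT_inl_inr (i : Fin N) (q : Phys N) (a b : Fin 2) :
    kernelT N ψ (.inl i) (.inr q) a b = if i = q.1 ∧ a = 1 ∧ b = 0 then 1 else 0 := by
  rw [← kernelLOf_inl_inr (ψ := ψ)]
  simp [kernelT, kernelJX]

theorem kernelT_inr_inl (p : Phys N) (j : Fin N) (a b : Fin 2) :
    kernelT N ψ (.inr p) (.inl j) a b = if p.1 = j ∧ a = 0 ∧ b = 1 then -1 else 0 := by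
  rw [← kernelLOf_inr_inl (ψ := ψ)]
  simp [kernelT, kernelJX]

theorem kernelT_inr_inr (p q : Phys N) (a b : Fin 2) :
    kernelT N ψ (.inr p) (.inr q) a b = (if p = q then sympl a b else 0) +
      ((if p.1.val + 1 = q.1.val ∧ p.2 ≤ q.2 ∧ a = 1 ∧ b = 0 then 1 else 0) +
      (if q.1.val + 1 = p.1.val ∧ q.2 ≤ p.2 ∧ a = 0 ∧ b = 1 then -1 else 0) +
      if p.1.val + 1 = N ∧ q.1.val + 1 = N ∧ a = 1 ∧ b = 1 then ψ p.2 q.2 else 0) := by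
  rw [← kernelLOf_inr_inr]
  simp only [kernelT, kernelJX, kernelJ, Pi.add_apply, Matrix.add_apply]
  split_ifs <;> simp [sympl]

theorem kernelT_isSkew (hψ : ∀ x y, ψ x y = -ψ y x) : (kernelT N ψ).IsSkew := by
  intro z z' a b
  have h := kernelLOf_isSkew (N := N) ψ hψ z z' a b
  simp only [kernelT, Pi.add_apply, Matrix.add_apply, neg_add]
  rw [h]
  congr 1
  rcases z with i | p <;> rcases z' with j | q <;> simp only [kernelJX, Matrix.zero_apply, neg_zero]
  simp only [kernelJ, eq_comm (a := q)]
  split_ifs <;> fin_cases a <;> fin_cases b <;> simp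

/-- The terms of the entry `(z, a)` of the product of `J_X + L` with the column vector `d`. -/
def rowTerm (d : VPhys N → Fin 2 → ℂ) (z : VPhys N) (a : Fin 2) (s : VPhys N) : ℂ :=
  ∑ c, kernelT N ψ z s a c * d s c

/-- The equivalence is needed in both directions: to verify that a candidate is a solution, and to
extract the equations from a given solution. -/
theorem hasSum_of_row {β : Type*} {f : Fin N ⊕ (Fin N × β) → ℂ} {g : β → ℂ} (j : Fin N)
    (hg : ∀ y, f (.inr (j, y)) = g y) (h0 : ∀ i, f (.inl i) = 0)
    (h1 : ∀ q, q.1 ≠ j → f (.inr q) = 0) (v : ℂ) : HasSum f v ↔ HasSum g v := by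
  have hinj : Function.Injective fun y : β => (Sum.inr (j, y) : Fin N ⊕ (Fin N × β)) := by
    intro y y' h
    simpa using h
  rw [← hinj.hasSum_iff]
  · simp only [Function.comp_def, hg]
  · rintro (i | ⟨i, y⟩) hs
    · exact h0 i
    · refine h1 _ fun hij => hs ⟨y, ?_⟩
      simp only at hij
      rw [hij]

theorem hasSum_rowTerm_inl_zero (d : VPhys N → Fin 2 → ℂ) (i : Fin N) :
    HasSum (rowTerm ψ d (.inl i) 0) (∑ j, thetaMatrix N i j * d (.inl j) 0) := by
  have h : ∑ j, thetaMatrix N i j * d (.inl j) 0 =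
      ∑ s ∈ Finset.univ.map (Function.Embedding.inl (β := Phys N)), rowTerm ψ d (.inl i) 0 s := by
    rw [Finset.sum_map]
    refine Finset.sum_congr rfl fun j _ => ?_
    simp [rowTerm, kernelT_inl_inl]
  rw [h]
  refine hasSum_sum_of_ne_finset_zero fun s hs => ?_
  rcases s with j | q
  · simp at hs
  · simp [rowTerm, kernelT_inl_inr]

theorem hasSum_rowTerm_inl_one (d : VPhys N → Fin 2 → ℂ) (i : Fin N) (v : ℂ) :
    HasSum (rowTerm ψ d (.inl i) 1) v ↔ HasSum (fun x => d (.inr (i, x)) 0) v := by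
  refine hasSum_of_row i (fun y => ?_) (fun j => ?_) (fun q hq => ?_) v
  · simp [rowTerm, kernelT_inl_inr]
  · simp [rowTerm, kernelT_inl_inl]
  · simp [rowTerm, kernelT_inl_inr, hq.symm]

/-- The predecessors of a physical point: the points of the preceding row that are not larger. -/
def predecessors (p : Phys N) : Finset (Phys N) :=
  (Finset.univ.filter fun j : Fin N => j.val + 1 = p.1.val) ×ˢ Finset.Iic p.2

theorem mem_predecessors {p q : Phys N} :
    q ∈ predecessors p ↔ q.1.val + 1 = p.1.val ∧ q.2 ≤ p.2 := by
  simp [predecessors]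

/-- This row of `J_X + L` has finitely many nonzero entries: the point itself through `J`, the
virtual point of its row, and its predecessors. The sum converges for every vector. -/
theorem hasSum_rowTerm_inr_zero (d : VPhys N → Fin 2 → ℂ) (p : Phys N) :
    HasSum (rowTerm ψ d (.inr p) 0)
      (d (.inr p) 1 - d (.inl p.1) 1 - ∑ q ∈ predecessors p, d (.inr q) 1) := by
  have hp : p ∉ predecessors p := by simp [mem_predecessors]
  let S : Finset (VPhys N) := Finset.disjSum {p.1} (insert p (predecessors p))
  have h : d (.inr p) 1 - d (.inl p.1) 1 - ∑ q ∈ predecessors p, d (.inr q) 1 =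
      ∑ s ∈ S, rowTerm ψ d (.inr p) 0 s := by
    rw [Finset.sum_disjSum, Finset.sum_singleton, Finset.sum_insert hp]
    have h1 : rowTerm ψ d (.inr p) 0 (.inl p.1) = -d (.inl p.1) 1 := by
      simp [rowTerm, kernelT_inr_inl]
    have h2 : rowTerm ψ d (.inr p) 0 (.inr p) = d (.inr p) 1 := by
      simp [rowTerm, kernelT_inr_inr, sympl]
    have h3 : ∀ q ∈ predecessors p, rowTerm ψ d (.inr p) 0 (.inr q) = -d (.inr q) 1 := by
      intro q hq
      have hne : p ≠ q := fun h => hp (h ▸ hq)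
      rw [mem_predecessors] at hq
      simp [rowTerm, kernelT_inr_inr, hq, hne]
    rw [h1, h2, Finset.sum_congr rfl h3, Finset.sum_neg_distrib]
    ring
  rw [h]
  refine hasSum_sum_of_ne_finset_zero fun s hs => ?_
  rcases s with j | q
  · have : p.1 ≠ j := by
      rintro rfl
      simp [S] at hs
    simp [rowTerm, kernelT_inr_inl, this]
  · simp only [S, Finset.inr_mem_disjSum, Finset.mem_insert, not_or, mem_predecessors] at hs
    have hne : p ≠ q := fun h => hs.1 h.symm
    simp only [rowTerm, Fin.sum_univ_two, kernelT_inr_inr]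
    simp [hne, hs.2]

/-- Moving the contribution of `J` to the other side leaves a sum supported on a single row: the
next one, or the last one if `p` lies in it. -/
theorem hasSum_rowTerm_inr_one_aux (d : VPhys N → Fin 2 → ℂ) (p : Phys N) (v : ℂ) :
    HasSum (rowTerm ψ d (.inr p) 1) v ↔
      HasSum (fun s => rowTerm ψ d (.inr p) 1 s + if s = .inr p then d (.inr p) 0 else 0)
        (v + d (.inr p) 0) := by
  have h1 : HasSum (fun s : VPhys N => if s = .inr p then d (.inr p) 0 else 0) (d (.inr p) 0) :=
    hasSum_ite_eq _ _
  refine ⟨fun h => h.add h1, fun h => ?_⟩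
  have := h.sub h1
  simpa using this

theorem hasSum_rowTerm_inr_one (d : VPhys N → Fin 2 → ℂ) (p : Phys N) (j : Fin N)
    (hj : p.1.val + 1 = j.val) (v : ℂ) : HasSum (rowTerm ψ d (.inr p) 1) v ↔
      HasSum (fun y => if p.2 ≤ y then d (.inr (j, y)) 0 else 0) (v + d (.inr p) 0) := by
  rw [hasSum_rowTerm_inr_one_aux]
  have hN : p.1.val + 1 ≠ N := by have := j.isLt; omega
  refine hasSum_of_row j (fun y => ?_) (fun i => ?_) (fun q hq => ?_) _
  · have hne : (j, y) ≠ p := by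
      rintro rfl
      simp at hj
    simp only [rowTerm, Fin.sum_univ_two, kernelT_inr_inr]
    simp [hj, hne, hne.symm]
    intro h
    exact absurd h j.isLt.ne
  · simp [rowTerm, kernelT_inr_inl]
  · have hq' : p.1.val + 1 ≠ q.1.val := by
      intro h
      exact hq (Fin.ext (h.symm.trans hj))
    simp only [rowTerm, Fin.sum_univ_two, kernelT_inr_inr]
    by_cases hpq : p = q
    · subst hpq
      simp [sympl, hN]
    · simp [hpq, Ne.symm hpq, hq', hN]

theorem hasSum_rowTerm_inr_one_last (d : VPhys N → Fin 2 → ℂ) (p : Phys N)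
    (hp : p.1.val + 1 = N) (v : ℂ) : HasSum (rowTerm ψ d (.inr p) 1) v ↔
      HasSum (fun y => ψ p.2 y * d (.inr (p.1, y)) 1) (v + d (.inr p) 0) := by
  rw [hasSum_rowTerm_inr_one_aux]
  refine hasSum_of_row p.1 (fun y => ?_) (fun i => ?_) (fun q hq => ?_) _
  · simp only [rowTerm, Fin.sum_univ_two, kernelT_inr_inr]
    by_cases hpq : p = (p.1, y)
    · have h2 : p.2 = y := by
        have := congrArg Prod.snd hpq
        exact this
      subst h2
      have hp' : N ≠ p.1.val := by omega
      simp [sympl, hp, hp']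
    · have hpq' : (p.1, y) ≠ p := Ne.symm hpq
      have hp' : N ≠ p.1.val := by omega
      simp [hpq, hpq', hp, hp']
  · simp [rowTerm, kernelT_inr_inl]
  · have hq' : ¬ (q.1.val + 1 = N) := fun h => hq (Fin.ext (by omega))
    have hq2 : p.1.val + 1 ≠ q.1.val := by have := q.1.isLt; omega
    have hne : p ≠ q := by
      rintro rfl
      exact hq rfl
    simp only [rowTerm, Fin.sum_univ_two, kernelT_inr_inr]
    simp [hne, hne.symm, hq', hq2]

end InverseRows

/-! ### Counting weakly increasing paths. -/

noncomputable section PathCounts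

variable {N : ℕ}

/-- The hockey-stick identity, which prolongs paths by one step. -/
theorem sum_range_multichoose_eq (d k : ℕ) :
    ∑ j ∈ Finset.range (k + 1), Nat.multichoose d j = Nat.multichoose (d + 1) k := by
  induction k with
  | zero => simp
  | succ k ih => rw [Finset.sum_range_succ, ih, Nat.multichoose_succ_succ, add_comm]

theorem multichoose_le_choose (d k : ℕ) : Nat.multichoose d k ≤ (k + d).choose d := by
  have h1 : Nat.multichoose d k ≤ Nat.multichoose (d + 1) k := by
    rw [← sum_range_multichoose_eq]
    exact Finset.single_le_sum (f := fun j => Nat.multichoose d j) (fun _ _ => Nat.zero_le _)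
      (Finset.self_mem_range_succ k)
  refine h1.trans (le_of_eq ?_)
  rw [Nat.multichoose_eq, show d + 1 + k - 1 = k + d by omega, Nat.choose_symm_add]

theorem multichoose_succ_eq_choose (d k : ℕ) : Nat.multichoose (d + 1) k = (k + d).choose d := by
  rw [Nat.multichoose_eq, show d + 1 + k - 1 = k + d by omega, Nat.choose_symm_add]

theorem sum_Icc_pnat_sub {x y : ℕ+} (h : x ≤ y) (f : ℕ → ℕ) :
    ∑ w ∈ Finset.Icc x y, f ((w : ℕ) - x) = ∑ k ∈ Finset.range ((y : ℕ) - x + 1), f k := by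
  have h' : (x : ℕ) ≤ y := h
  refine Finset.sum_bij' (fun w _ => (w : ℕ) - x)
    (fun k _ => ⟨(x : ℕ) + k, by have := x.pos; omega⟩) ?_ ?_ ?_ ?_ ?_
  · intro w hw
    rw [Finset.mem_Icc] at hw
    have h1 : (x : ℕ) ≤ w := hw.1
    have h2 : (w : ℕ) ≤ y := hw.2
    simp only [Finset.mem_range]
    omega
  · intro k hk
    rw [Finset.mem_range] at hk
    refine Finset.mem_Icc.mpr ⟨?_, ?_⟩
    · change (x : ℕ) ≤ (x : ℕ) + k
      omega
    · change (x : ℕ) + k ≤ (y : ℕ)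
      omega
  · intro w hw
    rw [Finset.mem_Icc] at hw
    have h1 : (x : ℕ) ≤ w := hw.1
    apply PNat.coe_injective
    simp only [PNat.mk_coe]
    omega
  · intro k _
    simp
  · intro w _
    rfl

theorem sum_Icc_multichoose_sub_left {x y : ℕ+} (h : x ≤ y) (d : ℕ) :
    ∑ w ∈ Finset.Icc x y, Nat.multichoose d ((w : ℕ) - x) =
      Nat.multichoose (d + 1) ((y : ℕ) - x) := by
  rw [sum_Icc_pnat_sub h, sum_range_multichoose_eq]

theorem sum_Icc_multichoose_sub_right {x y : ℕ+} (h : x ≤ y) (d : ℕ) :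
    ∑ w ∈ Finset.Icc x y, Nat.multichoose d ((y : ℕ) - w) =
      Nat.multichoose (d + 1) ((y : ℕ) - x) := by
  have h1 := sum_Icc_pnat_sub h fun k => Nat.multichoose d ((y : ℕ) - x - k)
  have h2 := Finset.sum_range_reflect (fun k => Nat.multichoose d k) ((y : ℕ) - x + 1)
  rw [← sum_range_multichoose_eq, ← h2]
  simp only [Nat.add_sub_cancel]
  rw [← h1]
  refine Finset.sum_congr rfl fun w hw => ?_
  rw [Finset.mem_Icc] at hw
  have h3 : (x : ℕ) ≤ w := hw.1
  congr 1
  omega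

/-- The number of weakly increasing paths, advancing one row at each step, from a physical point
(or from the virtual point of a row) to a physical point. -/
def pathCount (s : VPhys N) (q : Phys N) : ℕ :=
  match s with
  | .inl i => if i ≤ q.1 then Nat.multichoose (q.1.val - i.val + 1) ((q.2 : ℕ) - 1) else 0
  | .inr p => if p.1 ≤ q.1 ∧ p.2 ≤ q.2 then
      Nat.multichoose (q.1.val - p.1.val) ((q.2 : ℕ) - p.2) else 0

/-- `pathCount` to the points of the last row. -/
def lastCount (s : VPhys N) (y : ℕ+) : ℕ :=
  match s with
  | .inl i => Nat.multichoose (N - 1 - i.val + 1) ((y : ℕ) - 1)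
  | .inr p => if p.2 ≤ y then Nat.multichoose (N - 1 - p.1.val) ((y : ℕ) - p.2) else 0

theorem pathCount_last {s : VPhys N} {q : Phys N} (hq : q.1.val + 1 = N) :
    pathCount s q = lastCount s q.2 := by
  have hq' : q.1.val = N - 1 := by omega
  rcases s with i | p
  · have : i ≤ q.1 := by rw [Fin.le_def]; have := i.isLt; omega
    simp [pathCount, lastCount, this, hq']
  · have : p.1 ≤ q.1 := by rw [Fin.le_def]; have := p.1.isLt; omega
    simp [pathCount, lastCount, this, hq']

/-- The paths of length zero. -/
def directCount (s : VPhys N) (q : Phys N) : ℕ :=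
  match s with
  | .inl i => if i = q.1 then 1 else 0
  | .inr p => if p = q then 1 else 0

theorem pathCount_inr_same_row {p q : Phys N} (h : p.1 = q.1) :
    pathCount (.inr p) q = if p = q then 1 else 0 := by
  rcases p with ⟨i, x⟩
  rcases q with ⟨j, y⟩
  simp only at h
  subst h
  simp only [pathCount, le_refl, true_and, Nat.sub_self, Prod.mk.injEq]
  split_ifs with h1 h2 h2
  · subst h2
    simp
  · have h3 : (x : ℕ) < y := lt_of_le_of_ne h1 fun h => h2 (PNat.coe_injective h)
    obtain ⟨k, hk⟩ : ∃ k, (y : ℕ) - x = k + 1 := ⟨(y : ℕ) - x - 1, by omega⟩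
    rw [hk, Nat.multichoose_zero_succ]
  · subst h2
    exact absurd le_rfl h1
  · rfl

theorem pathCount_inr_of_lt {p q : Phys N} (h : q.1 < p.1) : pathCount (.inr p) q = 0 := by
  simp [pathCount, not_le.mpr h]

theorem pathCount_inr_of_snd_lt {p q : Phys N} (h : q.2 < p.2) : pathCount (.inr p) q = 0 := by
  simp [pathCount, not_le.mpr h]

/-- Decomposition of a path by its last step. This is the recursion encoded in the rows `(p, 0)` of
`J_X + L`. -/
theorem pathCount_eq_sum_predecessors (s : VPhys N) (p : Phys N) :
    pathCount s p = directCount s p + ∑ q ∈ predecessors p, pathCount s q := by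
  rcases Nat.eq_zero_or_pos p.1.val with h0 | h0
  · have hpred : predecessors p = ∅ := by
      ext q
      simp [mem_predecessors, h0]
    rw [hpred, Finset.sum_empty, add_zero]
    rcases s with i | q
    · simp only [pathCount, directCount, h0]
      by_cases hi : i = p.1
      · subst hi
        simp [h0]
      · have : ¬ i ≤ p.1 := by
          rw [Fin.le_def, h0]
          intro h
          exact hi (Fin.ext (by omega))
        simp [hi, this]
    · by_cases hq : q.1 = p.1
      · rw [pathCount_inr_same_row hq, directCount]
      · have h1 : p.1 < q.1 := by
          rw [Fin.lt_def, h0]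
          exact Nat.pos_of_ne_zero fun h => hq (Fin.ext (by omega))
        have hne : q ≠ p := fun h => hq (by rw [h])
        simp [pathCount_inr_of_lt h1, directCount, hne]
  · let j : Fin N := ⟨p.1.val - 1, by have := p.1.isLt; omega⟩
    have hj : j.val + 1 = p.1.val := by simp only [j]; omega
    have hpred : predecessors p = ({j} : Finset (Fin N)) ×ˢ Finset.Iic p.2 := by
      ext q
      simp only [mem_predecessors, Finset.mem_product, Finset.mem_singleton, Finset.mem_Iic,
        Fin.ext_iff]
      constructor <;> rintro ⟨h1, h2⟩ <;> exact ⟨by omega, h2⟩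
    rw [hpred, Finset.sum_product, Finset.sum_singleton]
    rcases s with i | q
    · simp only [pathCount, directCount]
      by_cases hi : i ≤ j
      · have h1 : i ≤ p.1 := by rw [Fin.le_def] at hi ⊢; omega
        have h2 : i ≠ p.1 := by
          rintro rfl
          rw [Fin.le_def] at hi
          omega
        have h3 := sum_Icc_multichoose_sub_left (one_le (a := p.2)) (j.val - i.val + 1)
        have h4 : Finset.Icc 1 p.2 = Finset.Iic p.2 := by
          ext w
          simp
        rw [h4] at h3
        simp only [hi, h1, h2, if_true, if_false, zero_add]
        simp only [PNat.one_coe] at h3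
        rw [h3]
        congr 1
        rw [Fin.le_def] at hi
        omega
      · simp only [hi, if_false, Finset.sum_const_zero, add_zero]
        by_cases h2 : i = p.1
        · subst h2
          simp
        · have : ¬ i ≤ p.1 := by
            rw [Fin.le_def] at hi ⊢
            intro h
            exact h2 (Fin.ext (by omega))
          simp [h2, this]
    · by_cases hq : q.1 ≤ j
      · have h1 : q.1 ≤ p.1 := by rw [Fin.le_def] at hq ⊢; omega
        have h2 : q ≠ p := by
          rintro rfl
          rw [Fin.le_def] at hq
          omega
        simp only [pathCount, directCount, h1, h2, hq, true_and, if_false, zero_add]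
        rw [← Finset.sum_filter]
        have h4 : (Finset.Iic p.2).filter (fun w => q.2 ≤ w) = Finset.Icc q.2 p.2 := by
          ext w
          simp [and_comm]
        rw [h4]
        split_ifs with h5
        · rw [sum_Icc_multichoose_sub_left h5]
          congr 1
          rw [Fin.le_def] at hq
          omega
        · rw [Finset.Icc_eq_empty h5, Finset.sum_empty]
      · have h3 : ∀ w, pathCount (.inr q) (j, w) = 0 := fun w => by simp [pathCount, hq]
        simp only [h3, Finset.sum_const_zero, add_zero]
        by_cases h2 : q.1 = p.1
        · rw [pathCount_inr_same_row h2, directCount]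
        · have h4 : p.1 < q.1 := by
            rw [Fin.le_def] at hq
            rw [Fin.lt_def]
            have : q.1.val ≠ p.1.val := fun h => h2 (Fin.ext h)
            omega
          have hne : q ≠ p := fun h => h2 (by rw [h])
          simp [pathCount_inr_of_lt h4, directCount, hne]

/-- A path from `†_k` is classified by the point at which it enters row `k`. -/
theorem hasSum_pathCount_row (k : Fin N) (q : Phys N) :
    HasSum (fun x : ℕ+ => (pathCount (.inr (k, x)) q : ℝ)) (pathCount (.inl k) q) := by
  have h : (pathCount (.inl k) q : ℝ) =
      ∑ x ∈ Finset.Iic q.2, (pathCount (.inr (k, x)) q : ℝ) := by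
    rw [← Nat.cast_sum]
    congr 1
    simp only [pathCount]
    by_cases hk : k ≤ q.1
    · have h3 := sum_Icc_multichoose_sub_right (one_le (a := q.2)) (q.1.val - k.val)
      have h4 : Finset.Icc 1 q.2 = Finset.Iic q.2 := by
        ext w
        simp
      rw [h4, PNat.one_coe] at h3
      simp only [hk, if_true, true_and]
      rw [← h3]
      refine Finset.sum_congr rfl fun x hx => ?_
      rw [if_pos (Finset.mem_Iic.mp hx)]
    · simp [hk]
  rw [h]
  refine hasSum_sum_of_ne_finset_zero fun x hx => ?_
  rw [pathCount_inr_of_snd_lt (by simpa using hx), Nat.cast_zero]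

/-- Decomposition of a path by its first step. The subtracted delta is the path of length zero,
which has no first step. -/
theorem hasSum_pathCount_succ {p : Phys N} {j : Fin N} (hj : p.1.val + 1 = j.val) (q : Phys N) :
    HasSum (fun y : ℕ+ => ((if p.2 ≤ y then pathCount (.inr (j, y)) q else 0 : ℕ) : ℝ))
      (pathCount (.inr p) q - if p = q then 1 else 0) := by
  have h : (pathCount (.inr p) q - if p = q then 1 else 0 : ℝ) =
      ∑ y ∈ Finset.Icc p.2 q.2, ((if p.2 ≤ y then pathCount (.inr (j, y)) q else 0 : ℕ) : ℝ) := by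
    by_cases hjq : j ≤ q.1
    · have hne : p ≠ q := by
        rintro rfl
        rw [Fin.le_def] at hjq
        omega
      have hp : p.1 ≤ q.1 := by rw [Fin.le_def] at hjq ⊢; omega
      rw [if_neg hne, sub_zero, ← Nat.cast_sum]
      congr 1
      have h1 : ∀ y ∈ Finset.Icc p.2 q.2, (if p.2 ≤ y then pathCount (.inr (j, y)) q else 0) =
          Nat.multichoose (q.1.val - j.val) ((q.2 : ℕ) - y) := by
        intro y hy
        rw [Finset.mem_Icc] at hy
        simp [pathCount, hy.1, hy.2, hjq]
      rw [Finset.sum_congr rfl h1]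
      simp only [pathCount, hp, true_and]
      split_ifs with h5
      · rw [sum_Icc_multichoose_sub_right h5]
        congr 1
        rw [Fin.le_def] at hjq
        omega
      · rw [Finset.Icc_eq_empty h5, Finset.sum_empty]
    · have h1 : ∀ y, pathCount (.inr (j, y)) q = 0 := fun y => by simp [pathCount, hjq]
      simp only [h1, ite_self, Nat.cast_zero, Finset.sum_const_zero]
      by_cases hpq : p.1 = q.1
      · rw [pathCount_inr_same_row hpq]
        split_ifs <;> simp
      · have h4 : q.1 < p.1 := by
          rw [Fin.le_def] at hjq
          rw [Fin.lt_def]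
          have : p.1.val ≠ q.1.val := fun h => hpq (Fin.ext h)
          omega
        have hne : p ≠ q := fun h => hpq (by rw [h])
        simp [pathCount_inr_of_lt h4, hne]
  rw [h]
  refine hasSum_sum_of_ne_finset_zero fun y hy => ?_
  split_ifs with h1
  · have : q.2 < y := by
      rw [Finset.mem_Icc, not_and, not_le] at hy
      exact hy h1
    rw [pathCount_inr_of_snd_lt this, Nat.cast_zero]
  · exact Nat.cast_zero

/-- Path counts grow polynomially in the end point, so any exponential decay of the last-row kernel
makes their pairings converge. -/
theorem lastCount_le (s : VPhys N) (y : ℕ+) : lastCount s y ≤ ((y : ℕ) + N).choose N := by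
  have key : ∀ d k, d ≤ N → k ≤ (y : ℕ) → Nat.multichoose d k ≤ ((y : ℕ) + N).choose N := by
    intro d k hd hk
    refine (multichoose_le_choose d k).trans ?_
    have h1 : (k + d).choose d = (k + d).choose k := (Nat.choose_symm_add).symm
    rw [h1]
    refine (Nat.choose_le_choose k (by omega : k + d ≤ k + N)).trans ?_
    rw [Nat.choose_symm_add]
    exact Nat.choose_le_choose N (by omega)
  rcases s with i | p
  · have := i.isLt
    exact key _ _ (by omega) (by omega)
  · simp only [lastCount]
    split_ifs
    · exact key _ _ (by omega) (by omega)
    · exact Nat.zero_le _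

theorem summable_lastCount_mul_pow (s : VPhys N) {θ : ℝ} (h0 : 0 < θ) (h1 : θ < 1) :
    Summable fun y : ℕ+ => (lastCount s y : ℝ) * θ ^ (y : ℕ) := by
  have h2 : Summable fun n : ℕ => ((n + N).choose N : ℝ) * θ ^ n :=
    summable_choose_mul_geometric_of_norm_lt_one N (by
      rw [Real.norm_eq_abs, abs_of_pos h0]
      exact h1)
  have h3 := h2.comp_injective PNat.coe_injective
  refine Summable.of_nonneg_of_le (fun y => by positivity) (fun y => ?_) h3
  simp only [Function.comp_apply]
  have := lastCount_le s y
  gcongr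

end PathCounts

/-! ### Pairings of path counts with a decaying kernel, and the virtual block. -/

noncomputable section InverseKernel

open Filter Topology

variable {N : ℕ}

/-- Exponential decay of a kernel on the positive integers. -/
def HasDecay (ψ : ℕ+ → ℕ+ → ℂ) : Prop :=
  ∃ C θ : ℝ, 0 < θ ∧ θ < 1 ∧ ∀ x y : ℕ+, ‖ψ x y‖ ≤ C * (θ ^ (x : ℕ) * θ ^ (y : ℕ))

/-- Subexponential growth of a sequence. -/
def IsTame (f : ℕ+ → ℕ) : Prop :=
  ∀ θ : ℝ, 0 < θ → θ < 1 → Summable fun y : ℕ+ => (f y : ℝ) * θ ^ (y : ℕ)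

theorem isTame_lastCount (s : VPhys N) : IsTame (lastCount s) :=
  fun _ h0 h1 => summable_lastCount_mul_pow s h0 h1

/-- `∑_{x, y} f(x) ψ(x, y) g(y)`. -/
def pairing (ψ : ℕ+ → ℕ+ → ℂ) (f g : ℕ+ → ℕ) : ℂ :=
  ∑' p : ℕ+ × ℕ+, (f p.1 : ℂ) * ψ p.1 p.2 * (g p.2 : ℂ)

variable {ψ : ℕ+ → ℕ+ → ℂ}

theorem summable_pairing_norm (hψ : HasDecay ψ) {f g : ℕ+ → ℕ} (hf : IsTame f) (hg : IsTame g) :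
    Summable fun p : ℕ+ × ℕ+ => (f p.1 : ℝ) * ‖ψ p.1 p.2‖ * (g p.2 : ℝ) := by
  obtain ⟨C, θ, h0, h1, hb⟩ := hψ
  have hs := ((hf θ h0 h1).mul_of_nonneg (hg θ h0 h1) (fun _ => by positivity)
    (fun _ => by positivity)).mul_left C
  refine Summable.of_nonneg_of_le (fun p => by positivity) (fun p => ?_) hs
  calc (f p.1 : ℝ) * ‖ψ p.1 p.2‖ * (g p.2 : ℝ)
      ≤ (f p.1 : ℝ) * (C * (θ ^ (p.1 : ℕ) * θ ^ (p.2 : ℕ))) * (g p.2 : ℝ) := by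
        gcongr
        exact hb _ _
    _ = _ := by ring

theorem summable_pairing (hψ : HasDecay ψ) {f g : ℕ+ → ℕ} (hf : IsTame f) (hg : IsTame g) :
    Summable fun p : ℕ+ × ℕ+ => (f p.1 : ℂ) * ψ p.1 p.2 * (g p.2 : ℂ) := by
  refine Summable.of_norm ?_
  simpa using summable_pairing_norm hψ hf hg

theorem pairing_skew (hψ : ∀ x y, ψ x y = -ψ y x) (f g : ℕ+ → ℕ) :
    pairing ψ f g = -pairing ψ g f := by
  unfold pairing
  rw [← tsum_neg, ← (Equiv.prodComm ℕ+ ℕ+).tsum_eq]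
  refine tsum_congr fun p => ?_
  simp only [Equiv.prodComm_apply, Prod.fst_swap, Prod.snd_swap]
  rw [hψ]
  ring

/-- The pairing may be summed over a family of sequences. -/
theorem hasSum_pairing {ι : Type*} (hψ : HasDecay ψ) {n : ι → ℕ+ → ℕ} {W g : ℕ+ → ℕ}
    (hn : ∀ x, HasSum (fun i => (n i x : ℝ)) (W x)) (hW : IsTame W) (hg : IsTame g) :
    HasSum (fun i => pairing ψ (n i) g) (pairing ψ W g) := by
  let F : (ℕ+ × ℕ+) × ι → ℂ := fun q => (n q.2 q.1.1 : ℂ) * ψ q.1.1 q.1.2 * (g q.1.2 : ℂ)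
  have hF : Summable F := by
    refine Summable.of_norm ?_
    rw [summable_prod_of_nonneg fun _ => norm_nonneg _]
    have hi : ∀ p : ℕ+ × ℕ+, HasSum (fun i => ‖F (p, i)‖)
        ((W p.1 : ℝ) * ‖ψ p.1 p.2‖ * (g p.2 : ℝ)) := by
      intro p
      simp only [F, norm_mul, Complex.norm_natCast]
      exact ((hn p.1).mul_right _).mul_right _
    refine ⟨fun p => (hi p).summable, ?_⟩
    simp only [fun p => (hi p).tsum_eq]
    exact summable_pairing_norm hψ hW hg
  have h1 : HasSum (fun p : ℕ+ × ℕ+ => (W p.1 : ℂ) * ψ p.1 p.2 * (g p.2 : ℂ)) (∑' q, F q) := by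
    refine hF.hasSum.prod_fiberwise fun p => ?_
    have h2 : HasSum (fun i => (n i p.1 : ℂ)) (W p.1 : ℂ) := by
      have := Complex.hasSum_ofReal.mpr (hn p.1)
      simpa using this
    have h3 := (h2.mul_right (ψ p.1 p.2)).mul_right (g p.2 : ℂ)
    exact h3
  have hval : ∑' q, F q = pairing ψ W g := h1.tsum_eq.symm
  rw [← hval]
  have h3 : HasSum (fun q : ι × (ℕ+ × ℕ+) => F (q.2, q.1)) (∑' q, F q) :=
    (Equiv.prodComm ι (ℕ+ × ℕ+)).hasSum_iff.mpr hF.hasSum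
  refine h3.prod_fiberwise fun i => ?_
  exact (h3.summable.prod_factor i).hasSum

/-- The pairing of two path counting functions. -/
def pathPairing (ψ : ℕ+ → ℕ+ → ℂ) (z s : VPhys N) : ℂ := pairing ψ (lastCount z) (lastCount s)

theorem pathPairing_skew (hψ : ∀ x y, ψ x y = -ψ y x) (z s : VPhys N) :
    pathPairing ψ z s = -pathPairing ψ s z := pairing_skew hψ _ _

theorem hasSum_pathPairing_row (hψ : HasDecay ψ) (k : Fin N) (s : VPhys N) :
    HasSum (fun x => pathPairing ψ (.inr (k, x)) s) (pathPairing ψ (.inl k) s) := by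
  refine hasSum_pairing hψ (fun y => ?_) (isTame_lastCount _) (isTame_lastCount _)
  have hN : 0 < N := k.pos
  let q : Phys N := (⟨N - 1, by omega⟩, y)
  have hq : q.1.val + 1 = N := by simp only [q]; omega
  have := hasSum_pathCount_row k q
  simp only [pathCount_last hq] at this
  exact this

/-- A point that has a next row is not in the last row, so each of its paths to the last row has a
first step and no delta term appears. -/
theorem hasSum_pathPairing_succ (hψ : HasDecay ψ) {p : Phys N} {j : Fin N}
    (hj : p.1.val + 1 = j.val) (s : VPhys N) :
    HasSum (fun y => if p.2 ≤ y then pathPairing ψ (.inr (j, y)) s else 0)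
      (pathPairing ψ (.inr p) s) := by
  have hN : 0 < N := j.pos
  have h : HasSum (fun y => pairing ψ (fun x => if p.2 ≤ y then lastCount (.inr (j, y)) x else 0)
      (lastCount s)) (pathPairing ψ (.inr p) s) := by
    refine hasSum_pairing hψ (fun x => ?_) (isTame_lastCount _) (isTame_lastCount _)
    let q : Phys N := (⟨N - 1, by omega⟩, x)
    have hq : q.1.val + 1 = N := by simp only [q]; omega
    have hne : p ≠ q := by
      intro h
      rw [h] at hj
      have := j.isLt
      omega
    have := hasSum_pathCount_succ hj q
    simp only [pathCount_last hq, hne, if_false, sub_zero] at this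
    exact this
  have hfun : (fun y => pairing ψ (fun x => if p.2 ≤ y then lastCount (.inr (j, y)) x else 0)
      (lastCount s)) = fun y => if p.2 ≤ y then pathPairing ψ (.inr (j, y)) s else 0 := by
    funext y
    split_ifs
    · rfl
    · simp [pairing]
  rwa [hfun] at h

theorem lastCount_of_last {p : Phys N} (hp : p.1.val + 1 = N) (y : ℕ+) :
    lastCount (.inr p) y = if y = p.2 then 1 else 0 := by
  have h := pathCount_last (s := .inr p) (q := (p.1, y)) hp
  rw [← h, pathCount_inr_same_row (p := p) (q := (p.1, y)) rfl]
  simp [Prod.ext_iff, eq_comm]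

/-- From a point of the last row the only path to the last row is the trivial one, which collapses
the first summation. -/
theorem hasSum_pathPairing_last (hψ : HasDecay ψ) {p : Phys N} (hp : p.1.val + 1 = N)
    (s : VPhys N) :
    HasSum (fun y => ψ p.2 y * (lastCount s y : ℂ)) (pathPairing ψ (.inr p) s) := by
  have h : HasSum (fun q : ℕ+ × ℕ+ => (lastCount (.inr p) q.1 : ℂ) * ψ q.1 q.2 *
      (lastCount s q.2 : ℂ)) (pathPairing ψ (.inr p) s) :=
    (summable_pairing hψ (isTame_lastCount (.inr p)) (isTame_lastCount s)).hasSum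
  have hinj : Function.Injective fun y : ℕ+ => (p.2, y) := Prod.mk_right_injective _
  rw [← hinj.hasSum_iff] at h
  · simp only [Function.comp_def, lastCount_of_last hp, if_true, Nat.cast_one, one_mul] at h
    exact h
  · rintro ⟨x, y⟩ hxy
    have : x ≠ p.2 := fun h => hxy ⟨y, by rw [h]⟩
    simp [lastCount_of_last hp, this]

/-- A null vector satisfies `x (i - 1) = x (i + 1)` with zero boundary values before the first entry
and after the last. The first kills the entries of odd index; the second kills those of even index
because `N` is even. -/
theorem det_thetaMatrix_ne_zero (hN : Even N) : (thetaMatrix N).det ≠ 0 := by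
  intro h
  obtain ⟨v, hv, hv0⟩ := Matrix.exists_mulVec_eq_zero_iff.mpr h
  let x : ℕ → ℂ := fun i => if h : i < N then v ⟨i, h⟩ else 0
  have hx : ∀ i : Fin N, v i = x i := fun i => by simp [x]
  have hrow : ∀ i, i < N → (if i = 0 then 0 else x (i - 1)) = x (i + 1) := by
    intro i hi
    have h1 := congrFun hv0 ⟨i, hi⟩
    simp only [Matrix.mulVec, dotProduct, thetaMatrix, Matrix.of_apply, add_mul, ite_mul, zero_mul,
      Finset.sum_add_distrib, Pi.zero_apply, neg_mul, one_mul] at h1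
    have h2 : (∑ j : Fin N, if i + 1 = j.val then -v j else 0) = -x (i + 1) := by
      by_cases h : i + 1 < N
      · rw [Finset.sum_eq_single ⟨i + 1, h⟩]
        · simp [x, h]
        · intro j _ hj
          rw [if_neg]
          intro hij
          exact hj (Fin.ext hij.symm)
        · simp
      · rw [Finset.sum_eq_zero]
        · simp [x, h]
        · intro j _
          rw [if_neg]
          have := j.isLt
          omega
    have h3 : (∑ j : Fin N, if j.val + 1 = i then v j else 0) =
        if i = 0 then 0 else x (i - 1) := by
      by_cases h : i = 0
      · rw [if_pos h, Finset.sum_eq_zero]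
        intro j _
        rw [if_neg (by omega)]
      · rw [if_neg h, Finset.sum_eq_single ⟨i - 1, by omega⟩]
        · have : i - 1 < N := by omega
          have h4 : i - 1 + 1 = i := by omega
          simp [x, this, h4]
        · intro j _ hj
          rw [if_neg]
          intro hij
          exact hj (Fin.ext (by simp only; omega))
        · simp
    rw [h2, h3] at h1
    linear_combination h1
  have hodd : ∀ k, x (2 * k + 1) = 0 := by
    intro k
    induction k with
    | zero =>
      by_cases h0 : 0 < N
      · have := hrow 0 h0
        simpa using this.symm
      · simp only [x]
        rw [dif_neg (by omega)]
    | succ k ih =>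
      by_cases h0 : 2 * k + 2 < N
      · have := hrow (2 * k + 2) h0
        rw [if_neg (by omega), show 2 * k + 2 - 1 = 2 * k + 1 by omega, ih] at this
        exact this.symm
      · simp only [x]
        rw [dif_neg (by omega)]
  obtain ⟨n, hn⟩ := hN
  have heven : ∀ k, x (2 * (n - k)) = 0 := by
    intro k
    induction k with
    | zero =>
      simp only [x]
      rw [dif_neg (by omega)]
    | succ k ih =>
      by_cases hk : n ≤ k
      · rw [show n - (k + 1) = n - k by omega]
        exact ih
      · have := hrow (2 * (n - (k + 1)) + 1) (by omega)
        rw [if_neg (by omega), Nat.add_sub_cancel,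
          show 2 * (n - (k + 1)) + 1 + 1 = 2 * (n - k) by omega, ih] at this
        exact this
  apply hv
  funext i
  rw [hx, Pi.zero_apply]
  rcases Nat.even_or_odd' i.val with ⟨k, hk | hk⟩
  · have := heven (n - k)
    have hi := i.isLt
    rw [show n - (n - k) = k by omega] at this
    rw [hk, this]
  · rw [hk, hodd]

end InverseKernel

/-! ### The inverse of `J_X + L` and its uniqueness. -/

noncomputable section InverseSolution

open Filter Topology

variable {N : ℕ}

/-- The Gram matrix of `ψ` against the path counts from the virtual points. -/
def pathGram (N : ℕ) (ψ : ℕ+ → ℕ+ → ℂ) : Matrix (Fin N) (Fin N) ℂ :=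
  Matrix.of fun i l => pathPairing ψ (.inl i) (.inl l)

/-- The solutions of `(J_X + L) ρ = 0` off the rows `(†_k, 1)`, indexed by `i`. -/
def homSol (ψ : ℕ+ → ℕ+ → ℂ) (i : Fin N) (s : VPhys N) (a : Fin 2) : ℂ :=
  match s with
  | .inl j => if a = 1 ∧ i = j then 1 else 0
  | .inr p => if a = 1 then (pathCount (.inl i) p : ℂ) else pathPairing ψ (.inr p) (.inl i)

/-- The inverse of `J_X + L` up to a correction in the span of the `homSol`. -/
def parametrix (ψ : ℕ+ → ℕ+ → ℂ) (s q : VPhys N) (a b : Fin 2) : ℂ :=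
  match s, q with
  | .inl j, .inl l => if a = 0 ∧ b = 0 then (thetaMatrix N)⁻¹ j l else 0
  | .inl _, .inr _ => 0
  | .inr _, .inl _ => 0
  | .inr p, .inr q =>
      if a = 1 then (if b = 0 then (pathCount (.inr q) p : ℂ) else 0)
      else if b = 0 then pathPairing ψ (.inr p) (.inr q) else -(pathCount (.inr p) q : ℂ)

/-- The inverse of `J_X + L`. -/
def inverseT (N : ℕ) (ψ : ℕ+ → ℕ+ → ℂ) : Kernel2 (VPhys N) := fun s q =>
  Matrix.of fun a b => parametrix ψ s q a b +
    ∑ i, ∑ l, homSol ψ i s a * (pathGram N ψ)⁻¹ i l * homSol ψ l q b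

/-- A vector on the rows `(†_k, 1)`, extended by zero. -/
def virtualRow (v : Fin N → ℂ) (z : VPhys N) (a : Fin 2) : ℂ :=
  match z with
  | .inl k => if a = 1 then v k else 0
  | .inr _ => 0

variable {ψ : ℕ+ → ℕ+ → ℂ}

theorem fin_two_cases (a : Fin 2) : a = 0 ∨ a = 1 := by
  fin_cases a <;> simp

/-- The rows `(p, 0)` are the last-step recursion for path counts. The rows `(p, 1)` are the
first-step recursion for pairings, started in the last row by applying `ψ` to the path counts. Only
the rows `(†_k, 1)` leave a residue, a column of the Gram matrix. -/
theorem hasSum_rowTerm_homSol (hψ : HasDecay ψ) (i : Fin N) (z : VPhys N) (a : Fin 2) :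
    HasSum (rowTerm ψ (homSol ψ i) z a) (virtualRow (fun k => pathGram N ψ k i) z a) := by
  rcases z with k | p
  · rcases fin_two_cases a with rfl | rfl
    · have := hasSum_rowTerm_inl_zero ψ (homSol ψ i) k
      simpa [homSol, virtualRow] using this
    · rw [hasSum_rowTerm_inl_one]
      simpa [homSol, virtualRow, pathGram] using hasSum_pathPairing_row hψ k (.inl i)
  · rcases fin_two_cases a with rfl | rfl
    · have := hasSum_rowTerm_inr_zero ψ (homSol ψ i) p
      convert! this using 1
      have h1 := pathCount_eq_sum_predecessors (.inl i) p
      simp only [homSol, virtualRow, if_true, true_and]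
      rw [h1]
      simp [directCount]
    · by_cases hp : p.1.val + 1 = N
      · rw [hasSum_rowTerm_inr_one_last ψ _ p hp]
        have := hasSum_pathPairing_last hψ hp (.inl i)
        have hy : ∀ y, pathCount (.inl i) (p.1, y) = lastCount (.inl i) y :=
          fun y => pathCount_last (q := (p.1, y)) hp
        simpa [homSol, virtualRow, hy] using this
      · let j : Fin N := ⟨p.1.val + 1, by have := p.1.isLt; omega⟩
        rw [hasSum_rowTerm_inr_one ψ _ p j rfl]
        have := hasSum_pathPairing_succ hψ (p := p) (j := j) rfl (.inl i)
        simpa [homSol, virtualRow] using this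

/-- The same recursions with a source at `q`. The error is confined to the rows `(†_k, 1)`, where
the homogeneous solutions, combined through the inverse Gram matrix, can remove it. -/
theorem hasSum_rowTerm_parametrix (hN : Even N) (hψ : HasDecay ψ) (hskew : ∀ x y, ψ x y = -ψ y x)
    (q : VPhys N) (b : Fin 2) (z : VPhys N) (a : Fin 2) :
    HasSum (rowTerm ψ (fun s c => parametrix ψ s q c b) z a)
      ((if z = q ∧ a = b then 1 else 0) - virtualRow (fun k => homSol ψ k q b) z a) := by
  rcases q with l | q
  · have hphys : ∀ p c, parametrix ψ (.inr p) (.inl l) c b = 0 := fun p c => rfl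
    have hone : ∀ j, parametrix ψ (.inl j) (.inl l) 1 b = 0 := fun j => by simp [parametrix]
    rcases z with k | p
    · rcases fin_two_cases a with rfl | rfl
      · have := hasSum_rowTerm_inl_zero ψ (fun s c => parametrix ψ s (.inl l) c b) k
        convert! this using 1
        rcases fin_two_cases b with rfl | rfl
        · have h1 := congrFun (congrFun (Matrix.mul_nonsing_inv (thetaMatrix N)
            (det_thetaMatrix_ne_zero hN).isUnit) k) l
          rw [Matrix.mul_apply] at h1
          simp only [parametrix, virtualRow]
          simpa [Matrix.one_apply] using h1.symm
        · simp [parametrix, virtualRow]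
      · rw [hasSum_rowTerm_inl_one]
        simp only [hphys]
        convert! hasSum_zero using 1
        rcases fin_two_cases b with rfl | rfl
        · simp [virtualRow, homSol]
        · simp [virtualRow, homSol]
    · have hval : ((if (Sum.inr p : VPhys N) = .inl l ∧ a = b then 1 else 0) -
          virtualRow (fun k => homSol ψ k (.inl l) b) (.inr p) a : ℂ) = 0 := by
        simp [virtualRow]
      rw [hval]
      rcases fin_two_cases a with rfl | rfl
      · have := hasSum_rowTerm_inr_zero ψ (fun s c => parametrix ψ s (.inl l) c b) p
        simpa [hphys, hone] using this
      · by_cases hp : p.1.val + 1 = N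
        · rw [hasSum_rowTerm_inr_one_last ψ _ p hp]
          simp only [hphys, mul_zero, add_zero]
          exact hasSum_zero
        · let j : Fin N := ⟨p.1.val + 1, by have := p.1.isLt; omega⟩
          rw [hasSum_rowTerm_inr_one ψ _ p j rfl]
          simp only [hphys, ite_self, add_zero]
          exact hasSum_zero
  · have hvirt : ∀ j c, parametrix ψ (.inl j) (.inr q) c b = 0 := fun j c => rfl
    rcases z with k | p
    · rcases fin_two_cases a with rfl | rfl
      · have := hasSum_rowTerm_inl_zero ψ (fun s c => parametrix ψ s (.inr q) c b) k
        simpa [hvirt, virtualRow] using this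
      · rw [hasSum_rowTerm_inl_one]
        rcases fin_two_cases b with rfl | rfl
        · have := hasSum_pathPairing_row hψ k (.inr q)
          rw [pathPairing_skew hskew] at this
          simpa [parametrix, virtualRow, homSol] using this
        · have := (Complex.hasSum_ofReal.mpr (hasSum_pathCount_row k q)).neg
          simpa [parametrix, virtualRow, homSol] using this
    · have hval : ((if (Sum.inr p : VPhys N) = .inr q ∧ a = b then 1 else 0) -
          virtualRow (fun k => homSol ψ k (.inr q) b) (.inr p) a : ℂ) =
          if p = q ∧ a = b then 1 else 0 := by
        simp [virtualRow]
      rw [hval]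
      rcases fin_two_cases a with rfl | rfl
      · have := hasSum_rowTerm_inr_zero ψ (fun s c => parametrix ψ s (.inr q) c b) p
        convert! this using 1
        rcases fin_two_cases b with rfl | rfl
        · have h1 := pathCount_eq_sum_predecessors (.inr q) p
          simp only [parametrix, if_true, sub_zero]
          rw [h1]
          simp [directCount, eq_comm]
        · simp [parametrix]
      · by_cases hp : p.1.val + 1 = N
        · rw [hasSum_rowTerm_inr_one_last ψ _ p hp]
          rcases fin_two_cases b with rfl | rfl
          · have := hasSum_pathPairing_last hψ hp (.inr q)
            have hy : ∀ y, pathCount (.inr q) (p.1, y) = lastCount (.inr q) y :=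
              fun y => pathCount_last (q := (p.1, y)) hp
            simpa [parametrix, hy] using this
          · have h1 : pathCount (.inr p) q = if p = q then 1 else 0 := by
              by_cases hpq : p.1 = q.1
              · exact pathCount_inr_same_row hpq
              · have hlt : q.1 < p.1 := by
                  rw [Fin.lt_def]
                  have h2 := q.1.isLt
                  have h3 : p.1.val ≠ q.1.val := fun h => hpq (Fin.ext h)
                  omega
                have hne : p ≠ q := fun h => hpq (by rw [h])
                rw [pathCount_inr_of_lt hlt, if_neg hne]
            simp [parametrix, h1]
        · let j : Fin N := ⟨p.1.val + 1, by have := p.1.isLt; omega⟩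
          rw [hasSum_rowTerm_inr_one ψ _ p j rfl]
          rcases fin_two_cases b with rfl | rfl
          · have := hasSum_pathPairing_succ hψ (p := p) (j := j) rfl (.inr q)
            simpa [parametrix] using this
          · have := (Complex.hasSum_ofReal.mpr
              (hasSum_pathCount_succ (p := p) (j := j) rfl q)).neg
            convert! this using 1
            · funext y
              by_cases hy : p.2 ≤ y <;> simp [parametrix, hy]
            · by_cases hpq : p = q <;> simp [parametrix, hpq]
              ring

theorem rowTerm_add (d d' : VPhys N → Fin 2 → ℂ) (z : VPhys N) (a : Fin 2) :
    rowTerm ψ (fun s c => d s c + d' s c) z a =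
      fun s => rowTerm ψ d z a s + rowTerm ψ d' z a s := by
  funext s
  simp [rowTerm, mul_add, Finset.sum_add_distrib]

theorem rowTerm_sum_mul (d : Fin N → VPhys N → Fin 2 → ℂ) (κ : Fin N → ℂ) (z : VPhys N)
    (a : Fin 2) : rowTerm ψ (fun s c => ∑ i, d i s c * κ i) z a =
      fun s => ∑ i, rowTerm ψ (d i) z a s * κ i := by
  funext s
  simp only [rowTerm, Finset.mul_sum, Finset.sum_mul]
  rw [Finset.sum_comm]
  simp only [mul_assoc]

theorem pathGram_transpose (hskew : ∀ x y, ψ x y = -ψ y x) :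
    (pathGram N ψ).transpose = -pathGram N ψ := by
  ext i l
  exact pathPairing_skew hskew _ _

theorem thetaMatrix_transpose (N : ℕ) : (thetaMatrix N).transpose = -thetaMatrix N := by
  ext i j
  simp only [Matrix.transpose_apply, Matrix.neg_apply, thetaMatrix, Matrix.of_apply]
  split_ifs <;> simp

theorem inv_skew {n : Type*} [Fintype n] [DecidableEq n] {A : Matrix n n ℂ}
    (hA : A.transpose = -A) (i j : n) : A⁻¹ i j = -A⁻¹ j i := by
  have h := Matrix.transpose_nonsing_inv A
  rw [hA] at h
  have h2 : (-A)⁻¹ = -A⁻¹ := by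
    by_cases hd : IsUnit A.det
    · refine Matrix.inv_eq_left_inv ?_
      rw [neg_mul_neg, Matrix.nonsing_inv_mul _ hd]
    · rw [Matrix.nonsing_inv_apply_not_isUnit A hd, Matrix.nonsing_inv_apply_not_isUnit, neg_zero]
      rwa [← hA, Matrix.det_transpose]
  rw [h2] at h
  have := congrFun (congrFun h j) i
  simpa using this

/-- Both kernels being skew, transposition turns the right inverse into a left inverse. -/
theorem inverseT_isSkew (hskew : ∀ x y, ψ x y = -ψ y x) : (inverseT N ψ).IsSkew := by
  intro z z' a b
  have h1 : parametrix ψ z z' a b = -parametrix ψ z' z b a := by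
    rcases z with i | p <;> rcases z' with j | q
    · simp only [parametrix, and_comm (a := b = 0)]
      rw [inv_skew (thetaMatrix_transpose N)]
      split_ifs <;> simp
    · simp [parametrix]
    · simp [parametrix]
    · rcases fin_two_cases a with rfl | rfl <;> rcases fin_two_cases b with rfl | rfl
      · simpa [parametrix] using pathPairing_skew hskew _ _
      · simp [parametrix]
      · simp [parametrix]
      · simp [parametrix]
  have h2 : ∑ i, ∑ l, homSol ψ i z a * (pathGram N ψ)⁻¹ i l * homSol ψ l z' b =
      -∑ i, ∑ l, homSol ψ i z' b * (pathGram N ψ)⁻¹ i l * homSol ψ l z a := by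
    rw [Finset.sum_comm, ← Finset.sum_neg_distrib]
    refine Finset.sum_congr rfl fun i _ => ?_
    rw [← Finset.sum_neg_distrib]
    refine Finset.sum_congr rfl fun l _ => ?_
    rw [inv_skew (pathGram_transpose hskew) l i]
    ring
  simp only [inverseT, Matrix.of_apply]
  rw [h1, h2]
  ring

theorem hasSum_kernel_mul {Z : Type*} {T M : Kernel2 Z} {p q : Z} {V : Matrix (Fin 2) (Fin 2) ℂ}
    (h : ∀ a b, HasSum (fun s => ∑ c, T p s a c * M s q c b) (V a b)) :
    HasSum (fun s => T p s * M s q) V := by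
  refine Pi.hasSum.mpr fun a => Pi.hasSum.mpr fun b => ?_
  simpa [Matrix.mul_apply] using h a b

theorem hasSum_rowTerm_inverseT (hN : Even N) (hψ : HasDecay ψ)
    (hskew : ∀ x y, ψ x y = -ψ y x) (hG : (pathGram N ψ).det ≠ 0) (z q : VPhys N) (a b : Fin 2) :
    HasSum (rowTerm ψ (fun s c => inverseT N ψ s q c b) z a)
      (if z = q ∧ a = b then 1 else 0) := by
  let κ : Fin N → ℂ := fun i => ∑ l, (pathGram N ψ)⁻¹ i l * homSol ψ l q b
  have hM : (fun s c => inverseT N ψ s q c b) =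
      fun s c => parametrix ψ s q c b + ∑ i, homSol ψ i s c * κ i := by
    funext s c
    simp only [inverseT, Matrix.of_apply, κ, Finset.mul_sum, mul_assoc]
  rw [hM, rowTerm_add, rowTerm_sum_mul]
  have h1 := (hasSum_rowTerm_parametrix hN hψ hskew q b z a).add
    (hasSum_sum (s := Finset.univ) fun i _ => (hasSum_rowTerm_homSol hψ i z a).mul_right (κ i))
  convert! h1 using 1
  have h2 : ∑ i, virtualRow (fun k => pathGram N ψ k i) z a * κ i =
      virtualRow (fun k => homSol ψ k q b) z a := by
    rcases z with k | p
    · simp only [virtualRow]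
      split_ifs
      · have h3 : pathGram N ψ * (pathGram N ψ)⁻¹ = 1 :=
          Matrix.mul_nonsing_inv _ hG.isUnit
        have h4 : (pathGram N ψ).mulVec ((pathGram N ψ)⁻¹.mulVec fun l => homSol ψ l q b) =
            fun l => homSol ψ l q b := by
          rw [Matrix.mulVec_mulVec, h3, Matrix.one_mulVec]
        exact congrFun h4 k
      · simp
    · simp [virtualRow]
  rw [h2]
  ring

theorem isInverse_inverseT (hN : Even N) (hψ : HasDecay ψ) (hskew : ∀ x y, ψ x y = -ψ y x)
    (hG : (pathGram N ψ).det ≠ 0) : (kernelT N ψ).IsInverse (inverseT N ψ) := by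
  have key := hasSum_rowTerm_inverseT hN hψ hskew hG
  refine ⟨fun p q => hasSum_kernel_mul fun a b => ?_, fun p q => hasSum_kernel_mul fun a b => ?_⟩
  · have h := key p q a b
    convert! h using 1
    by_cases hpq : p = q <;> simp [hpq, Matrix.one_apply]
  · have h := key q p b a
    convert! h using 1
    · funext s
      simp only [rowTerm]
      refine Finset.sum_congr rfl fun c _ => ?_
      rw [inverseT_isSkew hskew p s, kernelT_isSkew ψ hskew s q]
      ring
    · by_cases hpq : p = q <;> simp [hpq, Matrix.one_apply, eq_comm]

/-- The rows determine `d` in turn. The rows `(†, 0)` and invertibility of `Θ` kill the first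
virtual components. The rows `(p, 0)`, going up, express the second physical components through path
counts with coefficients `c`. The rows `(p, 1)`, going down from the last row, express the first
physical components through pairings. The rows `(†, 1)` then say that the Gram matrix annihilates
`c`. -/
theorem eq_zero_of_hasSum_rowTerm (hN : Even N) (hψ : HasDecay ψ) (hG : (pathGram N ψ).det ≠ 0)
    {d : VPhys N → Fin 2 → ℂ} (hd : ∀ z a, HasSum (rowTerm ψ d z a) 0) : d = 0 := by
  let c : Fin N → ℂ := fun i => d (.inl i) 1
  have hD0 : (fun j => d (.inl j) 0) = 0 := by
    refine Matrix.eq_zero_of_mulVec_eq_zero (det_thetaMatrix_ne_zero hN) ?_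
    funext i
    exact (hasSum_rowTerm_inl_zero ψ d i).unique (hd (.inl i) 0)
  have hb : ∀ n, ∀ p : Phys N, p.1.val = n → d (.inr p) 1 = ∑ i, c i * pathCount (.inl i) p := by
    intro n
    induction n with
    | zero => ?_
    | succ n ih => ?_
    all_goals
      intro p hp
      have h1 := (hasSum_rowTerm_inr_zero ψ d p).unique (hd (.inr p) 0)
      have h2 : ∑ q ∈ predecessors p, d (.inr q) 1 =
          ∑ q ∈ predecessors p, ∑ i, c i * pathCount (.inl i) q := by
        refine Finset.sum_congr rfl fun q hq => ?_
        rw [mem_predecessors] at hq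
        first
        | exact ih q (by omega)
        | exact absurd hq.1 (by omega)
      have h3 : ∑ i, c i * (pathCount (.inl i) p : ℂ) =
          c p.1 + ∑ q ∈ predecessors p, ∑ i, c i * pathCount (.inl i) q := by
        rw [Finset.sum_comm]
        simp only [← Finset.mul_sum]
        have h4 : ∀ i, c i * (pathCount (.inl i) p : ℂ) = (if i = p.1 then c i else 0) +
            c i * ∑ q ∈ predecessors p, (pathCount (.inl i) q : ℂ) := by
          intro i
          rw [pathCount_eq_sum_predecessors]
          push_cast
          simp only [directCount]
          split_ifs <;> push_cast <;> ring
        rw [Finset.sum_congr rfl fun i _ => h4 i, Finset.sum_add_distrib]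
        simp
      rw [h3, ← h2]
      simp only [c]
      linear_combination h1
  have hb' : ∀ p : Phys N, d (.inr p) 1 = ∑ i, c i * pathCount (.inl i) p := fun p => hb _ p rfl
  have ha : ∀ n, ∀ p : Phys N, p.1.val + 1 + n = N →
      d (.inr p) 0 = ∑ i, c i * pathPairing ψ (.inr p) (.inl i) := by
    intro n
    induction n with
    | zero =>
      intro p hp
      have h1 := (hasSum_rowTerm_inr_one_last ψ d p hp 0).mp (hd (.inr p) 1)
      rw [zero_add] at h1
      refine h1.unique ?_
      have h2 := hasSum_sum (s := Finset.univ) fun i _ =>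
        (hasSum_pathPairing_last hψ hp (.inl i)).mul_left (c i)
      convert! h2 using 1
      funext y
      rw [hb', Finset.mul_sum]
      refine Finset.sum_congr rfl fun i _ => ?_
      rw [pathCount_last (q := (p.1, y)) hp]
      ring
    | succ n ih =>
      intro p hp
      let j : Fin N := ⟨p.1.val + 1, by omega⟩
      have h1 := (hasSum_rowTerm_inr_one ψ d p j rfl 0).mp (hd (.inr p) 1)
      rw [zero_add] at h1
      refine h1.unique ?_
      have h2 := hasSum_sum (s := Finset.univ) fun i _ =>
        (hasSum_pathPairing_succ hψ (p := p) (j := j) rfl (.inl i)).mul_left (c i)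
      convert! h2 using 1
      funext y
      rw [ih (j, y) (by simp only [j]; omega)]
      split_ifs <;> simp
  have ha' : ∀ p : Phys N, d (.inr p) 0 = ∑ i, c i * pathPairing ψ (.inr p) (.inl i) := fun p =>
    ha (N - (p.1.val + 1)) p (by have := p.1.isLt; omega)
  have hc : c = 0 := by
    refine Matrix.eq_zero_of_mulVec_eq_zero hG ?_
    funext k
    have h1 := (hasSum_rowTerm_inl_one ψ d k 0).mp (hd (.inl k) 1)
    simp only [ha'] at h1
    have h2 := hasSum_sum (s := Finset.univ) fun i _ =>
      (hasSum_pathPairing_row hψ k (.inl i)).mul_left (c i)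
    have h3 := h2.unique h1
    rw [Pi.zero_apply, ← h3]
    simp only [Matrix.mulVec, dotProduct, pathGram, Matrix.of_apply]
    exact Finset.sum_congr rfl fun i _ => mul_comm _ _
  funext z a
  rcases z with i | p
  · rcases fin_two_cases a with rfl | rfl
    · exact congrFun hD0 i
    · exact congrFun hc i
  · rcases fin_two_cases a with rfl | rfl
    · rw [ha', hc]
      simp
    · rw [hb', hc]
      simp

/-- Each column of the difference of two right inverses is annihilated by every row. Associativity,
which may fail for infinite matrices, is not involved. -/
theorem inverseT_unique (hN : Even N) (hψ : HasDecay ψ) (hskew : ∀ x y, ψ x y = -ψ y x)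
    (hG : (pathGram N ψ).det ≠ 0) {M : Kernel2 (VPhys N)} (hM : (kernelT N ψ).IsInverse M) :
    M = inverseT N ψ := by
  funext s q
  ext c b
  have h : (fun s c => M s q c b - inverseT N ψ s q c b) = 0 := by
    refine eq_zero_of_hasSum_rowTerm hN hψ hG fun z a => ?_
    have h1 := Pi.hasSum.mp (Pi.hasSum.mp (hM.1 z q) a) b
    have h2 := Pi.hasSum.mp (Pi.hasSum.mp ((isInverse_inverseT hN hψ hskew hG).1 z q) a) b
    have h3 := h1.sub h2
    rw [sub_self] at h3
    convert! h3 using 1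
    funext s
    simp [rowTerm, Matrix.mul_apply, mul_sub]
  have := congrFun (congrFun h s) c
  exact sub_eq_zero.mp this

end InverseSolution

/-! ### Decay and nondegeneracy for `Ψ`. -/

noncomputable section PsiOnIntegers

open Filter Topology Complex

/-- `Ψ` on the positive integers. -/
def psiKernel (α t r R : ℝ) (x y : ℕ+) : ℂ := Psi α t r R ((x : ℕ) : ℤ) ((y : ℕ) : ℤ)

variable {α t r R : ℝ}

theorem psiKernel_skew (h : AdmissibleRadii α r R) (x y : ℕ+) :
    psiKernel α t r R x y = -psiKernel α t r R y x := Psi_skew t h x y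

theorem psiKernel_succPNat (m n : ℕ) :
    psiKernel α t r R m.succPNat n.succPNat = Psi α t r R ((m + 1 : ℕ) : ℤ) ((n + 1 : ℕ) : ℤ) := by
  simp [psiKernel]

theorem psiKernel_hasDecay (ht : 0 ≤ t) (h : AdmissibleRadii α r R) :
    HasDecay (psiKernel α t r R) := by
  obtain ⟨C, hC, hCb⟩ := exists_norm_psiMode_le α t
  have h2 := two_le_psiRadius α
  have h0 : 0 < psiRadius α := by linarith
  set θ := (psiRadius α)⁻¹ with hθ
  have hθ0 : 0 < θ := inv_pos.mpr h0
  have hθ1 : θ < 1 := inv_lt_one_of_one_lt₀ (by linarith)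
  -- The modes give decay in `m = x - 1` and `n = y - 1`; the factor `psiRadius α ^ 2` compensates
  -- for this shift.
  refine ⟨α ^ 2 * Real.exp (-t) * (Real.exp t * (2 * C ^ 2) * t) * (psiRadius α) ^ 2, θ, hθ0, hθ1,
    fun x y => ?_⟩
  obtain ⟨m, rfl⟩ : ∃ m : ℕ, m.succPNat = x := ⟨x.natPred, by simp⟩
  obtain ⟨n, rfl⟩ : ∃ n : ℕ, n.succPNat = y := ⟨y.natPred, by simp⟩
  rw [psiKernel_succPNat, Psi_eq_wronskianIntegral t h, wronskianIntegral, norm_mul, norm_mul]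
  have hCb' : ∀ n, ∀ s, |s| ≤ t → ‖psiMode α (n + 1) s‖ ≤ C * θ ^ n := by
    intro n s hs
    refine (hCb _ s hs).trans (mul_le_mul_of_nonneg_left ?_ hC)
    exact pow_le_pow_of_le_one hθ0.le hθ1.le (Nat.le_succ n)
  have hI : ‖∫ s in (0 : ℝ)..t, exp s * (psiMode α m s * psiMode α (n + 1) s -
      psiMode α (m + 1) s * psiMode α n s)‖ ≤
      Real.exp t * (2 * C ^ 2 * (θ ^ m * θ ^ n)) * |t - 0| := by
    refine intervalIntegral.norm_integral_le_of_norm_le_const fun s hs => ?_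
    rw [Set.uIoc_of_le ht] at hs
    have hst : |s| ≤ t := by
      rw [abs_of_pos hs.1]
      exact hs.2
    rw [norm_mul]
    refine mul_le_mul ?_ ?_ (norm_nonneg _) (Real.exp_nonneg _)
    · rw [Complex.norm_exp, Complex.ofReal_re]
      exact Real.exp_le_exp.mpr hs.2
    · refine (norm_sub_le _ _).trans ?_
      rw [norm_mul, norm_mul]
      have e1 := mul_le_mul (hCb m s hst) (hCb' n s hst) (norm_nonneg _) (by positivity)
      have e2 := mul_le_mul (hCb' m s hst) (hCb n s hst) (norm_nonneg _) (by positivity)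
      nlinarith [e1, e2]
  have hα : ‖(α : ℂ) ^ 2‖ = α ^ 2 := by
    rw [norm_pow, Complex.norm_real, Real.norm_eq_abs, sq_abs]
  have he : ‖exp (-(t : ℂ))‖ = Real.exp (-t) := by
    rw [Complex.norm_exp]
    simp
  rw [hα, he]
  refine (mul_le_mul_of_nonneg_left hI (by positivity)).trans (le_of_eq ?_)
  rw [sub_zero, abs_of_nonneg ht]
  have hρ : psiRadius α * θ = 1 := mul_inv_cancel₀ h0.ne'
  simp only [Nat.succPNat_coe, Nat.succ_eq_add_one, pow_succ]
  linear_combination (-(α ^ 2 * Real.exp (-t) * (Real.exp t * (2 * C ^ 2) * t) * θ ^ m * θ ^ n) *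
    (1 + psiRadius α * θ)) * hρ

/-- The number of paths from a virtual point to height `m + 1` in the last row is the binomial
weight of the modes, with `k` the number of rows still to be climbed. Hence the order of the indices
is reversed. -/
theorem pathPairing_psiKernel {N : ℕ} (ht : 0 ≤ t) (h : AdmissibleRadii α r R) (i l : Fin N) :
    pathPairing (psiKernel α t r R) (.inl i) (.inl l) =
      wronskianIntegral α t (gramModeShift α (Fin.rev i)) (gramMode α (Fin.rev i))
        (gramModeShift α (Fin.rev l)) (gramMode α (Fin.rev l)) := by
  rw [← (hasSum_choose_mul_Psi ht h _ _).tsum_eq, pathPairing, pairing]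
  let e : ℕ × ℕ ≃ ℕ+ × ℕ+ := Equiv.prodCongr Equiv.pnatEquivNat.symm Equiv.pnatEquivNat.symm
  rw [← e.tsum_eq]
  refine tsum_congr fun p => ?_
  have hcount : ∀ (i : Fin N) (m : ℕ),
      lastCount (.inl i : VPhys N) m.succPNat = (m + (Fin.rev i).val).choose (Fin.rev i).val := by
    intro i m
    simp only [lastCount, Nat.succPNat_coe, Nat.succ_eq_add_one, Nat.add_sub_cancel]
    rw [multichoose_succ_eq_choose, Fin.val_rev, show N - (i.val + 1) = N - 1 - i.val by omega]
  have he : e p = (p.1.succPNat, p.2.succPNat) := rfl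
  rw [he, hcount, hcount, psiKernel_succPNat]

theorem det_pathGram_psiKernel_ne_zero {N : ℕ} (hN : Even N) (hα : 0 < α) (ht : 0 < t)
    (h : AdmissibleRadii α r R) : (pathGram N (psiKernel α t r R)).det ≠ 0 := by
  have h1 := det_gram_ne_zero hN hα ht
  rw [← Matrix.det_submatrix_equiv_self Fin.revPerm] at h1
  convert! h1 using 2
  ext i l
  simp only [pathGram, Matrix.of_apply, Matrix.submatrix_apply, Fin.revPerm_apply]
  exact pathPairing_psiKernel ht.le h i l

end PsiOnIntegers

/-! ### Cutting off the last-row kernel and restricting to finite boxes. -/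

noncomputable section Truncation

open Filter Topology

variable {N : ℕ}

/-- The kernel `ψ` cut off at height `n`. -/
def truncKernel (ψ : ℕ+ → ℕ+ → ℂ) (n : ℕ+) (x y : ℕ+) : ℂ :=
  if x ≤ n ∧ y ≤ n then ψ x y else 0

/-- The physical points of height at most `n`. -/
def physBox (N : ℕ) (n : ℕ+) : Finset (Phys N) := Finset.univ ×ˢ Finset.Iic n

/-- The virtual points together with the physical points of height at most `n`. -/
def fullBox (N : ℕ) (n : ℕ+) : Finset (VPhys N) := Finset.disjSum Finset.univ (physBox N n)

theorem mem_physBox {n : ℕ+} {p : Phys N} : p ∈ physBox N n ↔ p.2 ≤ n := by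
  simp [physBox]

theorem inl_mem_fullBox {n : ℕ+} (i : Fin N) : Sum.inl i ∈ fullBox N n := by
  simp [fullBox]

theorem inr_mem_fullBox {n : ℕ+} {p : Phys N} : Sum.inr p ∈ fullBox N n ↔ p.2 ≤ n := by
  simp [fullBox, mem_physBox]

variable {ψ : ℕ+ → ℕ+ → ℂ}

theorem norm_truncKernel_le (n x y : ℕ+) : ‖truncKernel ψ n x y‖ ≤ ‖ψ x y‖ := by
  unfold truncKernel
  split_ifs
  · exact le_rfl
  · simp

theorem HasDecay.truncKernel (hψ : HasDecay ψ) (n : ℕ+) : HasDecay (truncKernel ψ n) := by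
  obtain ⟨C, θ, h0, h1, hb⟩ := hψ
  exact ⟨C, θ, h0, h1, fun x y => (norm_truncKernel_le n x y).trans (hb x y)⟩

theorem truncKernel_skew (hskew : ∀ x y, ψ x y = -ψ y x) (n x y : ℕ+) :
    truncKernel ψ n x y = -truncKernel ψ n y x := by
  simp only [truncKernel, and_comm (a := y ≤ n)]
  split_ifs
  · exact hskew x y
  · simp

/-- Paths never descend, so those starting above the cut-off miss the support of the truncated
kernel. -/
theorem pathPairing_truncKernel_eq_zero {n : ℕ+} {p : Phys N} (hp : n < p.2) (s : VPhys N) :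
    pathPairing (truncKernel ψ n) (.inr p) s = 0 := by
  unfold pathPairing pairing
  refine (tsum_congr fun q => ?_).trans tsum_zero
  by_cases hq : p.2 ≤ q.1
  · simp [truncKernel, not_le.mpr (hp.trans_le hq)]
  · simp [lastCount, hq]

theorem inverseT_truncKernel_eq_zero {n : ℕ+} {p : Phys N} (hp : n < p.2) {q : VPhys N}
    (hq : q ∈ fullBox N n) (b : Fin 2) : inverseT N (truncKernel ψ n) (.inr p) q 0 b = 0 := by
  have h1 : ∀ i, homSol (truncKernel ψ n) i (.inr p) 0 = 0 := by
    intro i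
    simp [homSol, pathPairing_truncKernel_eq_zero hp]
  have h2 : parametrix (truncKernel ψ n) (.inr p) q 0 b = 0 := by
    rcases q with l | q
    · rfl
    · rw [inr_mem_fullBox] at hq
      simp [parametrix, pathPairing_truncKernel_eq_zero hp,
        pathCount_inr_of_snd_lt (hq.trans_lt hp)]
  simp [inverseT, h1, h2]

theorem kernelT_truncKernel_eq_zero {n : ℕ+} {p : Phys N} (hp : n < p.2) {z : VPhys N}
    (hz : z ∈ fullBox N n) (a : Fin 2) : kernelT N (truncKernel ψ n) z (.inr p) a 1 = 0 := by
  rcases z with k | z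
  · simp [kernelT_inl_inr]
  · rw [inr_mem_fullBox] at hz
    have h1 : z ≠ p := by
      rintro rfl
      exact absurd hz (not_le.mpr hp)
    have h2 : ¬ p.2 ≤ z.2 := not_le.mpr (hz.trans_lt hp)
    have h3 : truncKernel ψ n z.2 p.2 = 0 := by
      simp [truncKernel, not_le.mpr hp]
    simp [kernelT_inr_inr, h1, h2, h3]

theorem kernelT_truncKernel {n : ℕ+} {z s : VPhys N} (hz : z ∈ fullBox N n)
    (hs : s ∈ fullBox N n) (a b : Fin 2) :
    kernelT N (truncKernel ψ n) z s a b = kernelT N ψ z s a b := by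
  rcases z with k | z <;> rcases s with l | s
  · simp [kernelT_inl_inl]
  · simp [kernelT_inl_inr]
  · simp [kernelT_inr_inl]
  · rw [inr_mem_fullBox] at hz hs
    have : truncKernel ψ n z.2 s.2 = ψ z.2 s.2 := by simp [truncKernel, hz, hs]
    simp [kernelT_inr_inr, this]

/-- The matrix of a kernel on a finite set of points. -/
def kernelMatrix (K : Kernel2 (VPhys N)) (S : Finset (VPhys N)) :
    Matrix (S × Fin 2) (S × Fin 2) ℂ :=
  Matrix.of fun p q => K p.1 q.1 p.2 q.2

theorem kernelMatrix_transpose {K : Kernel2 (VPhys N)} (hK : K.IsSkew) (S : Finset (VPhys N)) :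
    (kernelMatrix K S).transpose = -kernelMatrix K S := by
  ext p q
  exact hK _ _ _ _

/-- For both ends in the box, an intermediate point above the box contributes nothing: through its
second component the first factor vanishes, through its first component the second one does. Thus
the infinite inverse for the truncated kernel restricts to the inverse of the finite matrix. -/
theorem kernelMatrix_mul_inverse (hN : Even N) (hψ : HasDecay ψ) (hskew : ∀ x y, ψ x y = -ψ y x)
    {n : ℕ+} (hG : (pathGram N (truncKernel ψ n)).det ≠ 0) :
    kernelMatrix (kernelT N ψ) (fullBox N n) *
      kernelMatrix (inverseT N (truncKernel ψ n)) (fullBox N n) = 1 := by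
  ext ⟨⟨z, hz⟩, a⟩ ⟨⟨q, hq⟩, b⟩
  have h1 := hasSum_rowTerm_inverseT hN (hψ.truncKernel n) (truncKernel_skew hskew n) hG z q a b
  have h2 : HasSum (rowTerm (truncKernel ψ n)
      (fun s c => inverseT N (truncKernel ψ n) s q c b) z a)
      (∑ s ∈ fullBox N n, rowTerm (truncKernel ψ n)
        (fun s c => inverseT N (truncKernel ψ n) s q c b) z a s) := by
    refine hasSum_sum_of_ne_finset_zero fun s hs => ?_
    rcases s with l | p
    · exact absurd (inl_mem_fullBox l) hs
    · rw [inr_mem_fullBox, not_le] at hs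
      simp [rowTerm, inverseT_truncKernel_eq_zero hs hq, kernelT_truncKernel_eq_zero hs hz]
  have h3 := h2.unique h1
  rw [Matrix.mul_apply, Fintype.sum_prod_type]
  rw [← Finset.sum_coe_sort] at h3
  simp only [rowTerm] at h3
  have h4 : (∑ s : fullBox N n, ∑ c, kernelMatrix (kernelT N ψ) (fullBox N n) (⟨z, hz⟩, a) (s, c) *
      kernelMatrix (inverseT N (truncKernel ψ n)) (fullBox N n) (s, c) (⟨q, hq⟩, b)) =
      ∑ s : fullBox N n, ∑ c, kernelT N (truncKernel ψ n) z s a c *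
        inverseT N (truncKernel ψ n) s q c b := by
    refine Finset.sum_congr rfl fun s _ => Finset.sum_congr rfl fun c _ => ?_
    rw [kernelT_truncKernel hz s.2]
    rfl
  rw [h4, h3, Matrix.one_apply]
  simp

end Truncation

/-! ### Removing the cut-off. -/

noncomputable section TruncationLimits

open Filter Topology

variable {N : ℕ} {ψ : ℕ+ → ℕ+ → ℂ}

theorem tendsto_truncKernel (ψ : ℕ+ → ℕ+ → ℂ) (x y : ℕ+) :
    Tendsto (fun n => truncKernel ψ n x y) atTop (𝓝 (ψ x y)) := by
  refine tendsto_const_nhds.congr' ?_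
  filter_upwards [eventually_ge_atTop (max x y)] with n hn
  simp [truncKernel, (le_max_left x y).trans hn, (le_max_right x y).trans hn]

theorem tendsto_pathPairing (hψ : HasDecay ψ) (z s : VPhys N) :
    Tendsto (fun n => pathPairing (truncKernel ψ n) z s) atTop (𝓝 (pathPairing ψ z s)) := by
  unfold pathPairing pairing
  refine tendsto_tsum_of_dominated_convergence
    (summable_pairing_norm hψ (isTame_lastCount z) (isTame_lastCount s)) (fun p => ?_)
    (Eventually.of_forall fun n p => ?_)
  · exact ((tendsto_truncKernel ψ p.1 p.2).const_mul _).mul_const _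
  · rw [norm_mul, norm_mul, Complex.norm_natCast, Complex.norm_natCast]
    gcongr
    exact norm_truncKernel_le n _ _

theorem tendsto_pathGram (hψ : HasDecay ψ) :
    Tendsto (fun n => pathGram N (truncKernel ψ n)) atTop (𝓝 (pathGram N ψ)) := by
  refine tendsto_pi_nhds.mpr fun i => tendsto_pi_nhds.mpr fun l => ?_
  exact tendsto_pathPairing hψ _ _

theorem tendsto_matrix_inv {n ι : Type*} [Fintype n] [DecidableEq n] {l : Filter ι}
    {A : ι → Matrix n n ℂ} {B : Matrix n n ℂ} (h : Tendsto A l (𝓝 B)) (hB : B.det ≠ 0) :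
    Tendsto (fun i => (A i)⁻¹) l (𝓝 B⁻¹) := by
  simp only [Matrix.inv_def, Ring.inverse_eq_inv']
  have hdet : Tendsto (fun i => (A i).det) l (𝓝 B.det) :=
    ((continuous_id.matrix_det).tendsto B).comp h
  have hadj : Tendsto (fun i => (A i).adjugate) l (𝓝 B.adjugate) :=
    ((continuous_id.matrix_adjugate).tendsto B).comp h
  exact (hdet.inv₀ hB).smul hadj

theorem eventually_det_pathGram_ne_zero (hψ : HasDecay ψ) (hG : (pathGram N ψ).det ≠ 0) :
    ∀ᶠ n in atTop, (pathGram N (truncKernel ψ n)).det ≠ 0 := by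
  have hdet : Tendsto (fun n => (pathGram N (truncKernel ψ n)).det) atTop
      (𝓝 (pathGram N ψ).det) :=
    ((continuous_id.matrix_det).tendsto _).comp (tendsto_pathGram hψ)
  exact hdet.eventually_ne hG

/-- The explicit inverse depends on `ψ` only through pairings, which converge by domination, and
through the inverse Gram matrix, which is continuous where the determinant is nonzero. -/
theorem tendsto_inverseT (hψ : HasDecay ψ) (hG : (pathGram N ψ).det ≠ 0) (z q : VPhys N)
    (a b : Fin 2) :
    Tendsto (fun n => inverseT N (truncKernel ψ n) z q a b) atTop (𝓝 (inverseT N ψ z q a b)) := by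
  have hhom : ∀ i (s : VPhys N) c, Tendsto (fun n => homSol (truncKernel ψ n) i s c) atTop
      (𝓝 (homSol ψ i s c)) := by
    intro i s c
    rcases s with j | p
    · exact tendsto_const_nhds
    · simp only [homSol]
      split_ifs
      · exact tendsto_const_nhds
      · exact tendsto_pathPairing hψ _ _
  have hpar : Tendsto (fun n => parametrix (truncKernel ψ n) z q a b) atTop
      (𝓝 (parametrix ψ z q a b)) := by
    rcases z with i | p <;> rcases q with j | q
    · exact tendsto_const_nhds
    · exact tendsto_const_nhds
    · exact tendsto_const_nhds
    · simp only [parametrix]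
      split_ifs
      · exact tendsto_const_nhds
      · exact tendsto_const_nhds
      · exact tendsto_pathPairing hψ _ _
      · exact tendsto_const_nhds
  have hinv := tendsto_matrix_inv (tendsto_pathGram (N := N) hψ) hG
  simp only [inverseT, Matrix.of_apply]
  refine hpar.add (tendsto_finsetSum _ fun i _ => tendsto_finsetSum _ fun l _ => ?_)
  exact ((hhom i z a).mul (((continuous_apply l).tendsto _).comp
    (((continuous_apply i).tendsto _).comp hinv))).mul (hhom l q b)

end TruncationLimits

/-! ### Correlation identity in a finite box. -/

noncomputable section FiniteIdentity

variable {N : ℕ} (ψ : ℕ+ → ℕ+ → ℂ)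

/-- `Pf [L restricted to V ∪ A]` for a general last-row kernel. -/
def pfLOf (N : ℕ) (ψ : ℕ+ → ℕ+ → ℂ) (A : Finset (Phys N)) : ℂ :=
  (kernelLOf N ψ).pfOn (Sum.map id (fun p : A => (p : Phys N)))

theorem pfLOf_eq_pfSet (A : Finset (Phys N)) :
    pfLOf N ψ A = (kernelLOf N ψ).pfSet (Finset.disjSum Finset.univ A) := by
  let e : Fin N ⊕ A ≃ (Finset.disjSum (Finset.univ : Finset (Fin N)) A : Finset (VPhys N)) :=
    { toFun := fun s => ⟨Sum.map id (fun p : A => (p : Phys N)) s, by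
        rcases s with i | p <;> simp⟩
      invFun := fun s => match s with
        | ⟨.inl i, _⟩ => .inl i
        | ⟨.inr p, h⟩ => .inr ⟨p, by simpa using h⟩
      left_inv := by
        rintro (i | p) <;> rfl
      right_inv := by
        rintro ⟨i | p, h⟩ <;> rfl }
  exact Kernel2.pfOn_congr _ e fun i => rfl

/-- In the Fredholm expansion over the points of the box outside `S`, the removed points form the
complement of a configuration containing `S`. -/
theorem sum_pfLOf_eq_pfSet (n : ℕ+) {S : Finset (Phys N)} (hS : S ⊆ physBox N n) :
    ∑ A ∈ (physBox N n).powerset.filter (S ⊆ ·), pfLOf N ψ A =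
      (kernelLOf N ψ + kernelJOn ((physBox N n \ S).map Function.Embedding.inr)).pfSet
        (fullBox N n) := by
  rw [Kernel2.pfSet_add_kernelJOn]
  · refine Finset.sum_bij' (fun A _ => (physBox N n \ A).map Function.Embedding.inr)
      (fun B _ => physBox N n \ B.toRight) ?_ ?_ ?_ ?_ ?_
    · intro A hA
      rw [Finset.mem_filter, Finset.mem_powerset] at hA
      rw [Finset.mem_powerset]
      exact Finset.map_subset_map.mpr (Finset.sdiff_subset_sdiff le_rfl hA.2)
    · intro B hB
      rw [Finset.mem_powerset, Finset.subset_map_inr] at hB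
      rw [Finset.mem_filter, Finset.mem_powerset]
      refine ⟨Finset.sdiff_subset, fun p hp => ?_⟩
      rw [Finset.mem_sdiff]
      exact ⟨hS hp, fun h => (Finset.mem_sdiff.mp (hB.2 h)).2 hp⟩
    · intro A hA
      rw [Finset.mem_filter, Finset.mem_powerset] at hA
      ext p
      have := @hA.1 p
      simp only [Finset.mem_sdiff, Finset.mem_toRight, Finset.mem_map]
      simp
      tauto
    · intro B hB
      rw [Finset.mem_powerset, Finset.subset_map_inr] at hB
      ext s
      rcases s with i | p
      · have : Sum.inl i ∉ B := by
          rw [← Finset.mem_toLeft, hB.1]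
          simp
        simp [this]
      · have h1 : Sum.inr p ∈ B → p ∈ physBox N n := fun h =>
          (Finset.mem_sdiff.mp (hB.2 (Finset.mem_toRight.mpr h))).1
        simp
        tauto
    · intro A hA
      rw [Finset.mem_filter, Finset.mem_powerset] at hA
      rw [pfLOf_eq_pfSet]
      congr 1
      ext s
      rcases s with i | p
      · simp [fullBox]
      · have := @hA.1 p
        simp [fullBox]
        tauto
  · intro s hs
    simp only [Finset.mem_map, Function.Embedding.inr_apply] at hs
    obtain ⟨p, hp, rfl⟩ := hs
    rw [inr_mem_fullBox, ← mem_physBox]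
    exact (Finset.mem_sdiff.mp hp).1

variable {ψ}

/-- The correlation identity for the truncated process. -/
theorem sum_pfLOf_eq_mul (hN : Even N) (hψ : HasDecay ψ) (hskew : ∀ x y, ψ x y = -ψ y x)
    {n : ℕ+} (hG : (pathGram N (truncKernel ψ n)).det ≠ 0) {S : Finset (Phys N)}
    (hS : S ⊆ physBox N n) :
    ∑ A ∈ (physBox N n).powerset.filter (S ⊆ ·), pfLOf N ψ A =
      pfPairs (kernelMatrix (kernelT N ψ) (fullBox N n)) *
        (corrKernel N (inverseT N (truncKernel ψ n))).pfOn fun x : S => (x : Phys N) := by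
  rw [sum_pfLOf_eq_pfSet ψ n hS]
  let g : S → fullBox N n := fun x =>
    ⟨.inr x.1, inr_mem_fullBox.mpr (mem_physBox.mp (hS x.2))⟩
  have hg : Function.Injective g := by
    intro x y h
    have := congrArg Subtype.val h
    exact Subtype.ext (Sum.inr_injective this)
  have h := pfPairs_sub_sympl (kernelMatrix_transpose (inverseT_isSkew (N := N)
    (truncKernel_skew hskew n)) (fullBox N n)) (kernelMatrix_mul_inverse hN hψ hskew hG) g hg
  -- On the box, adding `J` to `L` away from `S` is the same as subtracting `J_S` from `J_X + L`.
  have hL : (kernelLOf N ψ + kernelJOn ((physBox N n \ S).map Function.Embedding.inr)).pfSet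
      (fullBox N n) = pfPairs (Matrix.of fun p q : fullBox N n × Fin 2 =>
        kernelMatrix (kernelT N ψ) (fullBox N n) p q -
          if p.1 = q.1 ∧ p.1 ∈ Set.range g then sympl p.2 q.2 else 0) := by
    rw [Kernel2.pfSet, Kernel2.pfOn]
    congr 1
    ext ⟨⟨z, hz⟩, a⟩ ⟨⟨z', hz'⟩, b⟩
    simp only [Matrix.of_apply, kernelMatrix, Pi.add_apply, Matrix.add_apply, kernelT,
      kernelJOn_apply, Subtype.mk.injEq]
    have hJ : (if z = z' ∧ z ∈ (physBox N n \ S).map Function.Embedding.inr then sympl a b else 0) =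
        kernelJX N z z' a b -
          if z = z' ∧ (⟨z, hz⟩ : fullBox N n) ∈ Set.range g then sympl a b else 0 := by
      by_cases hzz : z = z'
      · subst hzz
        rcases z with i | p
        · have : (⟨.inl i, hz⟩ : fullBox N n) ∉ Set.range g := by
            rintro ⟨x, hx⟩
            have := congrArg Subtype.val hx
            simp [g] at this
          simp [kernelJX, this]
        · have hiff : (⟨.inr p, hz⟩ : fullBox N n) ∈ Set.range g ↔ p ∈ S := by
            constructor
            · rintro ⟨x, hx⟩
              have := congrArg Subtype.val hx
              simp only [g, Sum.inr.injEq] at this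
              rw [← this]
              exact x.2
            · intro hp
              exact ⟨⟨p, hp⟩, rfl⟩
          have hp : p ∈ physBox N n := mem_physBox.mpr (inr_mem_fullBox.mp hz)
          have hj : kernelJX N (.inr p) (.inr p) a b = sympl a b := by
            simp [kernelJX, kernelJ, sympl]
          rw [hj]
          simp only [hiff]
          by_cases hpS : p ∈ S <;> simp [hpS, hp]
      · have hj : kernelJX N z z' a b = 0 := by
          rcases z with i | p <;> rcases z' with j | q
          · simp [kernelJX]
          · simp [kernelJX]
          · simp [kernelJX]
          · have : p ≠ q := fun h => hzz (by rw [h])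
            simp [kernelJX, kernelJ, this]
        simp [hzz, hj]
    rw [hJ]
    ring
  rw [hL, h, Kernel2.pfOn]
  congr 1
  congr 1
  ext ⟨x, a⟩ ⟨y, b⟩
  simp only [Matrix.of_apply, symplMatrix, corrKernel, Matrix.add_apply, kernelMatrix, g, kernelJ]
  congr 1
  by_cases hxy : x = y
  · simp [hxy, sympl]
  · have : (x : Phys N) ≠ y := fun h => hxy (Subtype.ext h)
    simp [hxy, this]

end FiniteIdentity

/-! ### Absolute convergence of the Fredholm Pfaffian. -/

noncomputable section FredholmSummability

open Filter Topology

variable {N : ℕ}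

theorem norm_pfaff_le {ι : Type*} [Fintype ι] [DecidableEq ι] {A : ι × Fin 2 → ι × Fin 2 → ℂ}
    {B : ℝ} (hA : ∀ p q, ‖A p q‖ ≤ B) :
    ‖pfaff A‖ ≤ ((2 : ℝ) ^ Fintype.card ι * Nat.factorial (Fintype.card ι))⁻¹ *
      (Nat.factorial (2 * Fintype.card ι) * B ^ Fintype.card ι) := by
  rw [pfaff_eq_pfPolar, norm_mul]
  refine mul_le_mul (le_of_eq ?_) ?_ (norm_nonneg _) (by positivity)
  · simp
  · unfold pfPolar
    refine (norm_sum_le _ _).trans ?_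
    have : ∀ σ : Equiv.Perm (ι × Fin 2), ‖((Equiv.Perm.sign σ : ℤ) : ℂ) *
        ∏ i, A (σ (i, 0)) (σ (i, 1))‖ ≤ B ^ Fintype.card ι := by
      intro σ
      rw [norm_mul, norm_prod]
      have h1 : ‖((Equiv.Perm.sign σ : ℤ) : ℂ)‖ = 1 := by
        rcases Int.units_eq_one_or (Equiv.Perm.sign σ) with h | h <;> simp [h]
      rw [h1, one_mul]
      refine (Finset.prod_le_prod (fun _ _ => norm_nonneg _) fun i _ => hA _ _).trans ?_
      simp
    refine (Finset.sum_le_sum fun σ _ => this σ).trans (le_of_eq ?_)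
    rw [Finset.sum_const, Finset.card_univ, Fintype.card_perm, nsmul_eq_mul]
    simp [mul_comm]

theorem summable_prod_fin {X : Type*} {f : X → ℝ} (h0 : ∀ x, 0 ≤ f x) (hf : Summable f) (n : ℕ) :
    Summable fun z : Fin n → X => ∏ i, f (z i) := by
  induction n with
  | zero => exact Summable.of_finite
  | succ n ih =>
    rw [← (Fin.consEquiv fun _ => X).summable_iff]
    have := hf.mul_of_nonneg ih h0 fun z => Finset.prod_nonneg fun i _ => h0 _
    refine this.congr fun p => ?_
    simp [Fin.prod_univ_succ, Fin.consEquiv]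

theorem exists_one_lt_pow_le {η : ℝ} (h1 : η < 1) (N : ℕ) :
    ∃ θ : ℝ, 1 < θ ∧ θ ^ N * η ≤ 1 := by
  have hlim : Tendsto (fun θ : ℝ => θ ^ N * η) (𝓝[>] 1) (𝓝 (1 ^ N * η)) :=
    (((continuous_pow N).mul_const η).tendsto 1).mono_left nhdsWithin_le_nhds
  rw [one_pow, one_mul] at hlim
  obtain ⟨θ, hθ, hθ1⟩ := ((hlim.eventually_lt_const h1).and self_mem_nhdsWithin).exists
  exact ⟨θ, hθ1, hθ.le⟩

/-- Exponential decay of `Pf [L]` in the positions of the physical points. -/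
theorem exists_norm_pfOn_le {ψ : ℕ+ → ℕ+ → ℂ} (hψ : HasDecay ψ) (n : ℕ) :
    ∃ B τ : ℝ, 0 < τ ∧ τ < 1 ∧ ∀ z : Fin n → Phys N,
      ‖(kernelLOf N ψ).pfOn (Sum.map id z)‖ ≤ B * ∏ i, τ ^ ((z i).2 : ℕ) := by
  obtain ⟨C, η, h0, h1, hb⟩ := hψ
  obtain ⟨θ, hθ1, hθ⟩ := exists_one_lt_pow_le h1 N
  have hθ0 : 0 < θ := by linarith
  have hCnn : 0 ≤ C := by
    have := (norm_nonneg _).trans (hb 1 1)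
    by_contra hC
    have h2 : C * (η ^ ((1 : ℕ+) : ℕ) * η ^ ((1 : ℕ+) : ℕ)) < 0 :=
      mul_neg_of_neg_of_pos (not_le.mp hC) (by positivity)
    linarith
  let D : ℝ := max 1 C
  have hD1 : 1 ≤ D := le_max_left _ _
  have hDC : C ≤ D := le_max_right _ _
  let m := Fintype.card (Fin N ⊕ Fin n)
  refine ⟨((2 : ℝ) ^ m * Nat.factorial m)⁻¹ * (Nat.factorial (2 * m) * (3 * D) ^ m), θ⁻¹,
    inv_pos.mpr hθ0, inv_lt_one_of_one_lt₀ hθ1, fun z => ?_⟩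
  -- A diagonal congruence that leaves the entries bounded. At a point of height `x` in row `k`,
  -- counted from 0, the weights are `θ ^ (-k x)` and `θ ^ ((k + 1) x)`. Entries of `φ` stay at most
  -- 1 because paths do not descend, entries of `ψ` stay bounded because `θ ^ N * η ≤ 1`, and the
  -- two weights of a point multiply to `θ ^ x`, which is the decay gained.
  let f : (Fin N ⊕ Fin n) × Fin 2 → ℝ := fun p => match p with
    | (.inl _, _) => 1
    | (.inr i, a) => if a = 1 then θ ^ (((z i).1.val + 1) * ((z i).2 : ℕ))
        else θ⁻¹ ^ ((z i).1.val * ((z i).2 : ℕ))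
  have hf0 : ∀ p, 0 < f p := by
    rintro ⟨i | i, a⟩
    · exact one_pos
    · simp only [f]
      split_ifs <;> positivity
  let A : (Fin N ⊕ Fin n) × Fin 2 → (Fin N ⊕ Fin n) × Fin 2 → ℂ := fun p q =>
    kernelLOf N ψ (Sum.map id z p.1) (Sum.map id z q.1) p.2 q.2
  have hprod : ∏ p, f p = ∏ i, θ ^ ((z i).2 : ℕ) := by
    rw [Fintype.prod_prod_type, Fintype.prod_sum_type]
    simp only [Fin.prod_univ_two, f]
    rw [Finset.prod_eq_one (fun _ _ => one_mul _), one_mul]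
    refine Finset.prod_congr rfl fun i _ => ?_
    simp only [zero_ne_one, if_false, if_true]
    rw [add_mul, one_mul, pow_add, ← mul_assoc, ← mul_pow, inv_mul_cancel₀ hθ0.ne', one_pow,
      one_mul]
  have hle1 : θ⁻¹ ≤ 1 := (inv_lt_one_of_one_lt₀ hθ1).le
  have hPhi : ∀ i j : Fin n, (z i).1.val + 1 = (z j).1.val → (z i).2 ≤ (z j).2 →
      f (.inr i, 1) * f (.inr j, 0) ≤ 1 := by
    intro i j hij hle
    simp only [f, if_true, zero_ne_one, if_false]
    rw [← hij, inv_pow, ← div_eq_mul_inv, div_le_one (by positivity)]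
    exact pow_le_pow_right₀ hθ1.le (Nat.mul_le_mul_left _ hle)
  have hPsi : ∀ i j : Fin n, (z i).1.val + 1 = N → (z j).1.val + 1 = N →
      f (.inr i, 1) * f (.inr j, 1) * ‖ψ (z i).2 (z j).2‖ ≤ D := by
    intro i j hi hj
    have hfi : ∀ i : Fin n, (z i).1.val + 1 = N → f (.inr i, 1) * η ^ ((z i).2 : ℕ) ≤ 1 := by
      intro i hi
      simp only [f, if_true]
      rw [hi, pow_mul, ← mul_pow]
      exact pow_le_one₀ (by positivity) hθ
    calc f (.inr i, 1) * f (.inr j, 1) * ‖ψ (z i).2 (z j).2‖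
        ≤ f (.inr i, 1) * f (.inr j, 1) * (C * (η ^ ((z i).2 : ℕ) * η ^ ((z j).2 : ℕ))) :=
          mul_le_mul_of_nonneg_left (hb _ _)
            (mul_pos (hf0 (.inr i, 1)) (hf0 (.inr j, 1))).le
      _ = C * ((f (.inr i, 1) * η ^ ((z i).2 : ℕ)) * (f (.inr j, 1) * η ^ ((z j).2 : ℕ))) := by
          ring
      _ ≤ C * (1 * 1) := by
          refine mul_le_mul_of_nonneg_left ?_ hCnn
          exact mul_le_mul (hfi i hi) (hfi j hj) 
            (mul_pos (hf0 (.inr j, 1)) (pow_pos h0 _)).le zero_le_one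
      _ ≤ D := by simpa using hDC
  have hD0 : ∀ i : Fin n, f (.inr i, 0) ≤ 1 := by
    intro i
    simp only [f, zero_ne_one, if_false]
    exact pow_le_one₀ (by positivity) hle1
  have hbound : ∀ p q, ‖(f p : ℂ) * (f q : ℂ) * A p q‖ ≤ 3 * D := by
    intro p q
    rw [norm_mul, norm_mul, Complex.norm_real, Complex.norm_real, Real.norm_of_nonneg (hf0 p).le,
      Real.norm_of_nonneg (hf0 q).le]
    rcases p with ⟨i | i, a⟩ <;> rcases q with ⟨j | j, b⟩
    · simp only [f, A, Sum.map_inl, id, kernelLOf_inl_inl, mul_one, one_mul]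
      have : ‖if a = 0 ∧ b = 0 then thetaMatrix N i j else 0‖ ≤ 2 := by
        split_ifs
        · simp only [thetaMatrix, Matrix.of_apply]
          refine (norm_add_le _ _).trans ?_
          have e1 : ‖if i.val + 1 = j.val then (-1 : ℂ) else 0‖ ≤ 1 := by split_ifs <;> simp
          have e2 : ‖if j.val + 1 = i.val then (1 : ℂ) else 0‖ ≤ 1 := by split_ifs <;> simp
          linarith
        · simp
      linarith
    · simp only [A, Sum.map_inl, Sum.map_inr, id, kernelLOf_inl_inr]
      split_ifs with h
      · obtain ⟨_, _, rfl⟩ := h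
        have : f (.inl i, a) = 1 := rfl
        rw [this, norm_one, mul_one, one_mul]
        linarith [hD0 j]
      · simp only [norm_zero, mul_zero]
        linarith
    · simp only [A, Sum.map_inl, Sum.map_inr, id, kernelLOf_inr_inl]
      split_ifs with h
      · obtain ⟨_, rfl, _⟩ := h
        have : f (.inl j, b) = 1 := rfl
        rw [this, norm_neg, norm_one, mul_one, mul_one]
        linarith [hD0 i]
      · simp only [norm_zero, mul_zero]
        linarith
    · simp only [A, Sum.map_inr, kernelLOf_inr_inr]
      have hff : 0 ≤ f (.inr i, a) * f (.inr j, b) :=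
        (mul_pos (hf0 (.inr i, a)) (hf0 (.inr j, b))).le
      refine (mul_le_mul_of_nonneg_left (norm_add₃_le) hff).trans ?_
      rw [mul_add, mul_add]
      have e1 : f (.inr i, a) * f (.inr j, b) * ‖if (z i).1.val + 1 = (z j).1.val ∧
          (z i).2 ≤ (z j).2 ∧ a = 1 ∧ b = 0 then (1 : ℂ) else 0‖ ≤ D := by
        split_ifs with h
        · obtain ⟨h1, h2, rfl, rfl⟩ := h
          rw [norm_one, mul_one]
          exact (hPhi i j h1 h2).trans hD1
        · simp only [norm_zero, mul_zero]
          linarith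
      have e2 : f (.inr i, a) * f (.inr j, b) * ‖if (z j).1.val + 1 = (z i).1.val ∧
          (z j).2 ≤ (z i).2 ∧ a = 0 ∧ b = 1 then (-1 : ℂ) else 0‖ ≤ D := by
        split_ifs with h
        · obtain ⟨h1, h2, rfl, rfl⟩ := h
          rw [norm_neg, norm_one, mul_one, mul_comm]
          exact (hPhi j i h1 h2).trans hD1
        · simp only [norm_zero, mul_zero]
          linarith
      have e3 : f (.inr i, a) * f (.inr j, b) * ‖if (z i).1.val + 1 = N ∧
          (z j).1.val + 1 = N ∧ a = 1 ∧ b = 1 then ψ (z i).2 (z j).2 else 0‖ ≤ D := by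
        split_ifs with h
        · obtain ⟨h1, h2, rfl, rfl⟩ := h
          exact hPsi i j h1 h2
        · simp only [norm_zero, mul_zero]
          linarith
      linarith
  have hscale := pfaff_smul_diag (fun p => (f p : ℂ)) A
  have hn := norm_pfaff_le hbound
  rw [hscale, norm_mul, ← Complex.ofReal_prod, Complex.norm_real, hprod,
    Real.norm_of_nonneg (by positivity)] at hn
  have hP : 0 < ∏ i, θ ^ ((z i).2 : ℕ) := Finset.prod_pos fun i _ => by positivity
  change ‖pfaff A‖ ≤ _
  have hinv : ∏ i, θ⁻¹ ^ ((z i).2 : ℕ) = (∏ i, θ ^ ((z i).2 : ℕ))⁻¹ := by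
    rw [← Finset.prod_inv_distrib]
    simp only [inv_pow]
  rw [hinv, ← div_eq_mul_inv, le_div_iff₀ hP, mul_comm]
  exact hn

theorem summable_pow_phys {τ : ℝ} (h0 : 0 < τ) (h1 : τ < 1) :
    Summable fun p : Phys N => τ ^ (p.2 : ℕ) := by
  have h2 : Summable fun x : ℕ+ => τ ^ (x : ℕ) :=
    (summable_geometric_of_lt_one h0.le h1).comp_injective PNat.coe_injective
  have h3 : Summable fun _ : Fin N => (1 : ℝ) := Summable.of_finite
  have := h3.mul_of_nonneg h2 (fun _ => zero_le_one) fun _ => by positivity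
  simpa using this

theorem card_eq_of_pfOn_ne_zero {ψ : ℕ+ → ℕ+ → ℂ} {n : ℕ} (z : Fin n → Phys N)
    (h : (kernelLOf N ψ).pfOn (Sum.map id z) ≠ 0) : n = ∑ k : Fin N, (k.val + 1) := by
  have h1 := Finset.card_eq_sum_card_fiberwise (s := (Finset.univ : Finset (Fin n)))
    (t := (Finset.univ : Finset (Fin N))) (f := fun i => (z i).1) fun _ _ => by simp
  rw [Finset.card_univ, Fintype.card_fin] at h1
  rw [h1]
  exact Finset.sum_congr rfl fun k _ => card_fiber_eq_of_pfOn_ne_zero ψ z h k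

/-- The terms of the Fredholm Pfaffian for a general last-row kernel. -/
def fredholmTermOf (N : ℕ) (ψ : ℕ+ → ℕ+ → ℂ) (s : Σ n : ℕ, (Fin n → Phys N)) : ℂ :=
  (Nat.factorial s.1 : ℂ)⁻¹ * (kernelLOf N ψ).pfOn (Sum.map id s.2)

/-- Only tuples of the size of a triangular array contribute, so the series lives on a single `n`
and no control of the growth in `n` is needed. -/
theorem summable_fredholmTermOf {ψ : ℕ+ → ℕ+ → ℂ} (hψ : HasDecay ψ) :
    Summable (fredholmTermOf N ψ) := by
  let n := ∑ k : Fin N, (k.val + 1)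
  obtain ⟨B, τ, h0, h1, hB⟩ := exists_norm_pfOn_le (N := N) hψ n
  have hinj : Function.Injective fun z : Fin n → Phys N => (⟨n, z⟩ : Σ n : ℕ, (Fin n → Phys N)) :=
    fun z z' h => eq_of_heq (Sigma.mk.inj h).2
  rw [← hinj.summable_iff]
  · refine Summable.of_norm_bounded
      (((summable_prod_fin (fun p => by positivity) (summable_pow_phys (N := N) h0 h1) n).mul_left
        B).mul_left (Nat.factorial n : ℝ)⁻¹) fun z => ?_
    simp only [Function.comp_apply, fredholmTermOf, norm_mul, norm_inv, Complex.norm_natCast]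
    exact mul_le_mul_of_nonneg_left (hB z) (by positivity)
  · rintro ⟨m, z⟩ hz
    by_contra hne
    have hm : m = n := card_eq_of_pfOn_ne_zero z (right_ne_zero_of_mul hne)
    subst hm
    exact hz ⟨z, rfl⟩

/-- Enumerated finite sets as injective tuples. -/
def enumTuple (s : Σ A : Finset (Phys N), (Fin A.card ≃ A)) : Σ n : ℕ, (Fin n → Phys N) :=
  ⟨s.1.card, fun i => (s.2 i : Phys N)⟩

theorem image_enumTuple (s : Σ A : Finset (Phys N), (Fin A.card ≃ A)) :
    Finset.univ.image (enumTuple s).2 = s.1 := by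
  ext p
  simp only [Finset.mem_image, enumTuple]
  constructor
  · rintro ⟨i, _, rfl⟩
    exact (s.2 i).2
  · intro hp
    exact ⟨s.2.symm ⟨p, hp⟩, Finset.mem_univ _, by simp⟩

theorem enumTuple_injective : Function.Injective (enumTuple (N := N)) := by
  rintro ⟨A, e⟩ ⟨A', e'⟩ h
  have hA : A = A' := by
    have h1 := image_enumTuple ⟨A, e⟩
    have h2 := image_enumTuple ⟨A', e'⟩
    rw [h] at h1
    exact h1.symm.trans h2
  subst hA
  have h2 := eq_of_heq (Sigma.mk.inj h).2
  have : e = e' := Equiv.ext fun i => Subtype.ext (congrFun h2 i)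
  rw [this]

theorem mem_range_enumTuple {n : ℕ} {z : Fin n → Phys N} (hz : Function.Injective z) :
    (⟨n, z⟩ : Σ n : ℕ, (Fin n → Phys N)) ∈ Set.range (enumTuple (N := N)) := by
  have hcard : (Finset.univ.image z).card = n := by
    rw [Finset.card_image_of_injective _ hz, Finset.card_univ, Fintype.card_fin]
  let e : Fin n ≃ (Finset.univ.image z : Finset (Phys N)) := Equiv.ofBijective
    (fun i => ⟨z i, by simp⟩) ⟨fun i j h => hz (congrArg Subtype.val h), fun p => by
      obtain ⟨i, _, hi⟩ := Finset.mem_image.mp p.2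
      exact ⟨i, Subtype.ext hi⟩⟩
  refine ⟨⟨Finset.univ.image z, (finCongr hcard).trans e⟩, ?_⟩
  have key : ∀ m (h : m = n),
      (⟨m, fun i => z (finCongr h i)⟩ : Σ n : ℕ, (Fin n → Phys N)) = ⟨n, z⟩ := by
    rintro m rfl
    rfl
  exact key _ hcard

/-- The Fredholm Pfaffian is the total mass of `A ↦ Pf [L restricted to V ∪ A]`. -/
theorem hasSum_pfLOf {ψ : ℕ+ → ℕ+ → ℂ} (hψ : HasDecay ψ) :
    HasSum (pfLOf N ψ) (∑' s, fredholmTermOf N ψ s) := by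
  have h1 := (summable_fredholmTermOf (N := N) hψ).hasSum
  rw [← enumTuple_injective.hasSum_iff] at h1
  -- A finite set has as many listings as the factorial in the prefactor; tuples with repetitions
  -- contribute zero.
  · refine h1.sigma fun A => ?_
    have hterm : ∀ e : Fin A.card ≃ A, (fredholmTermOf N ψ ∘ enumTuple) ⟨A, e⟩ =
        (Nat.factorial A.card : ℂ)⁻¹ * pfLOf N ψ A := by
      intro e
      simp only [Function.comp_apply, fredholmTermOf, enumTuple, pfLOf]
      congr 1
      refine Kernel2.pfOn_congr _ (Equiv.sumCongr (Equiv.refl _) e) fun i => ?_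
      rcases i with i | i <;> rfl
    simp only [hterm]
    have hcard : Fintype.card (Fin A.card ≃ A) = Nat.factorial A.card := by
      rw [Fintype.card_equiv (A.equivFin).symm, Fintype.card_fin]
    have := hasSum_fintype fun _ : Fin A.card ≃ A =>
      (Nat.factorial A.card : ℂ)⁻¹ * pfLOf N ψ A
    rw [Finset.sum_const, Finset.card_univ, hcard, nsmul_eq_mul, ← mul_assoc,
      mul_inv_cancel₀ (by exact_mod_cast Nat.factorial_ne_zero _), one_mul] at this
    exact this
  · rintro ⟨n, z⟩ hz
    have hni : ¬ Function.Injective z := fun h => hz (mem_range_enumTuple h)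
    rw [Function.Injective] at hni
    push Not at hni
    obtain ⟨i, j, hij, hne⟩ := hni
    simp only [fredholmTermOf]
    rw [Kernel2.pfOn_eq_zero_of_eq (i := .inr i) (j := .inr j) _ _ (by simpa using hne)
      (by simp [hij]), mul_zero]

end FredholmSummability

/-! ### Infinite-volume correlation functions and nonvanishing of the total mass. -/

noncomputable section Correlations

open Filter Topology

variable {N : ℕ} {ψ : ℕ+ → ℕ+ → ℂ}

theorem tendsto_pfOn_corrKernel (hψ : HasDecay ψ) (hG : (pathGram N ψ).det ≠ 0)
    (S : Finset (Phys N)) :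
    Tendsto (fun n => (corrKernel N (inverseT N (truncKernel ψ n))).pfOn fun x : S => (x : Phys N))
      atTop (𝓝 ((corrKernel N (inverseT N ψ)).pfOn fun x : S => (x : Phys N))) := by
  unfold Kernel2.pfOn pfPairs
  refine Tendsto.const_mul _ (tendsto_finsetSum _ fun σ _ => Tendsto.const_mul _
    (tendsto_finsetProd _ fun i _ => ?_))
  exact (tendsto_inverseT hψ hG _ _ _ _).const_add _

theorem corrKernel_isSkew {M : Kernel2 (VPhys N)} (hM : M.IsSkew) : (corrKernel N M).IsSkew := by
  intro p q a b
  simp only [corrKernel, Matrix.add_apply, neg_add]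
  rw [hM]
  congr 1
  by_cases hpq : p = q
  · subst hpq
    fin_cases a <;> fin_cases b <;> simp [kernelJ]
  · simp [kernelJ, hpq, Ne.symm hpq]

theorem tendsto_powerset_physBox :
    Tendsto (fun n => (physBox N n).powerset) atTop atTop := by
  refine tendsto_atTop_finset_of_monotone (fun m n h => Finset.powerset_mono.mpr fun p hp => ?_)
    fun A => ?_
  · exact mem_physBox.mpr ((mem_physBox.mp hp).trans h)
  · obtain ⟨n, hn⟩ := (A.image Prod.snd).exists_le
    exact ⟨n, Finset.mem_powerset.mpr fun p hp =>
      mem_physBox.mpr (hn _ (Finset.mem_image_of_mem _ hp))⟩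

theorem eventually_subset_physBox (S : Finset (Phys N)) : ∀ᶠ n in atTop, S ⊆ physBox N n := by
  filter_upwards [tendsto_powerset_physBox.eventually_ge_atTop {S}] with n hn
  exact Finset.mem_powerset.mp (hn (Finset.mem_singleton_self S))

theorem sum_filter_eq_sum_indicator (S : Finset (Phys N)) (n : ℕ+) :
    ∑ A ∈ (physBox N n).powerset.filter (S ⊆ ·), pfLOf N ψ A =
      ∑ A ∈ (physBox N n).powerset, {A | S ⊆ A}.indicator (pfLOf N ψ) A := by
  rw [Finset.sum_filter]
  refine Finset.sum_congr rfl fun A _ => ?_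
  by_cases h : S ⊆ A <;> simp [h]

/-- By the finite identity with `S` empty, the Pfaffians on boxes are eventually the partial sums of
the total mass. -/
theorem tendsto_pfPairs_kernelT (hN : Even N) (hψ : HasDecay ψ) (hskew : ∀ x y, ψ x y = -ψ y x)
    (hG : (pathGram N ψ).det ≠ 0) :
    Tendsto (fun n => pfPairs (kernelMatrix (kernelT N ψ) (fullBox N n))) atTop
      (𝓝 (∑' s, fredholmTermOf N ψ s)) := by
  refine ((hasSum_pfLOf (N := N) hψ).comp tendsto_powerset_physBox).congr' ?_
  filter_upwards [eventually_det_pathGram_ne_zero hψ hG] with n hn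
  have h := sum_pfLOf_eq_mul hN hψ hskew hn (Finset.empty_subset (physBox N n))
  have h1 : (corrKernel N (inverseT N (truncKernel ψ n))).pfOn
      (fun x : (∅ : Finset (Phys N)) => (x : Phys N)) = 1 := by
    simp [Kernel2.pfOn, pfPairs]
  rw [h1, mul_one] at h
  rw [← h]
  simp

/-- The unnormalized correlation functions. -/
theorem hasSum_indicator_pfLOf (hN : Even N) (hψ : HasDecay ψ) (hskew : ∀ x y, ψ x y = -ψ y x)
    (hG : (pathGram N ψ).det ≠ 0) (S : Finset (Phys N)) :
    HasSum ({A | S ⊆ A}.indicator (pfLOf N ψ)) ((∑' s, fredholmTermOf N ψ s) *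
      (corrKernel N (inverseT N ψ)).pfOn fun x : S => (x : Phys N)) := by
  have hsum := ((hasSum_pfLOf (N := N) hψ).summable.indicator {A | S ⊆ A}).hasSum
  -- Summability is already known, so the limit may be taken along boxes. There the finite identity
  -- gives a product whose two factors converge separately.
  have h1 := hsum.comp tendsto_powerset_physBox
  have h2 := (tendsto_pfPairs_kernelT hN hψ hskew hG).mul (tendsto_pfOn_corrKernel hψ hG S)
  have h3 := tendsto_nhds_unique (h1.congr' ?_) h2
  · rwa [h3] at hsum
  · filter_upwards [eventually_det_pathGram_ne_zero hψ hG, eventually_subset_physBox S] with n hn hS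
    rw [← sum_pfLOf_eq_mul hN hψ hskew hn hS, sum_filter_eq_sum_indicator]
    rfl

theorem card_eq_of_pfLOf_ne_zero {A : Finset (Phys N)} (h : pfLOf N ψ A ≠ 0) :
    A.card = ∑ k : Fin N, (k.val + 1) := by
  have hA : IsTriangular A := by
    by_contra hA
    exact h (pfOn_eq_zero_of_not_isTriangular ψ hA)
  rw [Finset.card_eq_sum_card_fiberwise (f := Prod.fst) (t := Finset.univ) fun _ _ => by simp]
  exact Finset.sum_congr rfl fun k _ => hA k

/-- Configurations of nonzero weight all have the same cardinality, so the correlation sum at such a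
set `S` reduces to the weight of `S`. If the total mass were zero, every weight would vanish, and so
would the Pfaffian of an invertible finite matrix. -/
theorem tsum_fredholmTermOf_ne_zero (hN : Even N) (hψ : HasDecay ψ)
    (hskew : ∀ x y, ψ x y = -ψ y x) (hG : (pathGram N ψ).det ≠ 0) :
    ∑' s, fredholmTermOf N ψ s ≠ 0 := by
  intro hZ
  have hzero : ∀ S, pfLOf N ψ S = 0 := by
    intro S
    by_contra hS
    have h1 := hasSum_indicator_pfLOf hN hψ hskew hG S
    rw [hZ, zero_mul] at h1
    have h2 : HasSum ({A | S ⊆ A}.indicator (pfLOf N ψ)) (pfLOf N ψ S) := by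
      have h3 := hasSum_single (f := {A | S ⊆ A}.indicator (pfLOf N ψ)) S fun A hA => by
        by_contra h
        obtain ⟨hSA, hA0⟩ := Set.indicator_apply_ne_zero.mp h
        refine hA (Finset.eq_of_subset_of_card_le hSA ?_).symm
        rw [card_eq_of_pfLOf_ne_zero hA0, card_eq_of_pfLOf_ne_zero hS]
      rwa [Set.indicator_of_mem (show S ∈ {A | S ⊆ A} from Finset.Subset.refl S)] at h3
    exact hS (h2.unique h1)
  obtain ⟨n, hn⟩ := (eventually_det_pathGram_ne_zero hψ hG).exists
  have h := sum_pfLOf_eq_mul hN hψ hskew hn (Finset.empty_subset (physBox N n))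
  have h1 : (corrKernel N (inverseT N (truncKernel ψ n))).pfOn
      (fun x : (∅ : Finset (Phys N)) => (x : Phys N)) = 1 := by
    simp [Kernel2.pfOn, pfPairs]
  rw [h1, mul_one, Finset.sum_eq_zero fun A _ => hzero A] at h
  exact pfPairs_ne_zero_of_inverse (kernelMatrix_transpose (kernelT_isSkew ψ hskew) _)
    (kernelMatrix_transpose (inverseT_isSkew (truncKernel_skew hskew n)) _)
    (kernelMatrix_mul_inverse hN hψ hskew hn) h.symm

theorem isPfaffianPointProcess_of_hasDecay (hN : Even N) (hψ : HasDecay ψ)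
    (hskew : ∀ x y, ψ x y = -ψ y x) (hG : (pathGram N ψ).det ≠ 0) :
    IsPfaffianPointProcess (fun A => pfLOf N ψ A / ∑' s, fredholmTermOf N ψ s)
      (corrKernel N (inverseT N ψ)) := by
  refine ⟨corrKernel_isSkew (inverseT_isSkew hskew), fun S => ?_⟩
  have h := (hasSum_subtype_iff_indicator.mpr (hasSum_indicator_pfLOf hN hψ hskew hG S)).div_const
    (∑' s, fredholmTermOf N ψ s)
  rwa [mul_div_cancel_left₀ _ (tsum_fredholmTermOf_ne_zero hN hψ hskew hG)] at h

end Correlations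


theorem theorem4p6 (N : ℕ) (hN : Even N) (α t r R : ℝ) (hα : 0 ≤ α) (ht : 0 ≤ t)
    (hrR : AdmissibleRadii α r R) :
    (kernelL N α t r R).IsSkew ∧
    (∀ A : Finset (Phys N),
      (∀ z : TriArray N ℕ+, Enumerates z A →
        pfL N α t r R A = weightW N α t r R z.toInt) ∧
      (¬ IsTriangular A → pfL N α t r R A = 0)) ∧
    (0 < α → 0 < t →
      Summable (fredholmTerm N α t r R) ∧
      fredholmPf N α t r R ≠ 0 ∧
      (∃ M : Kernel2 (VPhys N),
        (kernelJX N + kernelL N α t r R).IsInverse M ∧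
        (∀ M' : Kernel2 (VPhys N), (kernelJX N + kernelL N α t r R).IsInverse M' → M' = M) ∧
        IsPfaffianPointProcess (muN N α t r R) (corrKernel N M)) ∧
      (∀ A : Finset (Phys N), ¬ IsTriangular A → muN N α t r R A = 0) ∧
      (∃ c : ℂ, c ≠ 0 ∧ ∀ (A : Finset (Phys N)) (z : TriArray N ℕ+), Enumerates z A →
        muN N α t r R A = c * weightW N α t r R z.toInt)) := by
  have hL : kernelL N α t r R = kernelLOf N (psiKernel α t r R) := kernelL_eq_kernelLOf N α t r R
  have hskew := psiKernel_skew (t := t) hrR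
  have hpf : pfL N α t r R = pfLOf N (psiKernel α t r R) := by
    funext A
    rw [pfL, pfLOf, hL]
  have hterm : fredholmTerm N α t r R = fredholmTermOf N (psiKernel α t r R) := by
    funext s
    rw [fredholmTerm, fredholmTermOf, hL]
  have hoff : ∀ A : Finset (Phys N), ¬ IsTriangular A → pfL N α t r R A = 0 := by
    intro A hA
    rw [hpf]
    exact pfOn_eq_zero_of_not_isTriangular _ hA
  refine ⟨?_, fun A => ⟨pfL_eq_weightW hN α t r R A, hoff A⟩, fun hα0 ht0 => ?_⟩
  · rw [hL]
    exact kernelLOf_isSkew _ hskew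
  have hψ := psiKernel_hasDecay ht hrR
  have hG := det_pathGram_psiKernel_ne_zero hN hα0 ht0 hrR
  have hZ : fredholmPf N α t r R ≠ 0 := by
    rw [fredholmPf, hterm]
    exact tsum_fredholmTermOf_ne_zero hN hψ hskew hG
  refine ⟨?_, hZ, ⟨inverseT N (psiKernel α t r R), ?_, fun M' hM' => ?_, ?_⟩, fun A hA => ?_,
    (fredholmPf N α t r R)⁻¹, inv_ne_zero hZ, fun A z hz => ?_⟩
  · rw [hterm]
    exact summable_fredholmTermOf hψ
  · rw [hL]
    exact isInverse_inverseT hN hψ hskew hG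
  · rw [hL] at hM'
    exact inverseT_unique hN hψ hskew hG hM'
  · have h := isPfaffianPointProcess_of_hasDecay hN hψ hskew hG
    rw [← hterm, ← hpf] at h
    exact h
  · rw [muN, hoff A hA, zero_div]
  · rw [muN, pfL_eq_weightW hN α t r R A z hz, div_eq_inv_mul]
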